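/- Let $r\ge 0$ and let $\mathbb{C}_S=\mathbb{C}_{S[2r]}=\mathbb{R}_{S[2r]}\otimes\mathbb{C}$ be the complex Grassmann algebra on $2r$ generators $\beta_{[1]},\dots,\beta_{[2r]}$, with even and odd parts $(\mathbb{C}_S)_0,(\mathbb{C}_S)_1$, body map $\epsilon:\mathbb{C}_S\to\mathbb{C}$ and soul $\sigma(z)=z-\epsilon(z)$. Let ${}^\Diamond:\mathbb{C}_S\to\mathbb{C}_S$ be a graded involution: additive, $(zw)^\Diamond=z^\Diamond w^\Diamond$, $(cz)^\Diamond=\bar c\,z^\Diamond$ for $c\in\mathbb{C}$, degree preserving, and $z^{\Diamond\Diamond}=(-1)^{|z|}z$ for homogeneous $z$. Put $$S^{2,2}=\Bigl\{(x_1,x_2,x_3,\xi_1,\xi_2)\in(\mathbb{C}_S)_0^3\times(\mathbb{C}_S)_1^2\ \Big|\ \sum_i x_i^2+2\xi_1\xi_2=1,\ x_i^\Diamond=x_i,\ \xi_1^\Diamond=\xi_2\Bigr\},$$ $$UOSP(1,2)=\{s(a,b,\eta)\mid a,b\in(\mathbb{C}_S)_0,\ \eta\in(\mathbb{C}_S)_1,\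 aa^\Diamond+bb^\Diamond=1\},\qquad \mathcal{U}(1)=\{w\in(\mathbb{C}_S)_0\mid ww^\Diamond=1\},$$ $$s(a,b,\eta)=\begin{pmatrix}1+\frac14\eta\eta^\Diamond&-\frac12\eta&\frac12\eta^\Diamond\\-\frac12(a\eta^\Diamond-b^\Diamond\eta)&a(1-\frac18\eta\eta^\Diamond)&-b^\Diamond(1-\frac18\eta\eta^\Diamond)\\-\frac12(b\eta^\Diamond+a^\Diamond\eta)&b(1-\frac18\eta\eta^\Diamond)&a^\Diamond(1-\frac18\eta\eta^\Diamond)\end{pmatrix},$$ where $w\in\mathcal{U}(1)$ acts by right multiplication with $\mathrm{diag}(1,w,w^\Diamond)$. Let $h:UOSP(1,2)\to S^{2,2}$ be given by $x_1=(aa^\Diamond-bb^\Diamond)(1-\frac14\eta\eta^\Diamond)$, $x_2=(ab^\Diamond+ba^\Diamond)(1-\frac14\eta\eta^\Diamond)$, $x_3=-i(ab^\Diamond-ba^\Diamond)(1-\frac14\eta\eta^\Diamond)$, $\xi_1=-\frac12(a\eta^\Diamond+\eta b^\Diamond)$, $\xi_2=\frac12(\eta a^\Diamond-b\eta^\Diamond)$.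 Let $L'\ge 0$ be an integer. A $\mathbb{C}_S$-valued function on $S^{2,2}$ (respectively on $UOSP(1,2)$) is of class $GH^\infty$ if locally in the DeWitt topology it has the form $\sum_{\mu}\widehat{f_\mu}(x)\,\xi_\mu$, where $x$ are the even coordinates ($x_1,x_2,x_3$, respectively the $\Diamond$-real and $\Diamond$-imaginary parts of $a$ and $b$), $\xi_\mu$ runs through the products $1,\xi_1,\xi_2,\xi_1\xi_2$ of the odd coordinates ($\xi_1,\xi_2$, respectively $\eta,\eta^\Diamond$), the $f_\mu$ are smooth functions of the bodies of the even coordinates with values in the subalgebra $\mathbb{C}_{S[L']}\subset\mathbb{C}_S$ generated by the $\beta_{[i]}$ with $i\le L'$, and $\widehat{f}(x)=\sum_i\frac1{i!}\partial^if(\epsilon(x))\sigma(x)^i$ is the Grassmann analytic continuation. Let $\mathcal{A}$ and $\mathcal{B}$ be the rings of $GH^\infty$ functions on $S^{2,2}$ and on $UOSP(1,2)$, graded by the parity of the values. Let $\mathcal{A}^{n+1,n}$ be the free right $\mathcal{A}$-supermodule of columns with $2n+1$ entries in $\mathcal{A}$, whose first $n+1$ basis vectors are even and whose last $n$ are odd;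 define $\mathcal{B}^{n+1,n}$ likewise. For $n\ge1$ let $\langle\psi_n|$ be the row $$\Bigl(\bigl(1-\tfrac18\eta\eta^\Diamond\bigr)\sqrt{\tbinom nk}\,(a^\Diamond)^{n-k}(b^\Diamond)^k\ (0\le k\le n);\ \tfrac12\eta^\Diamond\sqrt{\tbinom{n-1}k}\,(a^\Diamond)^{n-1-k}(b^\Diamond)^k\ (0\le k\le n-1)\Bigr),$$ let $|\psi_n\rangle$ be its $\Diamond$-conjugate transpose, and $p_n=|\psi_n\rangle\langle\psi_n|$. Then, for every $n\ge1$: 1. $h$ induces an isomorphism $UOSP(1,2)/\mathcal{U}(1)\cong S^{2,2}$: it is surjective, its fibres are exactly the $\mathcal{U}(1)$-orbits, and a function $f$ on $S^{2,2}$ is $GH^\infty$ if and only if $f\circ h$ is. 2. $\mathcal{A}$ is a super commutative ring and $\mathcal{A}^{n+1,n}$ is a supermodule over it. 3. $F\mapsto p_nF$ is a well-defined idempotent $\mathcal{B}$-linear endomorphism $\pi_n$ of $\mathcal{B}^{n+1,n}$. 4. There is a unique $\mathcal{A}$-linear map $\widetilde{\pi}_n:\mathcal{A}^{n+1,n}\to\mathcal{A}^{n+1,n}$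 with $(\widetilde{\pi}_nF)(h(s))=p_n(s)F(h(s))$ for all $F\in\mathcal{A}^{n+1,n}$ and $s\in UOSP(1,2)$. It is even and idempotent, and $\operatorname{Im}\widetilde{\pi}_n$ is a super projective $\mathcal{A}$-module: there is an $\mathcal{A}$-supermodule $Q$ such that $\operatorname{Im}\widetilde{\pi}_n\oplus Q$ is isomorphic, by an even isomorphism, to a free $\mathcal{A}$-supermodule of some type $(I,J)$. -/

import Mathlib

open scoped BigOperators ContDiff
open MulOpposite

/-! ## Superrings, supermodules, super projective modules -/

/-- `R = R₀ ⊕ R₁` is a super commutative ring: the ring `R` with the subgroups `𝒜 0`, `𝒜 1` is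
`ℤ/2`-graded, and `a b = (-1)^{|a||b|} b a` for homogeneous `a`, `b`. -/
structure IsSuperCommRing {R : Type*} [Ring R] (𝒜 : ZMod 2 → AddSubgroup R) : Prop where
  graded : SetLike.GradedMonoid 𝒜
  internal : DirectSum.IsInternal 𝒜
  supercomm : ∀ (i j : ZMod 2) (a b : R), a ∈ 𝒜 i → b ∈ 𝒜 j →
    a * b = (-1) ^ (i.val * j.val) * (b * a)

/-- `M = M₀ ⊕ M₁` is a right supermodule over the superring `R = R₀ ⊕ R₁`.
A right `R`-module is a module over the opposite ring `Rᵐᵒᵖ`, with `x a = op a • x`. -/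
structure IsSuperModule {R M : Type*} [Ring R] [AddCommGroup M] [Module Rᵐᵒᵖ M]
    (𝒜 : ZMod 2 → AddSubgroup R) (ℳ : ZMod 2 → AddSubgroup M) : Prop where
  internal : DirectSum.IsInternal ℳ
  smul_mem : ∀ (i j : ZMod 2) (a : R) (x : M), x ∈ ℳ i → a ∈ 𝒜 j → op a • x ∈ ℳ (i + j)

/-- The grading of the module of columns `(f ; g)` with entries in `R`, the entries `f` being
indexed by `I` and the entries `g` by `J`. A column has degree `i` when its `I`-entries have
degree `i` and its `J`-entries have degree `i + 1`, so that the basis vectors with index in `I`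
are even and those with index in `J` are odd. -/
def columnGrading {R : Type*} [Ring R] (𝒜 : ZMod 2 → AddSubgroup R) (I J : Type*)
    (i : ZMod 2) : AddSubgroup (I ⊕ J → R) where
  carrier := {v | (∀ k : I, v (Sum.inl k) ∈ 𝒜 i) ∧ ∀ k : J, v (Sum.inr k) ∈ 𝒜 (i + 1)}
  zero_mem' := ⟨fun _ => zero_mem _, fun _ => zero_mem _⟩
  add_mem' hv hw := ⟨fun k => add_mem (hv.1 k) (hw.1 k), fun k => add_mem (hv.2 k) (hw.2 k)⟩
  neg_mem' hv := ⟨fun k => neg_mem (hv.1 k), fun k => neg_mem (hv.2 k)⟩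

/-- The grading of the free supermodule `(I ⊕ J) →₀ R` of type `(I, J)`. -/
noncomputable def freeGrading {R : Type*} [Ring R] (𝒜 : ZMod 2 → AddSubgroup R) (I J : Type*)
    (i : ZMod 2) : AddSubgroup ((I ⊕ J) →₀ R) :=
  (columnGrading 𝒜 I J i).comap Finsupp.coeFnAddHom

/-- The supermodule `P` is super projective: it is a supermodule, and there is a supermodule `Q`
such that `P ⊕ Q` is isomorphic, by a degree preserving isomorphism, to a free supermodule of
some type `(I, J)`. -/
def IsSuperProjective {R P : Type} [Ring R] [AddCommGroup P] [Module Rᵐᵒᵖ P]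
    (𝒜 : ZMod 2 → AddSubgroup R) (𝒩 : ZMod 2 → AddSubgroup P) : Prop :=
  IsSuperModule 𝒜 𝒩 ∧
  ∃ (I J Q : Type) (_ : AddCommGroup Q) (_ : Module Rᵐᵒᵖ Q) (𝒬 : ZMod 2 → AddSubgroup Q),
    IsSuperModule 𝒜 𝒬 ∧
    ∃ e : (P × Q) ≃ₗ[Rᵐᵒᵖ] ((I ⊕ J) →₀ R),
      ∀ (i : ZMod 2) (z : P × Q), (z.1 ∈ 𝒩 i ∧ z.2 ∈ 𝒬 i) ↔ e z ∈ freeGrading 𝒜 I J i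

/-- The grading `N_i = N ∩ M_i` of a submodule `N` of a graded module `M`. -/
def submoduleGrading {R M : Type*} [Ring R] [AddCommGroup M] [Module Rᵐᵒᵖ M]
    (ℳ : ZMod 2 → AddSubgroup M) (N : Submodule Rᵐᵒᵖ M) (i : ZMod 2) : AddSubgroup N :=
  (ℳ i).comap N.subtype.toAddMonoidHom

/-! ## The complex Grassmann algebra -/

/-- The complex Grassmann algebra `ℂ_{S[L]} = ℝ_{S[L]} ⊗ ℂ` with `L` generators. -/
abbrev Gr (L : ℕ) : Type := ExteriorAlgebra ℂ (Fin L → ℂ)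

namespace Gr

variable {L : ℕ}

/-- The even (`i = 0`) and odd (`i = 1`) part of the Grassmann algebra. -/
def part (L : ℕ) (i : ZMod 2) : Submodule ℂ (Gr L) :=
  CliffordAlgebra.evenOdd (0 : QuadraticForm ℂ (Fin L → ℂ)) i

/-- The generators `β_[1], …, β_[L]`. -/
noncomputable def gen (i : Fin L) : Gr L := ExteriorAlgebra.ι ℂ (Pi.single i (1 : ℂ))

/-- The subalgebra `ℂ_{S[L']}` of `ℂ_{S[L]}` generated by the first `L'` generators. -/
noncomputable def sub (L L' : ℕ) : Subalgebra ℂ (Gr L) :=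
  Algebra.adjoin ℂ {z | ∃ i : Fin L, i.val < L' ∧ z = gen i}

/-- The body map. -/
noncomputable def body (z : Gr L) : ℂ := ExteriorAlgebra.algebraMapInv z

/-- The soul map. -/
noncomputable def soul (z : Gr L) : Gr L := z - algebraMap ℂ (Gr L) (body z)

end Gr

/-- A graded involution `z ↦ z^◇` of the complex Grassmann algebra: an additive, multiplicative,
conjugate linear, degree preserving map with `z^◇◇ = (-1)^{|z|} z` for homogeneous `z`. -/
structure GradedInvolution (L : ℕ) where
  toFun : Gr L → Gr L
  map_add : ∀ z w, toFun (z + w) = toFun z + toFun w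
  map_mul : ∀ z w, toFun (z * w) = toFun z * toFun w
  map_smul : ∀ (c : ℂ) (z), toFun (c • z) = (starRingEnd ℂ) c • toFun z
  map_mem : ∀ (i : ZMod 2) (z), z ∈ Gr.part L i → toFun z ∈ Gr.part L i
  toFun_toFun : ∀ (i : ZMod 2) (z), z ∈ Gr.part L i → toFun (toFun z) = (-1 : ℂ) ^ i.val • z

instance (L : ℕ) : CoeFun (GradedInvolution L) (fun _ => Gr L → Gr L) := ⟨GradedInvolution.toFun⟩

/-! ## Functions of class `GH^∞` -/

/-- The partial derivative `∂_j g` of a function on `ℝ^m`. -/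
noncomputable def partialD {m : ℕ} (j : Fin m) (g : (Fin m → ℝ) → ℂ) : (Fin m → ℝ) → ℂ :=
  fun v => fderiv ℝ g v (Pi.single j 1)

/-- `(∑_j s_j ∂_j)^k g` at the point `v`, for Grassmann valued coefficients `s_j`. -/
noncomputable def taylorTerm {L m : ℕ} (s : Fin m → Gr L) :
    ℕ → ((Fin m → ℝ) → ℂ) → (Fin m → ℝ) → Gr L
  | 0, g, v => algebraMap ℂ (Gr L) (g v)
  | k + 1, g, v => ∑ j, s j * taylorTerm s k (partialD j g) v

/-- The body of a tuple of even elements whose bodies are real. -/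
noncomputable def realBody {L m : ℕ} (x : Fin m → Gr L) : Fin m → ℝ :=
  fun j => (Gr.body (x j)).re

/-- The Grassmann analytic continuation of the smooth function `g`,
`ĝ(x) = ∑_i (1 / i!) ∂^i g(ε(x)) σ(x)^i` (sum over multi-indices `i ∈ ℕ^m`); the terms with
`|i| = k` add up to `(1 / k!) (∑_j σ(x_j) ∂_j)^k g (ε(x))`, and those with `|i| > L` vanish. -/
noncomputable def grassmannCont {L m : ℕ} (g : (Fin m → ℝ) → ℂ) (x : Fin m → Gr L) : Gr L :=
  ∑ k ∈ Finset.range (L + 1),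
    ((Nat.factorial k : ℂ)⁻¹) • taylorTerm (fun j => Gr.soul (x j)) k g (realBody x)

/-- Global coordinates on `X`: `m` even ones `x_1, …, x_m` and two odd ones `ξ_1, ξ_2`. -/
structure SuperCoords (L m : ℕ) (X : Type) where
  x : X → Fin m → Gr L
  ξ : X → Fin 2 → Gr L
  x_mem : ∀ p j, x p j ∈ Gr.part L 0
  ξ_mem : ∀ p j, ξ p j ∈ Gr.part L 1

/-- Over the DeWitt open set of points with body in `V`, the function `F` is the Grassmann analytic
continuation `∑_k ĝ_k(x) e_k` of a smooth function `∑_k g_k e_k : V → ℂ_{S[L']}`. -/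
def IsContinuation {L m : ℕ} {X : Type} (c : SuperCoords L m X) (L' : ℕ) (V : Set (Fin m → ℝ))
    (F : X → Gr L) : Prop :=
  ∃ (κ : Type) (_ : Fintype κ) (g : κ → (Fin m → ℝ) → ℂ) (e : κ → Gr L),
    (∀ k, ContDiffOn ℝ ∞ (g k) V) ∧ (∀ k, e k ∈ Gr.sub L L') ∧
    ∀ p, realBody (c.x p) ∈ V → F p = ∑ k, grassmannCont (g k) (c.x p) * e k

/-- The function `f` is of class `GH^∞` in the coordinates `c`: in the DeWitt topology it is locally
of the form `∑_μ f̂_μ(x) ξ_μ` with smooth `ℂ_{S[L']}`-valued coefficients `f_μ`, where `ξ_μ` runs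
through `1, ξ_1, ξ_2, ξ_1 ξ_2`. -/
def IsGH {L m : ℕ} {X : Type} (c : SuperCoords L m X) (L' : ℕ) (f : X → Gr L) : Prop :=
  ∀ p₀ : X, ∃ V : Set (Fin m → ℝ), IsOpen V ∧ realBody (c.x p₀) ∈ V ∧
    ∃ F : Fin 2 → Fin 2 → X → Gr L, (∀ i j, IsContinuation c L' V (F i j)) ∧
      ∀ p, realBody (c.x p) ∈ V →
        f p = ∑ i, ∑ j, F i j p * (c.ξ p 0 ^ (i : ℕ) * c.ξ p 1 ^ (j : ℕ))

/-! Closure of the class `GH^∞` under the ring operations. -/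

namespace Gr

variable {L : ℕ}

theorem ι_swap (v w : Fin L → ℂ) : (ExteriorAlgebra.ι ℂ v * ExteriorAlgebra.ι ℂ w : Gr L) =
    -(ExteriorAlgebra.ι ℂ w * ExteriorAlgebra.ι ℂ v) :=
  eq_neg_of_add_eq_zero_left (ExteriorAlgebra.ι_add_mul_swap v w)

theorem even_comm_ι {z : Gr L} (hz : z ∈ part L 0) (v : Fin L → ℂ) :
    z * ExteriorAlgebra.ι ℂ v = ExteriorAlgebra.ι ℂ v * z := by
  induction z, hz using CliffordAlgebra.even_induction with
  | algebraMap r => exact Algebra.commutes r _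
  | add x y hx hy ihx ihy => rw [add_mul, ihx, ihy, mul_add]
  | ι_mul_ι_mul m₁ m₂ x hx ih =>
    change ExteriorAlgebra.ι ℂ m₁ * ExteriorAlgebra.ι ℂ m₂ * x * _ =
      _ * (ExteriorAlgebra.ι ℂ m₁ * ExteriorAlgebra.ι ℂ m₂ * x)
    rw [mul_assoc, ih, ← mul_assoc, mul_assoc _ _ (ExteriorAlgebra.ι ℂ v), ι_swap m₂ v, mul_neg,
      ← mul_assoc, ι_swap m₁ v]
    noncomm_ring

/-- Even elements are central. -/
theorem even_comm {z : Gr L} (hz : z ∈ part L 0) (w : Gr L) : z * w = w * z := by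
  induction w using ExteriorAlgebra.induction with
  | algebraMap r => exact (Algebra.commutes r z).symm
  | ι v => exact even_comm_ι hz v
  | mul a b ha hb => rw [← mul_assoc, ha, mul_assoc, hb, mul_assoc]
  | add a b ha hb => rw [mul_add, ha, hb, add_mul]

theorem odd_anticomm_ι {z : Gr L} (hz : z ∈ part L 1) (v : Fin L → ℂ) :
    z * ExteriorAlgebra.ι ℂ v = -(ExteriorAlgebra.ι ℂ v * z) := by
  induction z, hz using CliffordAlgebra.odd_induction with
  | ι w => exact ι_swap w v
  | add x y hx hy ihx ihy => rw [add_mul, ihx, ihy, mul_add, neg_add]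
  | ι_mul_ι_mul m₁ m₂ x hx ih =>
    change ExteriorAlgebra.ι ℂ m₁ * ExteriorAlgebra.ι ℂ m₂ * x * _ =
      -(_ * (ExteriorAlgebra.ι ℂ m₁ * ExteriorAlgebra.ι ℂ m₂ * x))
    rw [mul_assoc, ih, mul_neg, ← mul_assoc, mul_assoc _ _ (ExteriorAlgebra.ι ℂ v), ι_swap m₂ v,
      mul_neg, ← mul_assoc, ι_swap m₁ v]
    noncomm_ring

/-- The automorphism `z ↦ (-1)^{|z|} z`. -/
def parity (L : ℕ) : Gr L →ₐ[ℂ] Gr L := CliffordAlgebra.involute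

theorem parity_ι (v : Fin L → ℂ) :
    parity L (ExteriorAlgebra.ι ℂ v) = -ExteriorAlgebra.ι ℂ v :=
  CliffordAlgebra.involute_ι v

theorem odd_mul {z : Gr L} (hz : z ∈ part L 1) (w : Gr L) : z * w = parity L w * z := by
  induction w using ExteriorAlgebra.induction with
  | algebraMap r => simp [Algebra.commutes]
  | ι v => rw [odd_anticomm_ι hz v, parity_ι, neg_mul]
  | mul a b ha hb => rw [← mul_assoc, ha, mul_assoc, hb, map_mul, mul_assoc]
  | add a b ha hb => rw [mul_add, ha, hb, map_add, add_mul]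

theorem parity_even {z : Gr L} (hz : z ∈ part L 0) : parity L z = z :=
  CliffordAlgebra.involute_eq_of_mem_even hz

theorem parity_odd {z : Gr L} (hz : z ∈ part L 1) : parity L z = -z :=
  CliffordAlgebra.involute_eq_of_mem_odd hz

theorem odd_swap {z w : Gr L} (hz : z ∈ part L 1) (hw : w ∈ part L 1) : z * w = -(w * z) := by
  rw [odd_mul hz, parity_odd hw, neg_mul]

theorem odd_sq {z : Gr L} (hz : z ∈ part L 1) : z * z = 0 := by
  have h := odd_swap hz hz
  have h2 : (2 : ℂ) • (z * z) = 0 := by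
    rw [two_smul]; nth_rewrite 1 [h]; simp
  exact (smul_eq_zero.mp h2).resolve_left two_ne_zero

theorem even_mul {z w : Gr L} (hz : z ∈ part L 0) (hw : w ∈ part L 0) : z * w ∈ part L 0 :=
  CliffordAlgebra.evenOdd_mul_le _ 0 0 (Submodule.mul_mem_mul hz hw)

theorem algebraMap_mem (c : ℂ) : algebraMap ℂ (Gr L) c ∈ part L 0 :=
  SetLike.algebraMap_mem_graded (CliffordAlgebra.evenOdd (0 : QuadraticForm ℂ (Fin L → ℂ))) c

theorem one_even : (1 : Gr L) ∈ part L 0 := SetLike.GradedOne.one_mem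
  (A := CliffordAlgebra.evenOdd (0 : QuadraticForm ℂ (Fin L → ℂ)))

theorem soul_even {z : Gr L} (hz : z ∈ part L 0) : soul z ∈ part L 0 :=
  Submodule.sub_mem _ hz (algebraMap_mem _)

theorem parity_sub {L' : ℕ} {z : Gr L} (hz : z ∈ sub L L') : parity L z ∈ sub L L' := by
  induction hz using Algebra.adjoin_induction with
  | mem x hx =>
    obtain ⟨i, hi, rfl⟩ := hx
    rw [gen, parity_ι]
    exact neg_mem (Algebra.subset_adjoin ⟨i, hi, rfl⟩)
  | algebraMap r => rw [AlgHom.commutes]; exact Subalgebra.algebraMap_mem _ r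
  | add x y _ _ hx hy => rw [map_add]; exact add_mem hx hy
  | mul x y _ _ hx hy => rw [map_mul]; exact mul_mem hx hy

/-- The span of the generators. -/
noncomputable def V1 (L : ℕ) : Submodule ℂ (Gr L) := LinearMap.range (ExteriorAlgebra.ι ℂ)

theorem V1_pow : V1 L ^ (L + 1) = ⊥ := by
  have h : Module.finrank ℂ (⋀[ℂ]^(L + 1) (Fin L → ℂ)) = 0 := by
    rw [exteriorPower.finrank_eq]; simp
  exact (Submodule.finrank_eq_zero (S := ⋀[ℂ]^(L + 1) (Fin L → ℂ))).mp h

theorem top_mul_V1 : (⊤ : Submodule ℂ (Gr L)) * V1 L ≤ V1 L * ⊤ := by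
  rw [Submodule.mul_le]
  rintro z - _ ⟨v, rfl⟩
  have h := odd_mul (CliffordAlgebra.ι_mem_evenOdd_one (0 : QuadraticForm ℂ (Fin L → ℂ)) v)
    (parity L z)
  have h2 : parity L (parity L z) = z := CliffordAlgebra.involute_involute z
  rw [h2] at h
  exact h ▸ Submodule.mul_mem_mul ⟨v, rfl⟩ Submodule.mem_top

theorem exists_decomp (z : Gr L) : ∃ c : ℂ, ∃ u ∈ V1 L * ⊤, z = algebraMap ℂ _ c + u := by
  have hR : ∀ u ∈ V1 L * ⊤, ∀ w : Gr L, u * w ∈ V1 L * ⊤ := fun u hu w => by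
    have := Submodule.mul_mem_mul hu (Submodule.mem_top (x := w))
    rw [mul_assoc] at this
    exact mul_le_mul_right (le_top (a := (⊤ * ⊤ : Submodule ℂ (Gr L)))) _ this
  induction z using ExteriorAlgebra.induction with
  | algebraMap r => exact ⟨r, 0, zero_mem _, by simp⟩
  | ι v => exact ⟨0, _, Submodule.mul_mem_mul ⟨v, rfl⟩ (Submodule.mem_top (x := 1)), by simp⟩
  | mul a b ha hb =>
    obtain ⟨c, u, hu, rfl⟩ := ha
    obtain ⟨d, w, hw, rfl⟩ := hb
    refine ⟨c * d, c • w + u * (algebraMap ℂ _ d + w),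
      add_mem (Submodule.smul_mem _ _ hw) (hR _ hu _), ?_⟩
    rw [map_mul, Algebra.smul_def]; noncomm_ring
  | add a b ha hb =>
    obtain ⟨c, u, hu, rfl⟩ := ha
    obtain ⟨d, w, hw, rfl⟩ := hb
    exact ⟨c + d, u + w, add_mem hu hw, by rw [map_add]; abel⟩

theorem body_algebraMap (c : ℂ) : body (algebraMap ℂ (Gr L) c) = c := by simp [body]

theorem body_V1 {u : Gr L} (hu : u ∈ V1 L * ⊤) : body u = 0 := by
  induction hu using Submodule.mul_induction_on' with
  | mem_mul_mem m hm n _ =>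
    obtain ⟨v, rfl⟩ := hm
    simp [body, ExteriorAlgebra.algebraMapInv]
  | add x _ y _ hx hy =>
    have : body (x + y) = body x + body y := by simp [body]
    rw [this, hx, hy, add_zero]

theorem soul_mem (z : Gr L) : soul z ∈ V1 L * ⊤ := by
  obtain ⟨c, u, hu, rfl⟩ := exists_decomp z
  have h : body (algebraMap ℂ (Gr L) c + u) = c := by
    have : body (algebraMap ℂ (Gr L) c + u) = body (algebraMap ℂ (Gr L) c) + body u := by
      simp [body]
    rw [this, body_algebraMap, body_V1 hu, add_zero]
  simpa [soul, h] using hu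

/-- The filtration by powers of the ideal of elements with vanishing body. -/
noncomputable def fil (L k : ℕ) : Submodule ℂ (Gr L) := V1 L ^ k * ⊤

theorem fil_mul {j k : ℕ} {z w : Gr L} (hz : z ∈ fil L j) (hw : w ∈ fil L k) :
    z * w ∈ fil L (j + k) := by
  have key : ∀ k, (⊤ : Submodule ℂ (Gr L)) * V1 L ^ k ≤ V1 L ^ k * ⊤ := by
    intro k
    induction k with
    | zero => simp
    | succ k ih =>
      rw [pow_succ, ← mul_assoc]
      refine (mul_le_mul_left ih _).trans ?_
      rw [mul_assoc, mul_assoc]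
      exact mul_le_mul_right top_mul_V1 _
  have h : fil L j * fil L k ≤ fil L (j + k) := by
    unfold fil
    rw [pow_add, mul_assoc, mul_assoc]
    refine mul_le_mul_right ?_ _
    rw [← mul_assoc]
    refine (mul_le_mul_left (key k) _).trans ?_
    rw [mul_assoc]
    exact mul_le_mul_right le_top _
  exact h (Submodule.mul_mem_mul hz hw)

theorem fil_eq_zero {k : ℕ} (hk : L < k) {z : Gr L} (hz : z ∈ fil L k) : z = 0 := by
  obtain ⟨m, rfl⟩ := Nat.exists_eq_add_of_lt hk
  rw [show L + m + 1 = (L + 1) + m by ring, fil, pow_add, V1_pow, Submodule.bot_mul,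
    Submodule.bot_mul] at hz
  simpa using hz

end Gr

section Taylor

variable {L m : ℕ} {s : Fin m → Gr L}

theorem taylorTerm_even (hs : ∀ j, s j ∈ Gr.part L 0) (k : ℕ) (g : (Fin m → ℝ) → ℂ)
    (v : Fin m → ℝ) : taylorTerm s k g v ∈ Gr.part L 0 := by
  induction k generalizing g with
  | zero => exact Gr.algebraMap_mem _
  | succ k ih => exact Submodule.sum_mem _ fun j _ => Gr.even_mul (hs j) (ih _)

theorem taylorTerm_fil (hs : ∀ j, s j ∈ Gr.fil L 1) (k : ℕ) (g : (Fin m → ℝ) → ℂ)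
    (v : Fin m → ℝ) : taylorTerm s k g v ∈ Gr.fil L k := by
  induction k generalizing g with
  | zero => simp [Gr.fil]
  | succ k ih =>
    refine Submodule.sum_mem _ fun j _ => ?_
    rw [add_comm]
    exact Gr.fil_mul (hs j) (ih _)

theorem partialD_smooth {V : Set (Fin m → ℝ)} (hV : IsOpen V) {g : (Fin m → ℝ) → ℂ}
    (hg : ContDiffOn ℝ ∞ g V) (j : Fin m) : ContDiffOn ℝ ∞ (partialD j g) V :=
  (hg.fderiv_of_isOpen hV (by simp)).clm_apply contDiffOn_const

theorem taylorTerm_congr {V : Set (Fin m → ℝ)} (hV : IsOpen V) (k : ℕ) (g h : (Fin m → ℝ) → ℂ)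
    (hgh : Set.EqOn g h V) {v : Fin m → ℝ} (hv : v ∈ V) :
    taylorTerm s k g v = taylorTerm s k h v := by
  induction k generalizing g h with
  | zero => simp [taylorTerm, hgh hv]
  | succ k ih =>
    refine Finset.sum_congr rfl fun j _ => ?_
    rw [ih _ (partialD j h)]
    intro w hw
    have : g =ᶠ[nhds w] h := Filter.eventuallyEq_of_mem (hV.mem_nhds hw) hgh
    simp [partialD, this.fderiv_eq]

theorem taylorTerm_add {V : Set (Fin m → ℝ)} (hV : IsOpen V) (k : ℕ) {g h : (Fin m → ℝ) → ℂ}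
    (hg : ContDiffOn ℝ ∞ g V) (hh : ContDiffOn ℝ ∞ h V) {v : Fin m → ℝ} (hv : v ∈ V) :
    taylorTerm s k (g + h) v = taylorTerm s k g v + taylorTerm s k h v := by
  induction k generalizing g h with
  | zero => simp [taylorTerm]
  | succ k ih =>
    simp only [taylorTerm, ← Finset.sum_add_distrib]
    refine Finset.sum_congr rfl fun j _ => ?_
    rw [← mul_add, ← ih (partialD_smooth hV hg j) (partialD_smooth hV hh j)]
    congr 1
    refine taylorTerm_congr hV k _ _ (fun w hw => ?_) hv
    have h1 := (hg.contDiffAt (hV.mem_nhds hw)).differentiableAt (by simp)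
    have h2 := (hh.contDiffAt (hV.mem_nhds hw)).differentiableAt (by simp)
    simp [partialD, fderiv_add h1 h2]

theorem taylorTerm_mul (hs : ∀ j, s j ∈ Gr.part L 0) {V : Set (Fin m → ℝ)} (hV : IsOpen V) (k : ℕ)
    {g h : (Fin m → ℝ) → ℂ} (hg : ContDiffOn ℝ ∞ g V) (hh : ContDiffOn ℝ ∞ h V)
    {v : Fin m → ℝ} (hv : v ∈ V) :
    taylorTerm s k (g * h) v = ∑ ab ∈ Finset.HasAntidiagonal.antidiagonal k,
      (k.choose ab.1 : ℂ) • (taylorTerm s ab.1 g v * taylorTerm s ab.2 h v) := by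
  induction k generalizing g h with
  | zero => simp [taylorTerm]
  | succ k ih =>
    have step : taylorTerm s (k + 1) (g * h) v = ∑ j, s j *
        (taylorTerm s k (partialD j g * h) v + taylorTerm s k (g * partialD j h) v) := by
      refine Finset.sum_congr rfl fun j _ => ?_
      have e := taylorTerm_add (s := s) hV k (g := partialD j g * h) (h := g * partialD j h)
        ((partialD_smooth hV hg j).mul hh) (hg.mul (partialD_smooth hV hh j)) hv
      rw [← e]
      congr 1
      refine taylorTerm_congr hV k _ _ (fun w hw => ?_) hv
      have h1 := (hg.contDiffAt (hV.mem_nhds hw)).differentiableAt (by simp)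
      have h2 := (hh.contDiffAt (hV.mem_nhds hw)).differentiableAt (by simp)
      simp [partialD, fderiv_mul h1 h2]
      ring
    have hc : ∀ a b : ℕ, taylorTerm s a g v * taylorTerm s (b + 1) h v =
        ∑ j, s j * (taylorTerm s a g v * taylorTerm s b (partialD j h) v) := fun a b => by
      simp only [taylorTerm, Finset.mul_sum]
      refine Finset.sum_congr rfl fun j _ => ?_
      rw [← mul_assoc, ← mul_assoc, Gr.even_comm (hs j)]
    have hd : ∀ a b : ℕ, taylorTerm s (a + 1) g v * taylorTerm s b h v =
        ∑ j, s j * (taylorTerm s a (partialD j g) v * taylorTerm s b h v) := fun a b => by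
      simp only [taylorTerm, Finset.sum_mul, mul_assoc]
    have pas := Finset.sum_antidiagonal_choose_succ_nsmul
      (fun a b => taylorTerm s a g v * taylorTerm s b h v) k
    simp only [← Nat.cast_smul_eq_nsmul ℂ] at pas
    rw [step, pas, add_comm]
    simp only [mul_add, Finset.sum_add_distrib, hc, hd, Finset.smul_sum]
    congr 1
    · rw [Finset.sum_comm]
      refine Finset.sum_congr rfl fun j _ => ?_
      rw [ih (partialD_smooth hV hg j) hh, Finset.mul_sum]
      refine Finset.sum_congr rfl fun ab hab => ?_
      rw [mul_smul_comm, Nat.choose_symm_of_eq_add (Finset.HasAntidiagonal.mem_antidiagonal.mp hab).symm]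
    · rw [Finset.sum_comm]
      refine Finset.sum_congr rfl fun j _ => ?_
      rw [ih hg (partialD_smooth hV hh j), Finset.mul_sum]
      refine Finset.sum_congr rfl fun ab hab => ?_
      rw [mul_smul_comm]

theorem grassmannCont_even (x : Fin m → Gr L) (hx : ∀ j, x j ∈ Gr.part L 0)
    (g : (Fin m → ℝ) → ℂ) : grassmannCont g x ∈ Gr.part L 0 :=
  Submodule.sum_mem _ fun k _ =>
    Submodule.smul_mem _ _ (taylorTerm_even (fun j => Gr.soul_even (hx j)) k g _)

theorem grassmannCont_mul {x : Fin m → Gr L} (hx : ∀ j, x j ∈ Gr.part L 0)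
    {V : Set (Fin m → ℝ)} (hV : IsOpen V) {g h : (Fin m → ℝ) → ℂ} (hg : ContDiffOn ℝ ∞ g V)
    (hh : ContDiffOn ℝ ∞ h V) (hv : realBody x ∈ V) :
    grassmannCont (g * h) x = grassmannCont g x * grassmannCont h x := by
  have hs : ∀ j, Gr.soul (x j) ∈ Gr.part L 0 := fun j => Gr.soul_even (hx j)
  have hf : ∀ j, Gr.soul (x j) ∈ Gr.fil L 1 := fun j => by
    simpa [Gr.fil] using Gr.soul_mem (x j)
  let t : ((Fin m → ℝ) → ℂ) → ℕ → Gr L := fun g k =>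
    ((Nat.factorial k : ℂ)⁻¹) • taylorTerm (fun j => Gr.soul (x j)) k g (realBody x)
  have ht : ∀ g k, t g k ∈ Gr.fil L k := fun g k =>
    Submodule.smul_mem _ _ (taylorTerm_fil hf k g _)
  have hm : ∀ k, t (g * h) k = ∑ ab ∈ Finset.HasAntidiagonal.antidiagonal k, t g ab.1 * t h ab.2 := by
    intro k
    simp only [t]
    rw [taylorTerm_mul hs hV k hg hh hv, Finset.smul_sum]
    refine Finset.sum_congr rfl fun ab hab => ?_
    rw [smul_mul_smul_comm, smul_smul]
    congr 1
    have e := Finset.HasAntidiagonal.mem_antidiagonal.mp hab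
    have e2 := Nat.choose_mul_factorial_mul_factorial (n := k) (k := ab.1) (by omega)
    rw [show k - ab.1 = ab.2 by omega] at e2
    have e3 : (k.choose ab.1 : ℂ) * ab.1.factorial * ab.2.factorial = k.factorial := by
      exact_mod_cast e2
    have n1 : (ab.1.factorial : ℂ) ≠ 0 := by exact_mod_cast Nat.factorial_ne_zero _
    have n2 : (ab.2.factorial : ℂ) ≠ 0 := by exact_mod_cast Nat.factorial_ne_zero _
    have n3 : (k.factorial : ℂ) ≠ 0 := by exact_mod_cast Nat.factorial_ne_zero _
    field_simp
    linear_combination e3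
  change ∑ k ∈ Finset.range (L + 1), t (g * h) k =
    (∑ k ∈ Finset.range (L + 1), t g k) * ∑ k ∈ Finset.range (L + 1), t h k
  rw [Finset.sum_congr rfl fun k _ => hm k, Finset.sum_mul_sum, ← Finset.sum_product',
    Finset.sum_sigma']
  symm
  refine Finset.sum_bij_ne_zero (fun ab _ _ => ⟨ab.1 + ab.2, ab⟩) ?_ ?_ ?_ ?_
  · intro ab _ h0
    by_contra hcon
    refine h0 (Gr.fil_eq_zero ?_ (Gr.fil_mul (ht g ab.1) (ht h ab.2)))
    simp at hcon; omega
  · rintro a - - b - - hab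
    simpa using (Sigma.mk.inj_iff.mp hab).2
  · rintro ⟨k, ab⟩ hab h0
    simp only [Finset.mem_sigma, Finset.mem_range, Finset.HasAntidiagonal.mem_antidiagonal] at hab
    refine ⟨ab, by simp; omega, h0, ?_⟩
    obtain ⟨_, rfl⟩ := hab
    rfl
  · intro ab _ _; rfl

theorem grassmannCont_const (x : Fin m → Gr L) (c : ℂ) :
    grassmannCont (fun _ => c) x = algebraMap ℂ (Gr L) c := by
  have h0 : ∀ (k : ℕ) (s : Fin m → Gr L) (v), taylorTerm s k (fun _ => (0 : ℂ)) v = 0 := by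
    intro k s v
    induction k with
    | zero => simp [taylorTerm]
    | succ k ih =>
      have : ∀ j, partialD j (fun _ : Fin m → ℝ => (0 : ℂ)) = fun _ => 0 := fun j => by
        funext w; simp [partialD]
      simp [taylorTerm, this, ih]
  have h1 : ∀ (k : ℕ) (s : Fin m → Gr L) (v), taylorTerm s (k + 1) (fun _ => c) v = 0 := by
    intro k s v
    have : ∀ j, partialD j (fun _ : Fin m → ℝ => c) = fun _ => 0 := fun j => by
      funext w; simp [partialD]
    simp [taylorTerm, this, h0]
  rw [grassmannCont, Finset.sum_range_succ']
  rw [Finset.sum_eq_zero fun k _ => by rw [h1, smul_zero]]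
  simp [taylorTerm]

end Taylor

section Closure

variable {L m L' : ℕ} {X : Type} {c : SuperCoords L m X} {V W : Set (Fin m → ℝ)} {F G : X → Gr L}

theorem IsContinuation.mono (h : IsContinuation c L' V F) (hW : W ⊆ V) :
    IsContinuation c L' W F := by
  obtain ⟨κ, i, g, e, hg, he, hF⟩ := h
  exact ⟨κ, i, g, e, fun k => (hg k).mono hW, he, fun p hp => hF p (hW hp)⟩

theorem IsContinuation.const {e : Gr L} (he : e ∈ Gr.sub L L') :
    IsContinuation c L' V (fun _ => e) :=
  ⟨Unit, inferInstance, fun _ _ => 1, fun _ => e, fun _ => contDiffOn_const, fun _ => he,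
    fun p _ => by simp [grassmannCont_const]⟩

theorem IsContinuation.add (hF : IsContinuation c L' V F) (hG : IsContinuation c L' V G) :
    IsContinuation c L' V (F + G) := by
  obtain ⟨κ, i, g, e, hg, he, hF⟩ := hF
  obtain ⟨κ', i', g', e', hg', he', hG⟩ := hG
  refine ⟨κ ⊕ κ', inferInstance, Sum.elim g g', Sum.elim e e', ?_, ?_, fun p hp => ?_⟩
  · rintro (k | k); exacts [hg k, hg' k]
  · rintro (k | k); exacts [he k, he' k]
  · simp [hF p hp, hG p hp]

theorem IsContinuation.mul (hV : IsOpen V) (hF : IsContinuation c L' V F)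
    (hG : IsContinuation c L' V G) : IsContinuation c L' V (F * G) := by
  obtain ⟨κ, i, g, e, hg, he, hF⟩ := hF
  obtain ⟨κ', i', g', e', hg', he', hG⟩ := hG
  refine ⟨κ × κ', inferInstance, fun k => g k.1 * g' k.2, fun k => e k.1 * e' k.2,
    fun k => (hg k.1).mul (hg' k.2), fun k => mul_mem (he k.1) (he' k.2), fun p hp => ?_⟩
  simp only [Pi.mul_apply, hF p hp, hG p hp, Finset.sum_mul_sum, Fintype.sum_prod_type]
  refine Finset.sum_congr rfl fun k _ => Finset.sum_congr rfl fun l _ => ?_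
  rw [grassmannCont_mul (c.x_mem p) hV (hg k) (hg' l) hp, mul_assoc, mul_assoc, ← mul_assoc (e k),
    ← Gr.even_comm (grassmannCont_even _ (c.x_mem p) (g' l)) (e k), mul_assoc]

theorem IsContinuation.parity (hF : IsContinuation c L' V F) :
    IsContinuation c L' V (fun p => Gr.parity L (F p)) := by
  obtain ⟨κ, i, g, e, hg, he, hF⟩ := hF
  refine ⟨κ, i, g, fun k => Gr.parity L (e k), hg, fun k => Gr.parity_sub (he k), fun p hp => ?_⟩
  simp only [hF p hp, map_sum, map_mul, Gr.parity_even (grassmannCont_even _ (c.x_mem p) _)]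

theorem isGH_const {e : Gr L} (he : e ∈ Gr.sub L L') : IsGH c L' (fun _ => e) := fun p₀ => by
  refine ⟨Set.univ, isOpen_univ, trivial, fun i j => if i = 0 ∧ j = 0 then fun _ => e else
    fun _ => 0, fun i j => ?_, fun p _ => ?_⟩
  · dsimp only
    split_ifs
    exacts [.const he, .const (zero_mem _)]
  · simp [Fin.sum_univ_two]

theorem IsGH.add {f g : X → Gr L} (hf : IsGH c L' f) (hg : IsGH c L' g) : IsGH c L' (f + g) := by
  intro p₀
  obtain ⟨V, hV, hp, F, hF, hf⟩ := hf p₀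
  obtain ⟨W, hW, hq, G, hG, hg⟩ := hg p₀
  refine ⟨V ∩ W, hV.inter hW, ⟨hp, hq⟩, fun i j => F i j + G i j, fun i j =>
    ((hF i j).mono Set.inter_subset_left).add ((hG i j).mono Set.inter_subset_right), ?_⟩
  intro p hp
  simp only [Pi.add_apply, hf p hp.1, hg p hp.2, Fin.sum_univ_two]
  noncomm_ring

theorem IsGH.mul {f g : X → Gr L} (hf : IsGH c L' f) (hg : IsGH c L' g) : IsGH c L' (f * g) := by
  intro p₀
  obtain ⟨V, hV, hp, F, hF, hf⟩ := hf p₀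
  obtain ⟨W, hW, hq, G, hG, hg⟩ := hg p₀
  have hF' := fun i j => (hF i j).mono (Set.inter_subset_left (s := V) (t := W))
  have hG' := fun i j => (hG i j).mono (Set.inter_subset_right (s := V) (t := W))
  have hO := hV.inter hW
  let a : (X → Gr L) → X → Gr L := fun F p => Gr.parity L (F p)
  have m1 : (-1 : Gr L) ∈ Gr.sub L L' := neg_mem (one_mem _)
  refine ⟨V ∩ W, hO, ⟨hp, hq⟩, ![![F 0 0 * G 0 0, F 0 0 * G 0 1 + F 0 1 * a (G 0 0)],
    ![F 0 0 * G 1 0 + F 1 0 * a (G 0 0),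
      (F 0 0 * G 1 1 + F 1 1 * G 0 0) +
        (F 1 0 * a (G 0 1) + (fun _ => -1) * (F 0 1 * a (G 1 0)))]], ?_, ?_⟩
  · intro i j
    fin_cases i <;> fin_cases j
    · exact (hF' 0 0).mul hO (hG' 0 0)
    · exact ((hF' 0 0).mul hO (hG' 0 1)).add ((hF' 0 1).mul hO (hG' 0 0).parity)
    · exact ((hF' 0 0).mul hO (hG' 1 0)).add ((hF' 1 0).mul hO (hG' 0 0).parity)
    · exact (((hF' 0 0).mul hO (hG' 1 1)).add ((hF' 1 1).mul hO (hG' 0 0))).add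
        (((hF' 1 0).mul hO (hG' 0 1).parity).add
          ((IsContinuation.const m1).mul hO ((hF' 0 1).mul hO (hG' 1 0).parity)))
  · intro p hp
    simp only [Pi.mul_apply, hf p hp.1, hg p hp.2, Fin.sum_univ_two]
    have h0 := c.ξ_mem p 0
    have h1 := c.ξ_mem p 1
    generalize c.ξ p 0 = u at *
    generalize c.ξ p 1 = w at *
    simp [a]
    have uu : ∀ z, u * (u * z) = 0 := fun z => by rw [← mul_assoc, Gr.odd_sq h0, zero_mul]
    have wu : ∀ z, w * (u * z) = -(u * (w * z)) := fun z => by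
      rw [← mul_assoc, Gr.odd_swap h1 h0, neg_mul, mul_assoc]
    have hp2 : ∀ z, Gr.parity L (Gr.parity L z) = z := CliffordAlgebra.involute_involute
    have cu : ∀ z t, u * (G z t p) = Gr.parity L (G z t p) * u := fun z t => Gr.odd_mul h0 _
    have cw : ∀ z t, w * (G z t p) = Gr.parity L (G z t p) * w := fun z t => Gr.odd_mul h1 _
    have cu' : ∀ z t y, u * (G z t p * y) = Gr.parity L (G z t p) * (u * y) := fun z t y => by
      rw [← mul_assoc, cu, mul_assoc]
    have cw' : ∀ z t y, w * (G z t p * y) = Gr.parity L (G z t p) * (w * y) := fun z t y => by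
      rw [← mul_assoc, cw, mul_assoc]
    have pu' : ∀ z y, u * (Gr.parity L z * y) = z * (u * y) := fun z y => by
      rw [← mul_assoc, Gr.odd_mul h0, hp2, mul_assoc]
    simp only [mul_add, add_mul, mul_assoc, cu, cw, cu', cw', pu', uu, wu, Gr.odd_sq h0,
      Gr.odd_sq h1, Gr.odd_swap h1 h0, mul_neg, neg_mul, mul_zero, add_zero,
      neg_zero]
    abel

end Closure

/-- The algebra `GH^∞(X, ℂ_{S[L]})` of functions of class `GH^∞`. -/
def GHFun {L m : ℕ} {X : Type} (c : SuperCoords L m X) (L' : ℕ) : Subalgebra ℂ (X → Gr L) where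
  carrier := {f | IsGH c L' f}
  mul_mem' := IsGH.mul
  add_mem' := IsGH.add
  algebraMap_mem' r := isGH_const (Subalgebra.algebraMap_mem _ r)

/-- The grading of `GH^∞(X, ℂ_{S[L]})` by the parity of the values. -/
def GHFun.grading {L m : ℕ} {X : Type} (c : SuperCoords L m X) (L' : ℕ) (i : ZMod 2) :
    AddSubgroup (GHFun c L') where
  carrier := {f | ∀ p, f.1 p ∈ Gr.part L i}
  zero_mem' _ := Submodule.zero_mem _
  add_mem' hf hg p := Submodule.add_mem _ (hf p) (hg p)
  neg_mem' hf p := Submodule.neg_mem _ (hf p)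

/-! ## The supersphere `S^{2,2}`, the supergroup `UOSP(1,2)` and the projection between them -/

namespace GradedInvolution

variable {L : ℕ} (D : GradedInvolution L)

theorem map_neg (z : Gr L) : D (-z) = -D z := by
  have h := D.map_smul (-1) z
  rwa [_root_.map_neg, _root_.map_one, neg_one_smul, neg_one_smul] at h

theorem map_sub (z w : Gr L) : D (z - w) = D z - D w := by
  rw [sub_eq_add_neg, D.map_add, D.map_neg, ← sub_eq_add_neg]

theorem even_invol {z : Gr L} (hz : z ∈ Gr.part L 0) : D (D z) = z := by
  have h := D.toFun_toFun 0 z hz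
  rwa [ZMod.val_zero, pow_zero, one_smul] at h

theorem odd_invol {z : Gr L} (hz : z ∈ Gr.part L 1) : D (D z) = -z := by
  have h := D.toFun_toFun 1 z hz
  rwa [ZMod.val_one, pow_one, neg_one_smul] at h

theorem map_one : D 1 = 1 := by
  have h1 : (1 : Gr L) ∈ Gr.part L 0 := Gr.one_even
  calc D 1 = D 1 * D (D 1) := by rw [D.even_invol h1, mul_one]
    _ = D (D 1) := by rw [← D.map_mul, one_mul]
    _ = 1 := D.even_invol h1

end GradedInvolution

/-- The supersphere
`S^{2,2} = {(x_1, x_2, x_3, ξ_1, ξ_2) | ∑ x_i² + 2 ξ_1 ξ_2 = 1, x_i^◇ = x_i, ξ_1^◇ = ξ_2}`,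
with even `x_i` and odd `ξ_j`. -/
structure SuperSphere {L : ℕ} (D : GradedInvolution L) : Type where
  x : Fin 3 → Gr L
  ξ : Fin 2 → Gr L
  x_mem : ∀ i, x i ∈ Gr.part L 0
  ξ_mem : ∀ j, ξ j ∈ Gr.part L 1
  x_real : ∀ i, D (x i) = x i
  ξ_conj : D (ξ 0) = ξ 1
  sphere : ∑ i, x i ^ 2 + 2 * (ξ 0 * ξ 1) = 1

/-- The elements `s(a, b, η)` of `UOSP(1,2)`, given by their parameters. -/
structure UOSP {L : ℕ} (D : GradedInvolution L) : Type where
  a : Gr L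
  b : Gr L
  η : Gr L
  a_mem : a ∈ Gr.part L 0
  b_mem : b ∈ Gr.part L 0
  η_mem : η ∈ Gr.part L 1
  norm : a * D a + b * D b = 1

namespace UOSP

variable {L : ℕ} {D : GradedInvolution L} (s : UOSP D)

/-- The matrix `s(a, b, η)`. -/
noncomputable def toMatrix : Matrix (Fin 3) (Fin 3) (Gr L) :=
  !![1 + (1 / 4 : ℂ) • (s.η * D s.η), -(1 / 2 : ℂ) • s.η, (1 / 2 : ℂ) • D s.η;
    -(1 / 2 : ℂ) • (s.a * D s.η - D s.b * s.η), s.a * (1 - (1 / 8 : ℂ) • (s.η * D s.η)),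
      -(D s.b * (1 - (1 / 8 : ℂ) • (s.η * D s.η)));
    -(1 / 2 : ℂ) • (s.b * D s.η + D s.a * s.η), s.b * (1 - (1 / 8 : ℂ) • (s.η * D s.η)),
      D s.a * (1 - (1 / 8 : ℂ) • (s.η * D s.η))]

end UOSP

/-- The group `𝒰(1) = {w even | w w^◇ = 1}`. -/
def superU1 {L : ℕ} (D : GradedInvolution L) : Set (Gr L) :=
  {w | w ∈ Gr.part L 0 ∧ w * D w = 1}

/-- The embedding of `𝒰(1)` in `UOSP(1,2)`. -/
noncomputable def superU1.toMatrix {L : ℕ} (D : GradedInvolution L) (w : Gr L) :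
    Matrix (Fin 3) (Fin 3) (Gr L) :=
  Matrix.diagonal ![1, w, D w]

/-- The coordinates `x_1, x_2, x_3, ξ_1, ξ_2` of `S^{2,2}`. -/
def SuperSphere.coords {L : ℕ} (D : GradedInvolution L) : SuperCoords L 3 (SuperSphere D) where
  x p := p.x
  ξ p := p.ξ
  x_mem p := p.x_mem
  ξ_mem p := p.ξ_mem

/-- The coordinates of `UOSP(1,2)`: the real and imaginary parts (with respect to `◇`) of `a` and
`b`, and `η`, `η^◇`. -/
noncomputable def UOSP.coords {L : ℕ} (D : GradedInvolution L) : SuperCoords L 4 (UOSP D) where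
  x s := ![(1 / 2 : ℂ) • (s.a + D s.a), (-Complex.I / 2) • (s.a - D s.a),
    (1 / 2 : ℂ) • (s.b + D s.b), (-Complex.I / 2) • (s.b - D s.b)]
  ξ s := ![s.η, D s.η]
  x_mem s j := by
    have ha := D.map_mem 0 _ s.a_mem
    have hb := D.map_mem 0 _ s.b_mem
    fin_cases j
    · exact Submodule.smul_mem _ _ (add_mem s.a_mem ha)
    · exact Submodule.smul_mem _ _ (sub_mem s.a_mem ha)
    · exact Submodule.smul_mem _ _ (add_mem s.b_mem hb)
    · exact Submodule.smul_mem _ _ (sub_mem s.b_mem hb)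
  ξ_mem s j := by
    fin_cases j
    exacts [s.η_mem, D.map_mem 1 _ s.η_mem]

theorem hopf_identity {R : Type*} [CommRing R] [Algebra ℂ R] (a a' b b' t : R)
    (h : a * a' + b * b' = 1) (ht : t * t = 0) :
    ((a * a' - b * b') * (1 - (1 / 4 : ℂ) • t)) ^ 2 + ((a * b' + b * a') * (1 - (1 / 4 : ℂ) • t)) ^ 2
      + ((-Complex.I) • ((a * b' - b * a') * (1 - (1 / 4 : ℂ) • t))) ^ 2 + (1 / 2 : ℂ) • t = 1 := by
  have hI : (algebraMap ℂ R Complex.I) ^ 2 = -1 := by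
    rw [← map_pow, Complex.I_sq, map_neg, map_one]
  have h4 : (4 : R) * algebraMap ℂ R (1 / 4) = 1 := by
    rw [← map_ofNat (algebraMap ℂ R) 4, ← map_mul]; norm_num
  have h2 : algebraMap ℂ R (1 / 2) = 2 * algebraMap ℂ R (1 / 4) := by
    rw [← map_ofNat (algebraMap ℂ R) 2, ← map_mul]; norm_num
  simp only [Algebra.smul_def, h2, map_neg]
  generalize algebraMap ℂ R Complex.I = i at *
  generalize algebraMap ℂ R (1 / 4) = q at *
  have e : (1 - q * t) ^ 2 = 1 - 2 * q * t := by linear_combination q ^ 2 * ht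
  have e2 : ((a * a' - b * b') * (1 - q * t)) ^ 2 + ((a * b' + b * a') * (1 - q * t)) ^ 2
      + (-i * ((a * b' - b * a') * (1 - q * t))) ^ 2 =
      (a * a' + b * b') ^ 2 * (1 - q * t) ^ 2 := by
    linear_combination ((a * b' - b * a') * (1 - q * t)) ^ 2 * hI
  rw [e2, h, e]; ring

/-- The projection `UOSP(1,2) → UOSP(1,2) / 𝒰(1) ≅ S^{2,2}`. -/
noncomputable def hopf {L : ℕ} {D : GradedInvolution L} (s : UOSP D) : SuperSphere D where
  x := ![(s.a * D s.a - s.b * D s.b) * (1 - (1 / 4 : ℂ) • (s.η * D s.η)),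
    (s.a * D s.b + s.b * D s.a) * (1 - (1 / 4 : ℂ) • (s.η * D s.η)),
    (-Complex.I) • ((s.a * D s.b - s.b * D s.a) * (1 - (1 / 4 : ℂ) • (s.η * D s.η)))]
  ξ := ![-(1 / 2 : ℂ) • (s.a * D s.η + s.η * D s.b), (1 / 2 : ℂ) • (s.η * D s.a - s.b * D s.η)]
  x_mem i := by
    have ha := s.a_mem
    have hb := s.b_mem
    have ha' := D.map_mem 0 _ ha
    have hb' := D.map_mem 0 _ hb
    have ht : (1 - (1 / 4 : ℂ) • (s.η * D s.η)) ∈ Gr.part L 0 := by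
      refine sub_mem Gr.one_even (Submodule.smul_mem _ _ ?_)
      exact CliffordAlgebra.evenOdd_mul_le _ 1 1
        (Submodule.mul_mem_mul s.η_mem (D.map_mem 1 _ s.η_mem))
    fin_cases i
    · exact Gr.even_mul (sub_mem (Gr.even_mul ha ha') (Gr.even_mul hb hb')) ht
    · exact Gr.even_mul (add_mem (Gr.even_mul ha hb') (Gr.even_mul hb ha')) ht
    · exact Submodule.smul_mem _ _
        (Gr.even_mul (sub_mem (Gr.even_mul ha hb') (Gr.even_mul hb ha')) ht)
  ξ_mem j := by
    have m01 : ∀ {z w : Gr L}, z ∈ Gr.part L 0 → w ∈ Gr.part L 1 → z * w ∈ Gr.part L 1 :=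
      fun hz hw => CliffordAlgebra.evenOdd_mul_le _ 0 1 (Submodule.mul_mem_mul hz hw)
    have m10 : ∀ {z w : Gr L}, z ∈ Gr.part L 1 → w ∈ Gr.part L 0 → z * w ∈ Gr.part L 1 :=
      fun hz hw => CliffordAlgebra.evenOdd_mul_le _ 1 0 (Submodule.mul_mem_mul hz hw)
    have hη' := D.map_mem 1 _ s.η_mem
    fin_cases j
    · exact Submodule.smul_mem _ _
        (add_mem (m01 s.a_mem hη') (m10 s.η_mem (D.map_mem 0 _ s.b_mem)))
    · exact Submodule.smul_mem _ _
        (sub_mem (m10 s.η_mem (D.map_mem 0 _ s.a_mem)) (m01 s.b_mem hη'))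
  x_real i := by
    have ht : D (1 - (1 / 4 : ℂ) • (s.η * D s.η)) = 1 - (1 / 4 : ℂ) • (s.η * D s.η) := by
      rw [D.map_sub, D.map_one, D.map_smul, D.map_mul, D.odd_invol s.η_mem, mul_neg,
        ← Gr.odd_swap s.η_mem (D.map_mem 1 _ s.η_mem),
        show (starRingEnd ℂ) (1 / 4) = 1 / 4 by simp [Complex.ext_iff]]
    have ha := D.even_invol s.a_mem
    have hb := D.even_invol s.b_mem
    have ha' := D.map_mem 0 _ s.a_mem
    have hb' := D.map_mem 0 _ s.b_mem
    generalize 1 - (1 / 4 : ℂ) • (s.η * D s.η) = t at ht ⊢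
    fin_cases i
    · simp [D.map_mul, D.map_sub, ht, ha, hb, Gr.even_comm ha' s.a, Gr.even_comm hb' s.b]
    · simp [D.map_mul, D.map_add, ht, ha, hb, Gr.even_comm ha' s.b, Gr.even_comm hb' s.a,
        add_comm]
    · change D ((-Complex.I) • ((s.a * D s.b - s.b * D s.a) * t)) =
        (-Complex.I) • ((s.a * D s.b - s.b * D s.a) * t)
      rw [D.map_smul, D.map_mul, D.map_sub, D.map_mul, D.map_mul, ha, hb, ht,
        Gr.even_comm ha' s.b, Gr.even_comm hb' s.a, _root_.map_neg, Complex.conj_I, neg_neg,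
        ← neg_sub, neg_mul, smul_neg, neg_smul]
  ξ_conj := by
    have h := Gr.even_comm (D.map_mem 0 _ s.a_mem) s.η
    have h2 := Gr.even_comm s.b_mem (D s.η)
    have h3 : (starRingEnd ℂ) (-(1 / 2)) = -(1 / 2) := by simp [Complex.ext_iff]
    change D (-(1 / 2 : ℂ) • (s.a * D s.η + s.η * D s.b)) =
      (1 / 2 : ℂ) • (s.η * D s.a - s.b * D s.η)
    rw [D.map_smul, D.map_add, D.map_mul, D.map_mul, D.odd_invol s.η_mem, D.even_invol s.b_mem, h3,
      mul_neg, h, h2, neg_smul, ← smul_neg]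
    congr 1; abel
  sphere := by
    have hη := s.η_mem
    have hη' := D.map_mem 1 _ hη
    have ha' := D.map_mem 0 _ s.a_mem
    have hb' := D.map_mem 0 _ s.b_mem
    have hc : ∀ {z : Gr L}, z ∈ Gr.part L 0 → z ∈ Subalgebra.center ℂ (Gr L) := fun hz =>
      Subalgebra.mem_center_iff.mpr fun w => (Gr.even_comm hz w).symm
    have ht : s.η * D s.η ∈ Gr.part L 0 :=
      CliffordAlgebra.evenOdd_mul_le _ 1 1 (Submodule.mul_mem_mul hη hη')
    have htt : (s.η * D s.η) * (s.η * D s.η) = 0 := by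
      rw [mul_assoc, ← mul_assoc (D s.η), Gr.odd_swap hη' hη, neg_mul, mul_neg, ← mul_assoc,
        ← mul_assoc, Gr.odd_sq hη]; simp
    have key := congrArg (Subalgebra.center ℂ (Gr L)).val (hopf_identity
      (R := Subalgebra.center ℂ (Gr L)) ⟨_, hc s.a_mem⟩ ⟨_, hc ha'⟩ ⟨_, hc s.b_mem⟩
      ⟨_, hc hb'⟩ ⟨_, hc ht⟩ (Subtype.ext s.norm) (Subtype.ext htt))
    have hxi : (s.a * D s.η + s.η * D s.b) * (s.η * D s.a - s.b * D s.η) = -(s.η * D s.η) := by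
      have e1 : s.a * D s.η * (s.η * D s.a) = -(s.a * D s.a * (s.η * D s.η)) := by
        rw [mul_assoc, ← mul_assoc (D s.η), Gr.odd_swap hη' hη, neg_mul, mul_neg,
          ← Gr.even_comm ha', mul_assoc]
      have e2 : s.a * D s.η * (s.b * D s.η) = 0 := by
        rw [Gr.even_comm s.b_mem, mul_assoc, ← mul_assoc (D s.η), Gr.odd_sq hη']; simp
      have e3 : s.η * D s.b * (s.η * D s.a) = 0 := by
        rw [← Gr.even_comm hb', mul_assoc, ← mul_assoc s.η, Gr.odd_sq hη]; simp
      have e4 : s.η * D s.b * (s.b * D s.η) = s.b * D s.b * (s.η * D s.η) := by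
        rw [← Gr.even_comm hb', mul_assoc, ← mul_assoc s.η, ← Gr.even_comm s.b_mem, mul_assoc,
          ← mul_assoc, Gr.even_comm hb']
      rw [add_mul, mul_sub, mul_sub, e1, e2, e3, e4, sub_zero, zero_sub, ← neg_add, ← add_mul,
        s.norm, one_mul]
    have e : (2 : Gr L) * (-(1 / 2 : ℂ) • (s.a * D s.η + s.η * D s.b) *
        ((1 / 2 : ℂ) • (s.η * D s.a - s.b * D s.η))) = (1 / 2 : ℂ) • (s.η * D s.η) := by
      rw [smul_mul_smul_comm, hxi, two_mul, ← two_smul ℂ, smul_smul, smul_neg, ← neg_smul]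
      norm_num
    rw [Fin.sum_univ_three]
    simp only [Matrix.cons_val, e]
    exact key

/-! ## The projectors -/

namespace UOSP

variable {L : ℕ} {D : GradedInvolution L}

/-- The row `⟨ψ_n|`: first the `n + 1` even entries, then the `n` odd ones. -/
noncomputable def bra (n : ℕ) (s : UOSP D) : Fin (n + 1) ⊕ Fin n → Gr L
  | Sum.inl k => (1 - (1 / 8 : ℂ) • (s.η * D s.η)) *
      ((Real.sqrt (n.choose k) : ℂ) • (D s.a ^ (n - k) * D s.b ^ (k : ℕ)))
  | Sum.inr k => ((1 / 2 : ℂ) • D s.η) *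
      ((Real.sqrt ((n - 1).choose k) : ℂ) • (D s.a ^ (n - 1 - k) * D s.b ^ (k : ℕ)))

/-- The column `|ψ_n⟩`, the `◇`-conjugate transpose of `⟨ψ_n|`. -/
noncomputable def ket (n : ℕ) (s : UOSP D) (i : Fin (n + 1) ⊕ Fin n) : Gr L := D (s.bra n i)

/-- The projector `p_n = |ψ_n⟩⟨ψ_n|`. -/
noncomputable def proj (n : ℕ) (s : UOSP D) :
    Matrix (Fin (n + 1) ⊕ Fin n) (Fin (n + 1) ⊕ Fin n) (Gr L) :=
  Matrix.vecMulVec (s.ket n) (s.bra n)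

end UOSP

/-- The superring `𝒜` of `GH^∞` functions on `S^{2,2}`. -/
abbrev SphereFun {L : ℕ} (D : GradedInvolution L) (L' : ℕ) : Type :=
  GHFun (SuperSphere.coords D) L'

/-- The superring `ℬ` of `GH^∞` functions on `UOSP(1,2)`. -/
abbrev UOSPFun {L : ℕ} (D : GradedInvolution L) (L' : ℕ) : Type :=
  GHFun (UOSP.coords D) L'

/-- The free supermodule of type `(n + 1, n)`, as a module of columns. -/
abbrev Columns (R : Type) (n : ℕ) : Type := Fin (n + 1) ⊕ Fin n → R

/-!
Write `t = η η^◇`, `u = ξ_1 ξ_2` and `y = (1 + u) x`. On the image of `s(a, b, η)` one has `u = t / 4`,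
so that the nilpotent factor cancels and `y_1 = a a^◇ - b b^◇`, `y_2 + i y_3 = 2 a b^◇`,
`∑ y_i² = 1`, while `η = 2 (a ξ_2 - b ξ_1)`. Hence `h(s)` determines the products
`a a^◇, b b^◇, a b^◇`, two points with the same image differ by `w = a^◇ a' + b^◇ b'`, which lies in
`𝒰(1)` (`UOSP.exists_action_of_hopf_eq`), and conversely any even `a`, `b` with the right products
give a point over a given `p` (`SuperSphere.exists_hopf_eq`). Over the bodies with `x_1 ≠ -1` one takes
`a = √((1 + y_1) / 2)`, `b = (y_2 - i y_3) / (2 a)`, and over those with `x_1 ≠ 1` the roles of `a`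
and `b` are exchanged; the roots are Grassmann analytic continuations of real roots. These local
sections show that `h` is surjective and that `f` is of class `GH^∞` when `f ∘ h` is, since `f` is
the pullback of `f ∘ h` along them.

That pullbacks preserve the class `GH^∞` rests on a chain rule for the Grassmann analytic
continuation (`grassmannCont_comp`). The map `g ↦ ĝ(x)` is an algebra homomorphism on smooth
functions, and such a homomorphism is determined by the images of the coordinates
(`smoothFun_algHom_ext`): Hadamard's lemma writes `g` as `g(v₀) + ∑ (v_j - v₀_j) h_j`, so the
difference of two homomorphisms with the same values on coordinates lies in every power of the
nilpotent ideal. Both sides of the chain rule are such homomorphisms. The map `h` and its sections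
have the form `x' = Ŷ(x) + ξ_1 ξ_2 Ẑ(x)` in the even coordinates, which is what the chain rule and
`IsGH.comp` allow.

The normalization `⟨ψ_n|ψ_n⟩ = 1` is the binomial theorem for `(a a^◇ + b b^◇)^n`, the contribution
`t / 4` of the odd entries compensating `(1 - t / 8)² = 1 - t / 4`. So `p_n` is idempotent. Under `w` the
row `⟨ψ_n|` is multiplied by `(w^◇)^n`, so `p_n` is invariant and its entries descend to `GH^∞`
functions on the supersphere. The resulting idempotent is even, and its kernel is the complement that
makes its image super projective (`isSuperProjective_range`).
-/

/-! ### Smooth functions and Hadamard's lemma -/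

theorem hasFDerivAt_integral_of_contDiff {E F : Type} [NormedAddCommGroup E] [NormedSpace ℝ E]
    [FiniteDimensional ℝ E] [NormedAddCommGroup F] [NormedSpace ℝ F] [CompleteSpace F]
    {f : E × ℝ → F} (hf : ContDiff ℝ ∞ f) (x₀ : E) :
    HasFDerivAt (fun x => ∫ t in (0 : ℝ)..1, f (x, t))
      (∫ t in (0 : ℝ)..1, (fderiv ℝ f (x₀, t)).comp (ContinuousLinearMap.inl ℝ E ℝ)) x₀ := by
  have hc : Continuous fun z : E × ℝ =>
      (fderiv ℝ f z).comp (ContinuousLinearMap.inl ℝ E ℝ) :=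
    (hf.continuous_fderiv (by simp)).clm_comp continuous_const
  obtain ⟨C, hC⟩ := ((isCompact_closedBall x₀ 1).prod (isCompact_Icc (a := (0 : ℝ)) (b := 1))
    ).exists_bound_of_continuousOn hc.continuousOn
  refine intervalIntegral.hasFDerivAt_integral_of_dominated_of_fderiv_le (bound := fun _ => C)
    (F' := fun x t => (fderiv ℝ f (x, t)).comp (ContinuousLinearMap.inl ℝ E ℝ))
    (Metric.closedBall_mem_nhds x₀ one_pos) ?_ ?_ ?_ ?_ ?_ ?_
  · refine Filter.Eventually.of_forall fun x => ?_
    exact (hf.continuous.comp (by fun_prop : Continuous fun t : ℝ => (x, t))).aestronglyMeasurable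
  · exact (hf.continuous.comp
      (by fun_prop : Continuous fun t : ℝ => (x₀, t))).intervalIntegrable _ _
  · exact (hc.comp (by fun_prop : Continuous fun t : ℝ => (x₀, t))).aestronglyMeasurable
  · refine Filter.Eventually.of_forall fun t ht x hx => hC (x, t) ⟨hx, ?_⟩
    rw [Set.uIoc_of_le zero_le_one] at ht
    exact ⟨ht.1.le, ht.2⟩
  · exact intervalIntegrable_const
  · refine Filter.Eventually.of_forall fun t _ x _ => ?_
    have h1 := (hf.differentiable (by simp) (x, t)).hasFDerivAt
    have h2 : HasFDerivAt (fun x : E => (x, t)) (ContinuousLinearMap.inl ℝ E ℝ) x :=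
      hasFDerivAt_prodMk_left x t
    exact h1.comp x h2

theorem contDiff_integral_param {E : Type} [NormedAddCommGroup E] [NormedSpace ℝ E]
    [FiniteDimensional ℝ E] (n : ℕ) : ∀ {F : Type} [NormedAddCommGroup F] [NormedSpace ℝ F]
    [CompleteSpace F] {f : E × ℝ → F}, ContDiff ℝ ∞ f →
    ContDiff ℝ n (fun x => ∫ t in (0 : ℝ)..1, f (x, t)) := by
  induction n with
  | zero =>
    intro F _ _ _ f hf
    exact contDiff_zero.mpr (continuous_iff_continuousAt.mpr fun x =>
      (hasFDerivAt_integral_of_contDiff hf x).continuousAt)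
  | succ n ih =>
    intro F _ _ _ f hf
    rw [Nat.cast_succ, contDiff_succ_iff_hasFDerivAt]
    refine ⟨_, ih (f := fun z => (fderiv ℝ f z).comp (ContinuousLinearMap.inl ℝ E ℝ)) ?_,
      fun x => hasFDerivAt_integral_of_contDiff hf x⟩
    exact (hf.fderiv_right (m := ∞) (by simp)).clm_comp contDiff_const

/-- Hadamard's lemma: `h_j` is the mean of `∂_j g` along the segment from `v₀` to `v`. -/
theorem hadamard {m : ℕ} {g : (Fin m → ℝ) → ℂ} (hg : ContDiff ℝ ∞ g) (v₀ : Fin m → ℝ) :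
    ∃ h : Fin m → (Fin m → ℝ) → ℂ, (∀ j, ContDiff ℝ ∞ (h j)) ∧
      ∀ v, g v = g v₀ + ∑ j, ((v j : ℂ) - v₀ j) * h j v := by
  have hp : ∀ j, ContDiff ℝ ∞ (partialD j g) := fun j =>
    (hg.fderiv_right (m := ∞) (by simp)).clm_apply contDiff_const
  have hline : ContDiff ℝ ∞ fun z : (Fin m → ℝ) × ℝ => v₀ + z.2 • (z.1 - v₀) := by fun_prop
  refine ⟨fun j v => ∫ t in (0 : ℝ)..1, partialD j g (v₀ + t • (v - v₀)), fun j => ?_,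
    fun v => ?_⟩
  · rw [contDiff_infty]
    exact fun n => contDiff_integral_param n
      (f := fun z : (Fin m → ℝ) × ℝ => partialD j g (v₀ + z.2 • (z.1 - v₀))) ((hp j).comp hline)
  · have hd : ∀ t : ℝ, HasDerivAt (fun t : ℝ => g (v₀ + t • (v - v₀)))
        (∑ j, ((v j : ℂ) - v₀ j) * partialD j g (v₀ + t • (v - v₀))) t := fun t => by
      have h1 := (hg.differentiable (by simp) (v₀ + t • (v - v₀))).hasFDerivAt
      have h2 : HasDerivAt (fun t : ℝ => v₀ + t • (v - v₀)) (v - v₀) t := by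
        simpa using ((hasDerivAt_id t).smul_const (v - v₀)).const_add v₀
      have h3 : fderiv ℝ g (v₀ + t • (v - v₀)) (v - v₀) =
          ∑ j, ((v j : ℂ) - v₀ j) * partialD j g (v₀ + t • (v - v₀)) := by
        refine ((fderiv ℝ g (v₀ + t • (v - v₀))).toLinearMap.pi_apply_eq_sum_univ (v - v₀)).trans ?_
        refine Finset.sum_congr rfl fun j _ => ?_
        simp [partialD, Complex.real_smul]
        left
        congr 1
        ext i
        simp [Pi.single_apply, eq_comm]
      exact h3 ▸ h1.comp_hasDerivAt t h2
    have hci : ∀ j, IntervalIntegrable (fun t : ℝ => ((v j : ℂ) - v₀ j) *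
        partialD j g (v₀ + t • (v - v₀))) MeasureTheory.volume 0 1 := fun j =>
      (continuous_const.mul ((hp j).continuous.comp (by fun_prop))).intervalIntegrable _ _
    have hi := intervalIntegral.integral_eq_sub_of_hasDerivAt (a := 0) (b := 1)
      (fun t _ => hd t) (by
        simpa [Finset.sum_fn] using IntervalIntegrable.sum Finset.univ fun j _ => hci j)
    rw [intervalIntegral.integral_finsetSum fun j _ => hci j] at hi
    simp only [intervalIntegral.integral_const_mul] at hi
    simp [hi]

/-- The algebra of smooth functions on `ℝ^m`. -/
def smoothFun (m : ℕ) : Subalgebra ℂ ((Fin m → ℝ) → ℂ) where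
  carrier := {g | ContDiff ℝ ∞ g}
  mul_mem' {f g} (hf : ContDiff ℝ ∞ f) (hg : ContDiff ℝ ∞ g) := (hf.mul hg : ContDiff ℝ ∞ (f * g))
  add_mem' {f g} (hf : ContDiff ℝ ∞ f) (hg : ContDiff ℝ ∞ g) := (hf.add hg : ContDiff ℝ ∞ (f + g))
  algebraMap_mem' c := (contDiff_const : ContDiff ℝ ∞ fun _ : Fin m → ℝ => c)

theorem mem_smoothFun {m : ℕ} {g : (Fin m → ℝ) → ℂ} : g ∈ smoothFun m ↔ ContDiff ℝ ∞ g := Iff.rfl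

/-- The coordinate functions on `ℝ^m`. -/
def coordFun {m : ℕ} (j : Fin m) : (Fin m → ℝ) → ℂ := fun v => (v j : ℂ)

theorem contDiff_coordFun {m : ℕ} (j : Fin m) : ContDiff ℝ ∞ (coordFun j) :=
  Complex.ofRealCLM.contDiff.comp (contDiff_apply ℝ ℝ j)

/-- Homomorphisms from smooth functions to the Grassmann algebra are determined by the images of the
coordinates: by Hadamard's lemma, the difference of two such homomorphisms gains one degree of
nilpotency at every step. -/
theorem smoothFun_algHom_ext {L m : ℕ} {φ ψ : smoothFun m →ₐ[ℂ] Gr L} (v₀ : Fin m → ℝ)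
    (h : ∀ j, φ ⟨coordFun j, mem_smoothFun.mpr (contDiff_coordFun j)⟩ =
      ψ ⟨coordFun j, mem_smoothFun.mpr (contDiff_coordFun j)⟩)
    (hv : ∀ j, φ ⟨coordFun j, mem_smoothFun.mpr (contDiff_coordFun j)⟩ -
      algebraMap ℂ (Gr L) (v₀ j) ∈ Gr.fil L 1) :
    φ = ψ := by
  have key : ∀ k (g : smoothFun m), φ g - ψ g ∈ Gr.fil L k := by
    intro k
    induction k with
    | zero => intro g; simp [Gr.fil]
    | succ k ih =>
      rintro ⟨g, hg⟩
      obtain ⟨q, hq, e⟩ := hadamard (mem_smoothFun.mp hg) v₀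
      let x : Fin m → smoothFun m := fun j => ⟨coordFun j, mem_smoothFun.mpr (contDiff_coordFun j)⟩
      let q' : Fin m → smoothFun m := fun j => ⟨q j, mem_smoothFun.mpr (hq j)⟩
      have e' : (⟨g, hg⟩ : smoothFun m) = algebraMap ℂ _ (g v₀) +
          ∑ j, (x j - algebraMap ℂ _ (v₀ j : ℂ)) * q' j := by
        refine Subtype.ext (funext fun v => (e v).trans ?_)
        simp only [AddMemClass.coe_add, AddSubmonoidClass.coe_finsetSum, MulMemClass.coe_mul,
          Pi.add_apply, Finset.sum_apply, Pi.mul_apply]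
        rfl
      rw [e']
      simp only [map_add, map_sum, map_mul, map_sub, AlgHom.commutes]
      rw [add_sub_add_left_eq_sub, ← Finset.sum_sub_distrib]
      refine Submodule.sum_mem _ fun j _ => ?_
      rw [← h j, ← mul_sub, add_comm k 1]
      exact Gr.fil_mul (hv j) (ih _)
  refine AlgHom.ext fun g => sub_eq_zero.mp (Gr.fil_eq_zero (Nat.lt_succ_self L) (key (L + 1) g))

/-- A function that is smooth near a point agrees near this point with a smooth function on `ℝ^m`. -/
theorem exists_contDiff_eqOn {m : ℕ} {V : Set (Fin m → ℝ)} (hV : IsOpen V) {v : Fin m → ℝ}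
    (hv : v ∈ V) {g : (Fin m → ℝ) → ℂ} (hg : ContDiffOn ℝ ∞ g V) :
    ∃ U, IsOpen U ∧ v ∈ U ∧ U ⊆ V ∧ ∃ g' : (Fin m → ℝ) → ℂ, ContDiff ℝ ∞ g' ∧ Set.EqOn g g' U := by
  obtain ⟨r, hr, hrV⟩ := Metric.isOpen_iff.mp hV v hv
  let χ : ContDiffBump v := ⟨r / 4, r / 2, by positivity, by linarith⟩
  have hcl : Metric.closedBall v (r / 2) ⊆ V :=
    (Metric.closedBall_subset_ball (by linarith)).trans hrV
  refine ⟨Metric.ball v (r / 4), Metric.isOpen_ball, Metric.mem_ball_self (by positivity),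
    (Metric.ball_subset_ball (by linarith)).trans hrV, fun w => χ w • g w, ?_, ?_⟩
  · rw [contDiff_iff_contDiffAt]
    intro w
    by_cases hw : w ∈ V
    · exact χ.contDiff.contDiffAt.smul (hg.contDiffAt (hV.mem_nhds hw))
    · have hw' : w ∈ (Metric.closedBall v (r / 2))ᶜ := fun h => hw (hcl h)
      refine contDiffAt_const (c := (0 : ℂ)) |>.congr_of_eventuallyEq ?_
      filter_upwards [Metric.isClosed_closedBall.isOpen_compl.mem_nhds hw'] with y hy
      have : χ y = 0 := χ.zero_of_le_dist (by
        simpa using le_of_lt (by simpa using hy : r / 2 < dist y v))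
      simp [this]
  · intro w hw
    have : χ w = 1 := χ.one_of_mem_closedBall (Metric.ball_subset_closedBall hw)
    simp [this]

/-! ### Grassmann analytic continuation as a homomorphism -/

namespace Gr

variable {L : ℕ}

theorem body_add (z w : Gr L) : body (z + w) = body z + body w := by simp [body]

theorem body_mul (z w : Gr L) : body (z * w) = body z * body w := by simp [body]

theorem mem_fil_one_iff {z : Gr L} : z ∈ fil L 1 ↔ body z = 0 := by
  refine ⟨fun h => body_V1 (by simpa [fil] using h), fun h => ?_⟩
  have := soul_mem z
  rw [soul, h, map_zero, sub_zero] at this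
  simpa [fil] using this

theorem soul_mem_fil (z : Gr L) : soul z ∈ fil L 1 := by simpa [fil] using soul_mem z

theorem body_eq_zero_of_sq {u : Gr L} (hu : u * u = 0) : body u = 0 := by
  have := congrArg body hu
  rw [body_mul] at this
  simpa [body] using this

theorem odd_mul_odd {z w : Gr L} (hz : z ∈ part L 1) (hw : w ∈ part L 1) : z * w ∈ part L 0 :=
  CliffordAlgebra.evenOdd_mul_le _ 1 1 (Submodule.mul_mem_mul hz hw)

theorem even_pow {z : Gr L} (hz : z ∈ part L 0) (k : ℕ) : z ^ k ∈ part L 0 := by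
  induction k with
  | zero => rw [pow_zero]; exact one_even
  | succ k ih => rw [pow_succ]; exact even_mul ih hz

theorem odd_mul_sq {z w : Gr L} (hz : z ∈ part L 1) (hw : w ∈ part L 1) :
    (z * w) * (z * w) = 0 := by
  rw [mul_assoc, ← mul_assoc w, odd_swap hw hz, neg_mul, mul_neg, ← mul_assoc, ← mul_assoc,
    odd_sq hz, zero_mul, zero_mul, neg_zero]

end Gr

section Continuation

variable {L m : ℕ} {x : Fin m → Gr L}

theorem grassmannCont_congr {V : Set (Fin m → ℝ)} (hV : IsOpen V) {g h : (Fin m → ℝ) → ℂ}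
    (hgh : Set.EqOn g h V) (hx : realBody x ∈ V) : grassmannCont g x = grassmannCont h x :=
  Finset.sum_congr rfl fun k _ => by rw [taylorTerm_congr hV k g h hgh hx]

theorem grassmannCont_add {V : Set (Fin m → ℝ)} (hV : IsOpen V) {g h : (Fin m → ℝ) → ℂ}
    (hg : ContDiffOn ℝ ∞ g V) (hh : ContDiffOn ℝ ∞ h V) (hx : realBody x ∈ V) :
    grassmannCont (g + h) x = grassmannCont g x + grassmannCont h x := by
  simp only [grassmannCont, ← Finset.sum_add_distrib, ← smul_add]
  exact Finset.sum_congr rfl fun k _ => by rw [taylorTerm_add hV k hg hh hx]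

theorem grassmannCont_sub_mem (g : (Fin m → ℝ) → ℂ) (x : Fin m → Gr L) :
    grassmannCont g x - algebraMap ℂ (Gr L) (g (realBody x)) ∈ Gr.fil L 1 := by
  rw [grassmannCont, Finset.sum_range_succ']
  simp only [taylorTerm, Nat.factorial_zero, Nat.cast_one, inv_one, one_smul, add_sub_cancel_right]
  refine Submodule.sum_mem _ fun k _ => Submodule.smul_mem _ _ (Submodule.sum_mem _ fun j _ => ?_)
  exact Gr.fil_mul (Gr.soul_mem_fil _) (k := 0) (by simp [Gr.fil])

theorem body_grassmannCont (g : (Fin m → ℝ) → ℂ) (x : Fin m → Gr L) :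
    Gr.body (grassmannCont g x) = g (realBody x) := by
  have h := Gr.mem_fil_one_iff.mp (grassmannCont_sub_mem g x)
  rw [sub_eq_add_neg, ← map_neg, Gr.body_add, Gr.body_algebraMap] at h
  linear_combination h

theorem partialD_coordFun (i j : Fin m) :
    partialD i (coordFun j) = fun _ => (if i = j then 1 else 0 : ℂ) := by
  funext v
  let e : (Fin m → ℝ) →L[ℝ] ℂ := Complex.ofRealCLM.comp (ContinuousLinearMap.proj (R := ℝ) j)
  have : HasFDerivAt (coordFun j) e v := e.hasFDerivAt
  simp only [partialD, this.fderiv]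
  by_cases h : i = j <;> simp [e, h, eq_comm]

/-- The continuation of the `j`-th coordinate function is the `j`-th coordinate, provided that its body
is real: `realBody` drops imaginary parts. -/
theorem grassmannCont_coordFun {j : Fin m} (hj : (Gr.body (x j)).im = 0) :
    grassmannCont (coordFun j) x = x j := by
  have h0 : ∀ (k : ℕ) (c : ℂ) (v), taylorTerm (fun j => Gr.soul (x j)) (k + 1) (fun _ => c) v = 0 := by
    intro k
    induction k with
    | zero => intro c v; simp [taylorTerm, partialD]
    | succ k ih =>
      intro c v
      rw [taylorTerm]
      refine Finset.sum_eq_zero fun i _ => ?_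
      rw [show partialD i (fun _ : Fin m → ℝ => c) = fun _ => 0 by funext; simp [partialD], ih,
        mul_zero]
  have h1 : taylorTerm (fun j => Gr.soul (x j)) 1 (coordFun j) (realBody x) = Gr.soul (x j) := by
    simp [taylorTerm, partialD_coordFun]
  have h2 : ∀ k, taylorTerm (fun j => Gr.soul (x j)) (k + 2) (coordFun j) (realBody x) = 0 := by
    intro k
    rw [taylorTerm]
    exact Finset.sum_eq_zero fun i _ => by rw [partialD_coordFun, h0, mul_zero]
  have hb : (coordFun j (realBody x) : ℂ) = Gr.body (x j) := by
    simp [coordFun, realBody, Complex.ext_iff, hj]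
  have hs : algebraMap ℂ (Gr L) (Gr.body (x j)) + Gr.soul (x j) = x j := by simp [Gr.soul]
  rw [grassmannCont]
  rcases L with _ | L
  · have : Gr.soul (x j) = 0 := Gr.fil_eq_zero zero_lt_one (Gr.soul_mem_fil _)
    rw [this, add_zero] at hs
    simp [taylorTerm, hb, hs]
  · rw [Finset.sum_range_succ', Finset.sum_range_succ',
      Finset.sum_eq_zero fun k _ => by rw [h2, smul_zero]]
    simp only [zero_add, h1]
    simpa [add_comm, taylorTerm, hb] using hs

/-- The Grassmann analytic continuation `g ↦ ĝ(x)` as a homomorphism. -/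
noncomputable def contHom (x : Fin m → Gr L) (hx : ∀ j, x j ∈ Gr.part L 0) :
    smoothFun m →ₐ[ℂ] Gr L where
  toFun g := grassmannCont g.1 x
  map_one' := (grassmannCont_const x 1).trans (map_one _)
  map_zero' := (grassmannCont_const x 0).trans (map_zero _)
  map_mul' g h := grassmannCont_mul hx isOpen_univ (mem_smoothFun.mp g.2).contDiffOn
    (mem_smoothFun.mp h.2).contDiffOn trivial
  map_add' g h := grassmannCont_add isOpen_univ (mem_smoothFun.mp g.2).contDiffOn
    (mem_smoothFun.mp h.2).contDiffOn trivial
  commutes' c := grassmannCont_const x c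

/-- The chain rule for the Grassmann analytic continuation, with an additional increment `u Ẑ(x)`,
`u² = 0`, of the inner functions: both sides depend multiplicatively on `g` and agree on
coordinate functions. -/
theorem grassmannCont_comp (hx : ∀ j, x j ∈ Gr.part L 0) {W : Set (Fin m → ℝ)} (hW : IsOpen W)
    (hxW : realBody x ∈ W) {m' : ℕ} {Y Z : Fin m' → (Fin m → ℝ) → ℝ}
    (hY : ∀ i, ContDiffOn ℝ ∞ (Y i) W) (hZ : ∀ i, ContDiffOn ℝ ∞ (Z i) W) {u : Gr L}
    (hu : u ∈ Gr.part L 0) (huu : u * u = 0) {V : Set (Fin m' → ℝ)} (hV : IsOpen V)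
    (hYV : (fun i => Y i (realBody x)) ∈ V) {g : (Fin m' → ℝ) → ℂ} (hg : ContDiffOn ℝ ∞ g V) :
    grassmannCont g (fun i => grassmannCont (fun v => (Y i v : ℂ)) x +
        u * grassmannCont (fun v => (Z i v : ℂ)) x) =
      grassmannCont (fun v => g fun i => Y i v) x +
        u * grassmannCont (fun v => ∑ i, (Z i v : ℂ) * partialD i g fun i => Y i v) x := by
  have hYc : ContDiffOn ℝ ∞ (fun v i => Y i v) W := contDiffOn_pi.mpr hY
  have hYo : ∀ i, ContDiffOn ℝ ∞ (fun v => (Y i v : ℂ)) W := fun i =>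
    Complex.ofRealCLM.contDiff.comp_contDiffOn (hY i)
  have hZo : ∀ i, ContDiffOn ℝ ∞ (fun v => (Z i v : ℂ)) W := fun i =>
    Complex.ofRealCLM.contDiff.comp_contDiffOn (hZ i)
  have hu0 := Gr.body_eq_zero_of_sq huu
  set y : Fin m' → Gr L := fun i => grassmannCont (fun v => (Y i v : ℂ)) x +
        u * grassmannCont (fun v => (Z i v : ℂ)) x with hy
  have hye : ∀ i, y i ∈ Gr.part L 0 := fun i =>
    add_mem (grassmannCont_even x hx _) (Gr.even_mul hu (grassmannCont_even x hx _))
  have hyb : ∀ i, Gr.body (y i) = Y i (realBody x) := fun i => by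
    rw [hy]; simp [Gr.body_add, Gr.body_mul, body_grassmannCont, hu0]
  have hyv : realBody y = fun i => Y i (realBody x) := by
    funext i; simp [realBody, hyb]
  obtain ⟨U, hU, hvU, hUV, g', hg', hgg⟩ := exists_contDiff_eqOn hV hYV hg
  -- replace `g` by a function that is smooth everywhere
  have hO : IsOpen (W ∩ (fun v i => Y i v) ⁻¹' U) := hYc.continuousOn.isOpen_inter_preimage hW hU
  rw [grassmannCont_congr hU hgg (hyv ▸ hvU),
    grassmannCont_congr (g := fun v => g fun i => Y i v) (h := fun v => g' fun i => Y i v) hO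
      (fun v hv => hgg hv.2) ⟨hxW, hvU⟩,
    grassmannCont_congr (g := fun v => ∑ i, (Z i v : ℂ) * partialD i g fun i => Y i v)
      (h := fun v => ∑ i, (Z i v : ℂ) * partialD i g' fun i => Y i v) hO (fun v hv => by
        refine Finset.sum_congr rfl fun i _ => ?_
        have : g =ᶠ[nhds fun i => Y i v] g' := Filter.eventuallyEq_of_mem (hU.mem_nhds hv.2) hgg
        simp only [partialD, this.fderiv_eq]) ⟨hxW, hvU⟩]
  have hE : ∀ f : smoothFun m', ContDiffOn ℝ ∞ (fun v => f.1 fun i => Y i v) W := fun f =>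
    (mem_smoothFun.mp f.2).comp_contDiffOn hYc
  have hP : ∀ (f : smoothFun m') i, ContDiff ℝ ∞ (partialD i f.1) := fun f i =>
    ((mem_smoothFun.mp f.2).fderiv_right (m := ∞) (by simp)).clm_apply contDiff_const
  have hF : ∀ f : smoothFun m',
      ContDiffOn ℝ ∞ (fun v => ∑ i, (Z i v : ℂ) * partialD i f.1 fun i => Y i v) W := fun f =>
    ContDiffOn.sum fun i _ => (hZo i).mul ((hP f i).comp_contDiffOn hYc)
  have hd : ∀ (f : smoothFun m') v, DifferentiableAt ℝ f.1 v := fun f v =>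
    (mem_smoothFun.mp f.2).differentiable (by simp) v
  let ψ : smoothFun m' →ₐ[ℂ] Gr L :=
    { toFun := fun f => grassmannCont (fun v => f.1 fun i => Y i v) x +
        u * grassmannCont (fun v => ∑ i, (Z i v : ℂ) * partialD i f.1 fun i => Y i v) x
      map_one' := by
        have h1 : grassmannCont (fun v => (1 : smoothFun m').1 fun i => Y i v) x = 1 :=
          (grassmannCont_const x 1).trans (map_one _)
        have h2 : ∀ i, partialD i (1 : smoothFun m').1 = fun _ => 0 := fun i => by
          funext v
          change fderiv ℝ (fun _ => (1 : ℂ)) v _ = 0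
          simp
        simp only [h1, h2, mul_zero, Finset.sum_const_zero, grassmannCont_const, map_zero, add_zero]
      map_zero' := by
        have h1 : grassmannCont (fun v => (0 : smoothFun m').1 fun i => Y i v) x = 0 :=
          (grassmannCont_const x 0).trans (map_zero _)
        have h2 : ∀ i, partialD i (0 : smoothFun m').1 = fun _ => 0 := fun i => by
          funext v
          change fderiv ℝ (fun _ => (0 : ℂ)) v _ = 0
          simp
        simp only [h1, h2, mul_zero, Finset.sum_const_zero, grassmannCont_const, map_zero, add_zero]
      map_add' := fun f h => by
        have e1 : (fun v => (f + h).1 fun i => Y i v) =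
            (fun v => f.1 fun i => Y i v) + fun v => h.1 fun i => Y i v := rfl
        have e2 : (fun v => ∑ i, (Z i v : ℂ) * partialD i (f + h).1 fun i => Y i v) =
            (fun v => ∑ i, (Z i v : ℂ) * partialD i f.1 fun i => Y i v) +
              fun v => ∑ i, (Z i v : ℂ) * partialD i h.1 fun i => Y i v := by
          funext v
          simp only [Pi.add_apply, ← Finset.sum_add_distrib, ← mul_add]
          refine Finset.sum_congr rfl fun i _ => ?_
          congr 1
          change fderiv ℝ (f.1 + h.1) _ _ = _
          rw [fderiv_add (hd f _) (hd h _)]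
          rfl
        rw [e1, e2, grassmannCont_add hW (hE f) (hE h) hxW, grassmannCont_add hW (hF f) (hF h) hxW]
        noncomm_ring
      map_mul' := fun f h => by
        have e1 : (fun v => (f * h).1 fun i => Y i v) =
            (fun v => f.1 fun i => Y i v) * fun v => h.1 fun i => Y i v := rfl
        have e2 : (fun v => ∑ i, (Z i v : ℂ) * partialD i (f * h).1 fun i => Y i v) =
            (fun v => ∑ i, (Z i v : ℂ) * partialD i f.1 fun i => Y i v) *
                (fun v => h.1 fun i => Y i v) +
              (fun v => f.1 fun i => Y i v) *
                fun v => ∑ i, (Z i v : ℂ) * partialD i h.1 fun i => Y i v := by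
          funext v
          simp only [Pi.add_apply, Pi.mul_apply, Finset.sum_mul, Finset.mul_sum,
            ← Finset.sum_add_distrib]
          refine Finset.sum_congr rfl fun i _ => ?_
          change (Z i v : ℂ) * fderiv ℝ (f.1 * h.1) _ _ = _
          rw [fderiv_mul (hd f _) (hd h _)]
          simp [partialD]
          ring
        have m1 : ContDiffOn ℝ ∞ ((fun v => ∑ i, (Z i v : ℂ) * partialD i f.1 fun i => Y i v) *
            fun v => h.1 fun i => Y i v) W := (hF f).mul (hE h)
        have m2 : ContDiffOn ℝ ∞ ((fun v => f.1 fun i => Y i v) *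
            fun v => ∑ i, (Z i v : ℂ) * partialD i h.1 fun i => Y i v) W := (hE f).mul (hF h)
        rw [e1, e2, grassmannCont_mul hx hW (hE f) (hE h) hxW, grassmannCont_add hW m1 m2 hxW,
          grassmannCont_mul hx hW (hF f) (hE h) hxW, grassmannCont_mul hx hW (hE f) (hF h) hxW]
        generalize grassmannCont (fun v => f.1 fun i => Y i v) x = A
        generalize grassmannCont (fun v => h.1 fun i => Y i v) x = B
        generalize grassmannCont (fun v => ∑ i, (Z i v : ℂ) * partialD i f.1 fun i => Y i v) x = A'
        generalize grassmannCont (fun v => ∑ i, (Z i v : ℂ) * partialD i h.1 fun i => Y i v) x = B'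
        have c1 : u * A' * (u * B') = 0 := by
          rw [mul_assoc, ← mul_assoc A', ← Gr.even_comm hu A', mul_assoc, ← mul_assoc, huu, zero_mul]
        have c2 : A * (u * B') = u * (A * B') := by
          rw [← mul_assoc, ← Gr.even_comm hu A, mul_assoc]
        simp only [add_mul, mul_add, c1, c2, mul_assoc u A' B]
        abel
      commutes' := fun c => by
        have h1 : grassmannCont (fun v => (algebraMap ℂ (smoothFun m') c).1 fun i => Y i v) x =
          algebraMap ℂ _ c := grassmannCont_const x c
        have h2 : ∀ i, partialD i (algebraMap ℂ (smoothFun m') c).1 = fun _ => 0 := fun i => by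
          funext v
          change fderiv ℝ (fun _ => c) v _ = 0
          simp
        simp only [h1, h2, mul_zero, Finset.sum_const_zero, grassmannCont_const, map_zero, add_zero] }
  have key : contHom y hye = ψ := by
    have hco : ∀ j, contHom y hye ⟨coordFun j, mem_smoothFun.mpr (contDiff_coordFun j)⟩ = y j :=
      fun j => grassmannCont_coordFun (by rw [hyb, Complex.ofReal_im])
    refine smoothFun_algHom_ext (fun i => Y i (realBody x)) (fun j => ?_) fun j => ?_
    · rw [hco]
      change y j = grassmannCont (fun v => coordFun j fun i => Y i v) x +
        u * grassmannCont (fun v => ∑ i, (Z i v : ℂ) * partialD i (coordFun j) fun i => Y i v) x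
      simp only [partialD_coordFun]
      simp [hy, coordFun]
    · rw [hco, Gr.mem_fil_one_iff, sub_eq_add_neg, ← map_neg, Gr.body_add, Gr.body_algebraMap, hyb,
        add_neg_cancel]
  exact DFunLike.congr_fun key ⟨g', mem_smoothFun.mpr hg'⟩

end Continuation

/-! ### Locality and composition of functions of class `GH^∞` -/

section GHComp

variable {L m m' L' : ℕ} {X X' : Type} {c : SuperCoords L m X} {c' : SuperCoords L m' X'}

/-- The restriction of the coordinates to the DeWitt open set of points with body in `V`. -/
def SuperCoords.restrict (c : SuperCoords L m X) (V : Set (Fin m → ℝ)) :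
    SuperCoords L m {p // realBody (c.x p) ∈ V} where
  x p := c.x p
  ξ p := c.ξ p
  x_mem p := c.x_mem p
  ξ_mem p := c.ξ_mem p

theorem IsGH.restrict {f : X → Gr L} (hf : IsGH c L' f) (V : Set (Fin m → ℝ)) :
    IsGH (c.restrict V) L' (fun p => f p) := by
  intro p₀
  obtain ⟨U, hU, hp, F, hF, hf⟩ := hf p₀
  refine ⟨U, hU, hp, fun i j p => F i j p, fun i j => ?_, fun p hp => hf p hp⟩
  obtain ⟨κ, _, g, e, hg, he, h⟩ := hF i j
  exact ⟨κ, inferInstance, g, e, hg, he, fun p hp => h p hp⟩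

/-- Being of class `GH^∞` is a local property in the DeWitt topology. -/
theorem isGH_of_restrict {f : X → Gr L} (h : ∀ p₀, ∃ V, IsOpen V ∧ realBody (c.x p₀) ∈ V ∧
    IsGH (c.restrict V) L' (fun p => f p)) : IsGH c L' f := by
  intro p₀
  obtain ⟨V, hV, hp, h⟩ := h p₀
  obtain ⟨U, hU, hpU, F, hF, hf⟩ := h ⟨p₀, hp⟩
  choose κ i g e hg he h using hF
  refine ⟨V ∩ U, hV.inter hU, ⟨hp, hpU⟩,
    fun a b p => ∑ k, grassmannCont (g a b k) (c.x p) * e a b k, fun a b => ?_, fun p hp => ?_⟩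
  · exact ⟨κ a b, i a b, g a b, e a b, fun k => (hg a b k).mono Set.inter_subset_right, he a b,
      fun _ _ => rfl⟩
  · refine (hf ⟨p, hp.1⟩ hp.2).trans ?_
    refine Finset.sum_congr rfl fun a _ => Finset.sum_congr rfl fun b _ => ?_
    rw [h a b ⟨p, hp.1⟩ hp.2]
    rfl

theorem isGH_grassmannCont {W : Set (Fin m → ℝ)} (hW : IsOpen W)
    (hcW : ∀ p, realBody (c.x p) ∈ W) {g : (Fin m → ℝ) → ℂ} (hg : ContDiffOn ℝ ∞ g W) :
    IsGH c L' (fun p => grassmannCont g (c.x p)) := by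
  intro p₀
  refine ⟨W, hW, hcW p₀, fun i j p => if i = 0 ∧ j = 0 then grassmannCont g (c.x p) else 0,
    fun i j => ?_, fun p hp => by simp [Fin.sum_univ_two]⟩
  by_cases h : i = 0 ∧ j = 0
  · simp only [h]
    exact ⟨Unit, inferInstance, fun _ => g, fun _ => 1, fun _ => hg, fun _ => one_mem _,
      fun p _ => by simp⟩
  · simp only [h]
    exact .const (zero_mem _)

theorem isGH_x (hc : ∀ p j, (Gr.body (c.x p j)).im = 0) (j : Fin m) :
    IsGH c L' (fun p => c.x p j) := by
  have := isGH_grassmannCont (c := c) (L' := L') isOpen_univ (fun _ => trivial)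
    (contDiff_coordFun j).contDiffOn
  simpa only [grassmannCont_coordFun (hc _ j)] using this

theorem isGH_ξ (j : Fin 2) : IsGH c L' (fun p => c.ξ p j) := by
  intro p₀
  refine ⟨Set.univ, isOpen_univ, trivial, fun a b _ => if a.val + j.val = 1 ∧ b = j then 1 else 0,
    fun a b => ?_, fun p _ => ?_⟩
  · dsimp only
    split_ifs
    exacts [.const (one_mem _), .const (zero_mem _)]
  · fin_cases j <;> simp [Fin.sum_univ_two]

theorem IsGH.sum {ι : Type*} {s : Finset ι} {f : ι → X → Gr L} (hf : ∀ i ∈ s, IsGH c L' (f i)) :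
    IsGH c L' (fun p => ∑ i ∈ s, f i p) := by
  have : ∑ i ∈ s, f i ∈ GHFun c L' := sum_mem hf
  simpa [Finset.sum_fn] using (show IsGH c L' (∑ i ∈ s, f i) from this)

theorem IsGH.pow {f : X → Gr L} (hf : IsGH c L' f) (k : ℕ) : IsGH c L' (f ^ k) :=
  pow_mem (S := GHFun c L') hf k

theorem IsGH.smul {f : X → Gr L} (hf : IsGH c L' f) (z : ℂ) : IsGH c L' (z • f) :=
  (GHFun c L').smul_mem hf z

theorem IsGH.neg {f : X → Gr L} (hf : IsGH c L' f) : IsGH c L' (-f) :=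
  (GHFun c L').neg_mem hf

theorem IsGH.sub {f g : X → Gr L} (hf : IsGH c L' f) (hg : IsGH c L' g) : IsGH c L' (f - g) :=
  (GHFun c L').sub_mem hf hg

/-- Pullback of `GH^∞` functions along a map given in the even coordinates by
`x' = Ŷ(x) + ξ_1 ξ_2 Ẑ(x)` and in the odd ones by `GH^∞` functions. -/
theorem IsGH.comp {φ : X → X'} {W : Set (Fin m → ℝ)} (hW : IsOpen W)
    (hcW : ∀ p, realBody (c.x p) ∈ W) {Y Z : Fin m' → (Fin m → ℝ) → ℝ}
    (hY : ∀ i, ContDiffOn ℝ ∞ (Y i) W) (hZ : ∀ i, ContDiffOn ℝ ∞ (Z i) W)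
    (hx : ∀ p i, c'.x (φ p) i = grassmannCont (fun v => (Y i v : ℂ)) (c.x p) +
      c.ξ p 0 * c.ξ p 1 * grassmannCont (fun v => (Z i v : ℂ)) (c.x p))
    (hξ : ∀ j, IsGH c L' (fun p => c'.ξ (φ p) j)) {f : X' → Gr L} (hf : IsGH c' L' f) :
    IsGH c L' (fun p => f (φ p)) := by
  refine isGH_of_restrict fun p₀ => ?_
  obtain ⟨U, hU, hpU, F, hF, hf⟩ := hf (φ p₀)
  have hYc : ContDiffOn ℝ ∞ (fun v i => Y i v) W := contDiffOn_pi.mpr hY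
  have hb : ∀ p, realBody (c'.x (φ p)) = fun i => Y i (realBody (c.x p)) := fun p => by
    funext i
    have h0 : Gr.body (c.ξ p 0 * c.ξ p 1) = 0 :=
      Gr.body_eq_zero_of_sq (Gr.odd_mul_sq (c.ξ_mem p 0) (c.ξ_mem p 1))
    simp only [realBody]
    rw [hx, Gr.body_add, Gr.body_mul, h0, zero_mul, add_zero, body_grassmannCont, Complex.ofReal_re]
  set V := W ∩ (fun v i => Y i v) ⁻¹' U with hVdef
  have hV : IsOpen V := hYc.continuousOn.isOpen_inter_preimage hW hU
  have hVU : ∀ p : {p // realBody (c.x p) ∈ V}, realBody (c'.x (φ p)) ∈ U := fun p =>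
    hb p ▸ p.2.2
  refine ⟨V, hV, ⟨hcW p₀, by rwa [hb] at hpU⟩, ?_⟩
  choose κ i g e hg he h using hF
  have main : (fun p : {p // realBody (c.x p) ∈ V} => f (φ p)) =
      fun p : {p // realBody (c.x p) ∈ V} => ∑ a, ∑ b,
      (∑ k, (grassmannCont (fun v => g a b k fun i => Y i v) (c.x p) +
        c.ξ p 0 * c.ξ p 1 * grassmannCont (fun v => ∑ i, (Z i v : ℂ) *
          partialD i (g a b k) fun i => Y i v) (c.x p)) * e a b k) *
        (c'.ξ (φ p) 0 ^ (a : ℕ) * c'.ξ (φ p) 1 ^ (b : ℕ)) := by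
    funext p
    refine (hf _ (hVU p)).trans ?_
    refine Finset.sum_congr rfl fun a _ => Finset.sum_congr rfl fun b _ => ?_
    rw [h a b _ (hVU p)]
    congr 1
    refine Finset.sum_congr rfl fun k _ => ?_
    rw [← grassmannCont_comp (c.x_mem p) hW (hcW p) hY hZ
      (Gr.odd_mul_odd (c.ξ_mem p 0) (c.ξ_mem p 1)) (Gr.odd_mul_sq (c.ξ_mem p 0) (c.ξ_mem p 1))
      hU p.2.2 (hg a b k)]
    rw [show c'.x (φ p) = _ from funext (hx p)]
  rw [main]
  have hZo : ∀ i, ContDiffOn ℝ ∞ (fun v => (Z i v : ℂ)) V := fun i =>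
    (Complex.ofRealCLM.contDiff.comp_contDiffOn (hZ i)).mono Set.inter_subset_left
  have hYV : ContDiffOn ℝ ∞ (fun v i => Y i v) V := hYc.mono Set.inter_subset_left
  have hYU : Set.MapsTo (fun v i => Y i v) V U := fun v hv => hv.2
  refine IsGH.sum fun a _ => IsGH.sum fun b _ => IsGH.mul (IsGH.sum fun k _ =>
    IsGH.mul (IsGH.add ?_ (IsGH.mul (IsGH.mul (isGH_ξ (c := c.restrict V) 0)
      (isGH_ξ (c := c.restrict V) 1)) ?_)) (isGH_const (he a b k)))
    (IsGH.mul (((hξ 0).restrict V).pow a) (((hξ 1).restrict V).pow b))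
  · exact isGH_grassmannCont (c := c.restrict V) hV (fun p => p.2) ((hg a b k).comp hYV hYU)
  · exact isGH_grassmannCont (c := c.restrict V) hV (fun p => p.2) (ContDiffOn.sum fun i _ =>
      (hZo i).mul ((partialD_smooth hU (hg a b k) i).comp hYV hYU))

end GHComp

/-! ### The graded involution -/

namespace GradedInvolution

variable {L : ℕ} (D : GradedInvolution L)

theorem map_zero : D 0 = 0 := by
  have := D.map_smul 0 0
  simpa using this

theorem map_algebraMap (c : ℂ) :
    D (algebraMap ℂ (Gr L) c) = algebraMap ℂ (Gr L) ((starRingEnd ℂ) c) := by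
  rw [Algebra.algebraMap_eq_smul_one, D.map_smul, D.map_one, Algebra.algebraMap_eq_smul_one]

theorem map_sum {ι : Type*} (s : Finset ι) (f : ι → Gr L) : D (∑ i ∈ s, f i) = ∑ i ∈ s, D (f i) := by
  classical
  induction s using Finset.induction_on with
  | empty => simp [D.map_zero]
  | insert a s ha ih => rw [Finset.sum_insert ha, Finset.sum_insert ha, D.map_add, ih]

theorem map_pow (z : Gr L) (k : ℕ) : D (z ^ k) = D z ^ k := by
  induction k with
  | zero => rw [pow_zero, pow_zero, D.map_one]
  | succ k ih => rw [pow_succ, pow_succ, D.map_mul, ih]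

/-- The involution preserves nilpotency, so the body of `z^◇` is the conjugate of the body of `z`. -/
theorem body_map (z : Gr L) : Gr.body (D z) = (starRingEnd ℂ) (Gr.body z) := by
  have hfil : ∀ k, ∀ u ∈ Gr.fil L 1, u ^ k ∈ Gr.fil L k := fun k u hu => by
    induction k with
    | zero => simp [Gr.fil]
    | succ k ih => exact pow_succ u k ▸ Gr.fil_mul ih hu
  have hs : Gr.soul z ^ (L + 1) = 0 :=
    Gr.fil_eq_zero (Nat.lt_succ_self L) (hfil _ _ (Gr.soul_mem_fil z))
  have h1 : D (Gr.soul z) ^ (L + 1) = 0 := by rw [← D.map_pow, hs, D.map_zero]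
  have h2 : ∀ k (w : Gr L), Gr.body (w ^ k) = Gr.body w ^ k := fun k w => by simp [Gr.body]
  have h3 : Gr.body (D (Gr.soul z)) = 0 := by
    have := congrArg Gr.body h1
    rw [h2] at this
    exact pow_eq_zero_iff (Nat.succ_ne_zero L) |>.mp (this.trans (by simp [Gr.body]))
  have h4 : D z = algebraMap ℂ (Gr L) ((starRingEnd ℂ) (Gr.body z)) + D (Gr.soul z) := by
    rw [← D.map_algebraMap, ← D.map_add]; simp [Gr.soul]
  rw [h4, Gr.body_add, h3, Gr.body_algebraMap, add_zero]

theorem soul_map (z : Gr L) : Gr.soul (D z) = D (Gr.soul z) := by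
  rw [Gr.soul, Gr.soul, D.map_sub, D.map_algebraMap, D.body_map]

theorem body_im_of_real {z : Gr L} (hz : D z = z) : (Gr.body z).im = 0 := by
  have h := D.body_map z
  rw [hz] at h
  exact Complex.conj_eq_iff_im.mp h.symm

theorem map_taylorTerm {m : ℕ} {s : Fin m → Gr L} (hs : ∀ j, D (s j) = s j) (k : ℕ)
    (g : (Fin m → ℝ) → ℂ) (v : Fin m → ℝ) :
    D (taylorTerm s k g v) = taylorTerm s k (fun w => (starRingEnd ℂ) (g w)) v := by
  induction k generalizing g with
  | zero => exact D.map_algebraMap _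
  | succ k ih =>
    rw [taylorTerm, taylorTerm, D.map_sum]
    refine Finset.sum_congr rfl fun j _ => ?_
    rw [D.map_mul, hs, ih]
    congr 2
    funext w
    have := Complex.conjCLE.comp_fderiv (f := g) (x := w)
    change Complex.conjCLE (fderiv ℝ g w _) = fderiv ℝ (Complex.conjCLE ∘ g) w _
    rw [this]
    rfl

theorem map_grassmannCont {m : ℕ} {x : Fin m → Gr L} (hx : ∀ j, D (x j) = x j)
    (g : (Fin m → ℝ) → ℂ) :
    D (grassmannCont g x) = grassmannCont (fun w => (starRingEnd ℂ) (g w)) x := by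
  rw [grassmannCont, grassmannCont, D.map_sum]
  refine Finset.sum_congr rfl fun k _ => ?_
  rw [D.map_smul, D.map_taylorTerm fun j => by rw [← soul_map, hx]]
  simp

theorem map_grassmannCont_ofReal {m : ℕ} {x : Fin m → Gr L} (hx : ∀ j, D (x j) = x j)
    (g : (Fin m → ℝ) → ℝ) :
    D (grassmannCont (fun v => (g v : ℂ)) x) = grassmannCont (fun v => (g v : ℂ)) x := by
  rw [D.map_grassmannCont hx]; simp

end GradedInvolution

theorem isGH_x_of_real {L m L' : ℕ} {X : Type} {c : SuperCoords L m X} (D : GradedInvolution L)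
    (hc : ∀ p j, D (c.x p j) = c.x p j) (j : Fin m) : IsGH c L' (fun p => c.x p j) :=
  isGH_x (fun p j => D.body_im_of_real (hc p j)) j

theorem UOSP.coords_real {L : ℕ} {D : GradedInvolution L} (s : UOSP D) (j : Fin 4) :
    D ((UOSP.coords D).x s j) = (UOSP.coords D).x s j := by
  have ha := D.even_invol s.a_mem
  have hb := D.even_invol s.b_mem
  have h2 : (starRingEnd ℂ) (1 / 2) = 1 / 2 := by simp [Complex.ext_iff]
  have hI : (starRingEnd ℂ) (-Complex.I / 2) = -(-Complex.I / 2) := by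
    rw [map_div₀, map_neg, Complex.conj_I, map_ofNat]
    ring
  fin_cases j
  · change D ((1 / 2 : ℂ) • (s.a + D s.a)) = (1 / 2 : ℂ) • (s.a + D s.a)
    rw [D.map_smul, D.map_add, ha, h2, add_comm]
  · change D ((-Complex.I / 2) • (s.a - D s.a)) = (-Complex.I / 2) • (s.a - D s.a)
    rw [D.map_smul, D.map_sub, ha, hI, neg_smul, ← smul_neg, neg_sub]
  · change D ((1 / 2 : ℂ) • (s.b + D s.b)) = (1 / 2 : ℂ) • (s.b + D s.b)
    rw [D.map_smul, D.map_add, hb, h2, add_comm]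
  · change D ((-Complex.I / 2) • (s.b - D s.b)) = (-Complex.I / 2) • (s.b - D s.b)
    rw [D.map_smul, D.map_sub, hb, hI, neg_smul, ← smul_neg, neg_sub]

namespace UOSP

variable {L L' : ℕ} {D : GradedInvolution L}

theorem a_eq (s : UOSP D) :
    s.a = (UOSP.coords D).x s 0 + Complex.I • (UOSP.coords D).x s 1 := by
  change s.a = (1 / 2 : ℂ) • (s.a + D s.a) + Complex.I • ((-Complex.I / 2) • (s.a - D s.a))
  rw [smul_smul, show Complex.I * (-Complex.I / 2) = 1 / 2 by
    linear_combination (-1 / 2) * Complex.I_sq, ← smul_add, add_add_sub_cancel, ← two_smul ℂ,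
    smul_smul]
  norm_num

theorem b_eq (s : UOSP D) :
    s.b = (UOSP.coords D).x s 2 + Complex.I • (UOSP.coords D).x s 3 := by
  change s.b = (1 / 2 : ℂ) • (s.b + D s.b) + Complex.I • ((-Complex.I / 2) • (s.b - D s.b))
  rw [smul_smul, show Complex.I * (-Complex.I / 2) = 1 / 2 by
    linear_combination (-1 / 2) * Complex.I_sq, ← smul_add, add_add_sub_cancel, ← two_smul ℂ,
    smul_smul]
  norm_num

theorem map_a_eq (s : UOSP D) :
    D s.a = (UOSP.coords D).x s 0 - Complex.I • (UOSP.coords D).x s 1 := by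
  conv_lhs => rw [a_eq, D.map_add, D.map_smul, coords_real, coords_real, Complex.conj_I, neg_smul,
    ← sub_eq_add_neg]

theorem map_b_eq (s : UOSP D) :
    D s.b = (UOSP.coords D).x s 2 - Complex.I • (UOSP.coords D).x s 3 := by
  conv_lhs => rw [b_eq, D.map_add, D.map_smul, coords_real, coords_real, Complex.conj_I, neg_smul,
    ← sub_eq_add_neg]

theorem isGH_coord (j : Fin 4) : IsGH (UOSP.coords D) L' (fun s => (UOSP.coords D).x s j) :=
  isGH_x_of_real D UOSP.coords_real j

theorem isGH_a : IsGH (UOSP.coords D) L' UOSP.a := by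
  rw [funext (a_eq (D := D))]
  exact (isGH_coord 0).add ((isGH_coord 1).smul _)

theorem isGH_b : IsGH (UOSP.coords D) L' UOSP.b := by
  rw [funext (b_eq (D := D))]
  exact (isGH_coord 2).add ((isGH_coord 3).smul _)

theorem isGH_map_a : IsGH (UOSP.coords D) L' (fun s => D s.a) := by
  rw [funext (map_a_eq (D := D))]
  exact (isGH_coord 0).sub ((isGH_coord 1).smul _)

theorem isGH_map_b : IsGH (UOSP.coords D) L' (fun s => D s.b) := by
  rw [funext (map_b_eq (D := D))]
  exact (isGH_coord 2).sub ((isGH_coord 3).smul _)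

theorem isGH_η : IsGH (UOSP.coords D) L' UOSP.η := isGH_ξ (c := UOSP.coords D) 0

theorem isGH_map_η : IsGH (UOSP.coords D) L' (fun s => D s.η) := isGH_ξ (c := UOSP.coords D) 1

end UOSP

/-! ### Algebra of the projection onto the supersphere -/

namespace Gr

variable {L : ℕ}

theorem even_mem_center {z : Gr L} (hz : z ∈ part L 0) : z ∈ Subalgebra.center ℂ (Gr L) :=
  Subalgebra.mem_center_iff.mpr fun w => (even_comm hz w).symm

end Gr

namespace SuperSphere

variable {L : ℕ} {D : GradedInvolution L}

theorem eq_of_coords {p q : SuperSphere D} (hx : ∀ i, p.x i = q.x i) (hξ : ∀ j, p.ξ j = q.ξ j) :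
    p = q := by
  cases p; cases q
  simp only [mk.injEq]
  exact ⟨funext hx, funext hξ⟩

/-- The nilpotent even element `ξ_1 ξ_2`. -/
noncomputable def u (p : SuperSphere D) : Gr L := p.ξ 0 * p.ξ 1

/-- The rescaled even coordinates `y = (1 + ξ_1 ξ_2) x`, which satisfy `∑ y_i² = 1`. -/
noncomputable def y (p : SuperSphere D) (i : Fin 3) : Gr L := p.x i + p.u * p.x i

theorem u_even (p : SuperSphere D) : p.u ∈ Gr.part L 0 := Gr.odd_mul_odd (p.ξ_mem 0) (p.ξ_mem 1)

theorem u_sq (p : SuperSphere D) : p.u * p.u = 0 := Gr.odd_mul_sq (p.ξ_mem 0) (p.ξ_mem 1)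

theorem y_even (p : SuperSphere D) (i : Fin 3) : p.y i ∈ Gr.part L 0 :=
  add_mem (p.x_mem i) (Gr.even_mul p.u_even (p.x_mem i))

theorem map_ξ_one (p : SuperSphere D) : D (p.ξ 1) = -p.ξ 0 := by
  rw [← p.ξ_conj, D.odd_invol (p.ξ_mem 0)]

theorem u_real (p : SuperSphere D) : D p.u = p.u := by
  rw [u, D.map_mul, p.ξ_conj, p.map_ξ_one, mul_neg, ← Gr.odd_swap (p.ξ_mem 0) (p.ξ_mem 1)]

theorem y_real (p : SuperSphere D) (i : Fin 3) : D (p.y i) = p.y i := by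
  rw [y, D.map_add, D.map_mul, p.x_real, p.u_real]

theorem realBody_y (p : SuperSphere D) : realBody p.y = realBody p.x := by
  funext i
  simp [realBody, y, Gr.body_add, Gr.body_mul, Gr.body_eq_zero_of_sq p.u_sq]

theorem x_eq (p : SuperSphere D) (i : Fin 3) : p.y i * (1 - p.u) = p.x i := by
  have hu := p.u_sq
  have h := Gr.even_comm p.u_even (p.x i)
  rw [y, h, mul_sub, mul_one, add_mul, mul_assoc, hu, mul_zero]
  abel

theorem sum_y_sq (p : SuperSphere D) : p.y 0 * p.y 0 + p.y 1 * p.y 1 + p.y 2 * p.y 2 = 1 := by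
  have h : p.x 0 ^ 2 + p.x 1 ^ 2 + p.x 2 ^ 2 + (p.u + p.u) = 1 := by
    simpa [Fin.sum_univ_three, u, two_mul] using p.sphere
  have key : ∀ {R : Type} [CommRing R] (x₀ x₁ x₂ u : R), u * u = 0 →
      x₀ ^ 2 + x₁ ^ 2 + x₂ ^ 2 + (u + u) = 1 →
      (x₀ + u * x₀) * (x₀ + u * x₀) + (x₁ + u * x₁) * (x₁ + u * x₁) +
        (x₂ + u * x₂) * (x₂ + u * x₂) = 1 := fun x₀ x₁ x₂ u hu h => by
    linear_combination (1 + u) ^ 2 * h - 3 * hu - 2 * u * hu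
  exact congrArg (Subalgebra.center ℂ (Gr L)).val (key ⟨_, Gr.even_mem_center (p.x_mem 0)⟩
    ⟨_, Gr.even_mem_center (p.x_mem 1)⟩ ⟨_, Gr.even_mem_center (p.x_mem 2)⟩
    ⟨_, Gr.even_mem_center p.u_even⟩ (Subtype.ext p.u_sq) (Subtype.ext h))

/-- The odd parameter `η = 2 (a ξ_2 - b ξ_1)` of a point of `UOSP(1,2)` over `p`. -/
noncomputable def oddParam (p : SuperSphere D) (a b : Gr L) : Gr L :=
  (2 : ℂ) • (a * p.ξ 1 - b * p.ξ 0)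

theorem map_oddParam (p : SuperSphere D) (a b : Gr L) :
    D (p.oddParam a b) = -((2 : ℂ) • (D a * p.ξ 0 + D b * p.ξ 1)) := by
  have h2 : (starRingEnd ℂ) 2 = 2 := map_ofNat _ 2
  rw [oddParam, D.map_smul, D.map_sub, D.map_mul, D.map_mul, p.ξ_conj, p.map_ξ_one, h2, ← smul_neg]
  congr 1
  noncomm_ring

theorem oddParam_odd (p : SuperSphere D) {a b : Gr L} (ha : a ∈ Gr.part L 0)
    (hb : b ∈ Gr.part L 0) : p.oddParam a b ∈ Gr.part L 1 := by
  have m01 : ∀ {z w : Gr L}, z ∈ Gr.part L 0 → w ∈ Gr.part L 1 → z * w ∈ Gr.part L 1 :=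
    fun hz hw => CliffordAlgebra.evenOdd_mul_le _ 0 1 (Submodule.mul_mem_mul hz hw)
  exact Submodule.smul_mem _ _ (sub_mem (m01 ha (p.ξ_mem 1)) (m01 hb (p.ξ_mem 0)))

/-- If `a`, `b` satisfy the equations `a a^◇ = (1 + y_1) / 2`, `b b^◇ = (1 - y_1) / 2`,
`a b^◇ = (y_2 + i y_3) / 2`, they determine a point over `p`. -/
theorem exists_hopf_eq (p : SuperSphere D) {a b : Gr L} (ha : a ∈ Gr.part L 0)
    (hb : b ∈ Gr.part L 0) (haa : a * D a = (1 / 2 : ℂ) • (1 + p.y 0))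
    (hbb : b * D b = (1 / 2 : ℂ) • (1 - p.y 0))
    (hab : a * D b = (1 / 2 : ℂ) • (p.y 1 + Complex.I • p.y 2)) :
    ∃ s : UOSP D, hopf s = p ∧ s.a = a ∧ s.b = b ∧ s.η = p.oddParam a b := by
  have hh : (starRingEnd ℂ) (1 / 2) = 1 / 2 := by simp [Complex.ext_iff]
  have hba : b * D a = (1 / 2 : ℂ) • (p.y 1 - Complex.I • p.y 2) := by
    have h := congrArg D hab
    rw [D.map_mul, D.even_invol hb, D.map_smul, D.map_add, D.map_smul, p.y_real, p.y_real, hh,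
      Complex.conj_I, neg_smul, ← sub_eq_add_neg, ← Gr.even_comm hb] at h
    exact h
  have hn : a * D a + b * D b = 1 := by
    rw [haa, hbb, ← smul_add, add_add_sub_cancel, ← two_smul ℂ, smul_smul]; norm_num
  have hm : a * D a - b * D b = p.y 0 := by
    rw [haa, hbb, ← smul_sub, add_sub_sub_cancel, ← two_smul ℂ, smul_smul]; norm_num
  have ha' := D.map_mem 0 _ ha
  have hb' := D.map_mem 0 _ hb
  have h0 := p.ξ_mem 0
  have h1 := p.ξ_mem 1
  -- even elements are moved to the left
  have ca : ∀ w, w * D a = D a * w := fun w => (Gr.even_comm ha' w).symm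
  have cb : ∀ w, w * D b = D b * w := fun w => (Gr.even_comm hb' w).symm
  have ht : p.oddParam a b * D (p.oddParam a b) = (4 : ℂ) • p.u := by
    have e1 : a * p.ξ 1 * (D a * p.ξ 0) = -(a * D a * p.u) := by
      rw [mul_assoc, ← mul_assoc (p.ξ 1), ca, mul_assoc, Gr.odd_swap h1 h0, u, mul_neg, mul_neg,
        mul_assoc]
    have e2 : a * p.ξ 1 * (D b * p.ξ 1) = 0 := by
      rw [mul_assoc, ← mul_assoc (p.ξ 1), cb, mul_assoc, Gr.odd_sq h1, mul_zero, mul_zero]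
    have e3 : b * p.ξ 0 * (D a * p.ξ 0) = 0 := by
      rw [mul_assoc, ← mul_assoc (p.ξ 0), ca, mul_assoc, Gr.odd_sq h0, mul_zero, mul_zero]
    have e4 : b * p.ξ 0 * (D b * p.ξ 1) = b * D b * p.u := by
      rw [mul_assoc, ← mul_assoc (p.ξ 0), cb, mul_assoc, u, mul_assoc]
    rw [map_oddParam, oddParam, mul_neg, smul_mul_smul_comm, sub_mul, mul_add, mul_add, e1, e2, e3,
      e4, ← smul_neg]
    rw [show (4 : ℂ) • p.u = (2 * 2 : ℂ) • ((a * D a + b * D b) * p.u) by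
      rw [hn, one_mul]; norm_num]
    congr 1
    noncomm_ring
  have hX : ∀ z, z * (1 - (1 / 4 : ℂ) • (4 : ℂ) • p.u) = z * (1 - p.u) := fun z => by
    rw [smul_smul]; norm_num
  refine ⟨⟨a, b, p.oddParam a b, ha, hb, p.oddParam_odd ha hb, hn⟩, eq_of_coords (fun i => ?_)
    (fun j => ?_), rfl, rfl, rfl⟩
  · rw [← p.x_eq i]
    fin_cases i
    · change (a * D a - b * D b) * (1 - (1 / 4 : ℂ) • (_ * _)) = _
      rw [ht, hX, hm]
      rfl
    · change (a * D b + b * D a) * (1 - (1 / 4 : ℂ) • (_ * _)) = _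
      rw [ht, hX, hab, hba, ← smul_add, add_add_sub_cancel, ← two_smul ℂ, smul_smul]
      norm_num
    · change (-Complex.I) • ((a * D b - b * D a) * (1 - (1 / 4 : ℂ) • (_ * _))) = _
      rw [ht, hX, hab, hba, ← smul_sub, add_sub_sub_cancel, ← two_smul ℂ, smul_smul, smul_smul,
        ← smul_mul_assoc, smul_smul]
      rw [show -Complex.I * (1 / 2 * 2 * Complex.I) = 1 by linear_combination -Complex.I_sq,
        one_smul]
      rfl
  · have e1 : a * (D a * p.ξ 0 + D b * p.ξ 1) - (a * p.ξ 1 - b * p.ξ 0) * D b = p.ξ 0 := by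
      rw [sub_mul, mul_assoc, cb, mul_assoc b, cb, mul_add]
      simp only [← mul_assoc]
      rw [add_comm (a * D a * p.ξ 0), add_sub_sub_cancel, ← add_mul, hn, one_mul]
    have e2 : (a * p.ξ 1 - b * p.ξ 0) * D a + b * (D a * p.ξ 0 + D b * p.ξ 1) = p.ξ 1 := by
      rw [sub_mul, mul_assoc, ca, mul_assoc b, ca, mul_add]
      simp only [← mul_assoc]
      rw [add_comm (b * D a * p.ξ 0), sub_add_add_cancel, ← add_mul, hn, one_mul]
    fin_cases j
    · change -(1 / 2 : ℂ) • (a * D (p.oddParam a b) + p.oddParam a b * D b) = p.ξ 0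
      rw [map_oddParam, oddParam, mul_neg, mul_smul_comm, smul_mul_assoc, ← smul_neg, ← smul_add,
        smul_smul, show -(1 / 2 : ℂ) * 2 = -1 by norm_num, neg_one_smul]
      refine Eq.trans ?_ e1
      abel
    · change (1 / 2 : ℂ) • (p.oddParam a b * D a - b * D (p.oddParam a b)) = p.ξ 1
      rw [map_oddParam, oddParam, mul_neg, mul_smul_comm, smul_mul_assoc, sub_neg_eq_add, ← smul_add,
        smul_smul, show (1 / 2 : ℂ) * 2 = 1 by norm_num, one_smul, e2]

end SuperSphere

namespace UOSP

variable {L : ℕ} {D : GradedInvolution L}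

theorem hopf_u (s : UOSP D) : (hopf s).u = (1 / 4 : ℂ) • (s.η * D s.η) := by
  have hη := s.η_mem
  have hη' := D.map_mem 1 _ hη
  have ha' := D.map_mem 0 _ s.a_mem
  have hb' := D.map_mem 0 _ s.b_mem
  have e1 : s.a * D s.η * (s.η * D s.a) = -(s.a * D s.a * (s.η * D s.η)) := by
    rw [mul_assoc, ← mul_assoc (D s.η), Gr.odd_swap hη' hη, neg_mul, mul_neg,
      ← Gr.even_comm ha', mul_assoc]
  have e2 : s.a * D s.η * (s.b * D s.η) = 0 := by
    rw [Gr.even_comm s.b_mem, mul_assoc, ← mul_assoc (D s.η), Gr.odd_sq hη']; simp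
  have e3 : s.η * D s.b * (s.η * D s.a) = 0 := by
    rw [← Gr.even_comm hb', mul_assoc, ← mul_assoc s.η, Gr.odd_sq hη]; simp
  have e4 : s.η * D s.b * (s.b * D s.η) = s.b * D s.b * (s.η * D s.η) := by
    rw [← Gr.even_comm hb', mul_assoc, ← mul_assoc s.η, ← Gr.even_comm s.b_mem, mul_assoc,
      ← mul_assoc, Gr.even_comm hb']
  change -(1 / 2 : ℂ) • (s.a * D s.η + s.η * D s.b) *
    ((1 / 2 : ℂ) • (s.η * D s.a - s.b * D s.η)) = _
  rw [smul_mul_smul_comm, add_mul, mul_sub, mul_sub, e1, e2, e3, e4, sub_zero, zero_sub, ← neg_add,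
    ← add_mul, s.norm, one_mul, smul_neg, ← neg_smul]
  norm_num

/-- Rescaling by `1 + ξ_1 ξ_2` removes the nilpotent factor of the even coordinates of `hopf s`. -/
theorem rescale (s : UOSP D) (z : Gr L) :
    z * (1 - (1 / 4 : ℂ) • (s.η * D s.η)) + (hopf s).u * (z * (1 - (1 / 4 : ℂ) • (s.η * D s.η))) =
      z := by
  rw [← hopf_u, Gr.even_comm (hopf s).u_even, mul_assoc, ← mul_add, sub_mul, (hopf s).u_sq]
  simp

theorem hopf_y0 (s : UOSP D) : (hopf s).y 0 = s.a * D s.a - s.b * D s.b := s.rescale _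

theorem hopf_y1 (s : UOSP D) : (hopf s).y 1 = s.a * D s.b + s.b * D s.a := s.rescale _

theorem hopf_y2 (s : UOSP D) :
    (hopf s).y 2 = (-Complex.I) • (s.a * D s.b - s.b * D s.a) := by
  rw [← s.rescale ((-Complex.I) • (s.a * D s.b - s.b * D s.a)), smul_mul_assoc]
  rfl

theorem a_map_a (s : UOSP D) : s.a * D s.a = (1 / 2 : ℂ) • (1 + (hopf s).y 0) := by
  rw [hopf_y0, ← s.norm, add_add_sub_cancel, ← two_smul ℂ, smul_smul]; norm_num

theorem b_map_b (s : UOSP D) : s.b * D s.b = (1 / 2 : ℂ) • (1 - (hopf s).y 0) := by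
  rw [hopf_y0, ← s.norm, add_sub_sub_cancel, ← two_smul ℂ, smul_smul]; norm_num

theorem a_map_b (s : UOSP D) :
    s.a * D s.b = (1 / 2 : ℂ) • ((hopf s).y 1 + Complex.I • (hopf s).y 2) := by
  rw [hopf_y1, hopf_y2, smul_smul, show Complex.I * -Complex.I = 1 by
    linear_combination -Complex.I_sq, one_smul, add_add_sub_cancel, ← two_smul ℂ, smul_smul]
  norm_num

theorem η_eq (s : UOSP D) : s.η = (hopf s).oddParam s.a s.b := by
  have ca : ∀ w, w * s.a = s.a * w := fun w => (Gr.even_comm s.a_mem w).symm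
  have cb : ∀ w, w * s.b = s.b * w := fun w => (Gr.even_comm s.b_mem w).symm
  have h : s.a * (s.η * D s.a - s.b * D s.η) + s.b * (s.a * D s.η + s.η * D s.b) = s.η := by
    rw [mul_sub, mul_add, ← mul_assoc, ← mul_assoc, ← mul_assoc, ← mul_assoc, ← cb s.a,
      add_comm (s.a * s.b * D s.η), sub_add_add_cancel, Gr.even_comm s.a_mem, Gr.even_comm s.b_mem,
      mul_assoc, mul_assoc,
      ← mul_add, s.norm, mul_one]
  change s.η = (2 : ℂ) • (s.a * ((1 / 2 : ℂ) • (s.η * D s.a - s.b * D s.η)) -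
    s.b * (-(1 / 2 : ℂ) • (s.a * D s.η + s.η * D s.b)))
  rw [mul_smul_comm, mul_smul_comm, neg_smul, sub_neg_eq_add, ← smul_add, h, smul_smul]
  norm_num

end UOSP

/-! ### The fibres of the projection -/

namespace UOSP

variable {L : ℕ} {D : GradedInvolution L}

theorem b_map_a (s : UOSP D) :
    s.b * D s.a = (1 / 2 : ℂ) • ((hopf s).y 1 - Complex.I • (hopf s).y 2) := by
  rw [hopf_y1, hopf_y2, smul_smul, show Complex.I * -Complex.I = 1 by
    linear_combination -Complex.I_sq, one_smul, add_sub_sub_cancel, ← two_smul ℂ, smul_smul]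
  norm_num

section Action

variable {w : Gr L}

/-- A factor `w` and a factor `w^◇` cancel. -/
theorem mul_cancel_superU1 (hw : w ∈ superU1 D) (z z' : Gr L) : z * w * (z' * D w) = z * z' := by
  rw [mul_assoc, ← mul_assoc w, Gr.even_comm hw.1, mul_assoc z', hw.2, mul_one]

theorem mul_cancel_superU1' (hw : w ∈ superU1 D) (z z' : Gr L) : z * D w * (z' * w) = z * z' := by
  rw [mul_assoc, ← mul_assoc (D w), Gr.even_comm (D.map_mem 0 _ hw.1), mul_assoc z',
    ← Gr.even_comm hw.1, hw.2, mul_one]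

theorem hopf_eq_of_action {s s' : UOSP D} (hw : w ∈ superU1 D) (ha : s'.a = s.a * w)
    (hb : s'.b = s.b * w) (hη : s'.η = s.η * w) : hopf s' = hopf s := by
  have c := mul_cancel_superU1 hw
  refine SuperSphere.eq_of_coords (fun i => ?_) fun j => ?_
  · simp only [hopf, ha, hb, hη, D.map_mul, c]
  · simp only [hopf, ha, hb, hη, D.map_mul, c]

theorem toMatrix_eq_of_action {s s' : UOSP D} (hw : w ∈ superU1 D) (ha : s'.a = s.a * w)
    (hb : s'.b = s.b * w) (hη : s'.η = s.η * w) :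
    s'.toMatrix = s.toMatrix * superU1.toMatrix D w := by
  have c := mul_cancel_superU1 hw
  have c' := mul_cancel_superU1' hw
  have e1 : ∀ z t : Gr L, z * w * (1 - t) = z * (1 - t) * w := fun z t => by
    rw [mul_assoc, Gr.even_comm hw.1, mul_assoc]
  have e2 : ∀ z t : Gr L, z * D w * (1 - t) = z * (1 - t) * D w := fun z t => by
    rw [mul_assoc, Gr.even_comm (D.map_mem 0 _ hw.1), mul_assoc]
  ext i j
  rw [superU1.toMatrix, Matrix.mul_diagonal]
  fin_cases i <;> fin_cases j <;> simp [toMatrix, ha, hb, hη, D.map_mul, c, c', e1, e2]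

theorem action_of_toMatrix_eq {s s' : UOSP D} (hw : w ∈ superU1 D)
    (h : s'.toMatrix = s.toMatrix * superU1.toMatrix D w) :
    s'.a = s.a * w ∧ s'.b = s.b * w ∧ s'.η = s.η * w := by
  have he : ∀ i j, s'.toMatrix i j = s.toMatrix i j * ![1, w, D w] j := fun i j => by
    rw [h, superU1.toMatrix, Matrix.mul_diagonal]
  have hη : s'.η = s.η * w := by
    have h1 : -(1 / 2 : ℂ) • s'.η = -(1 / 2 : ℂ) • s.η * w := he 0 1
    rw [smul_mul_assoc] at h1
    exact (smul_right_injective (Gr L) (by norm_num : -(1 / 2 : ℂ) ≠ 0)) h1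
  have ht : s'.η * D s'.η = s.η * D s.η := by
    rw [hη, D.map_mul, mul_cancel_superU1 hw]
  -- `1 - t / 8` is invertible because `t = η η^◇` squares to zero
  have hinv : (1 - (1 / 8 : ℂ) • (s.η * D s.η)) * (1 + (1 / 8 : ℂ) • (s.η * D s.η)) = 1 := by
    have := Gr.odd_mul_sq s.η_mem (D.map_mem 1 _ s.η_mem)
    rw [sub_mul, mul_add, mul_add, smul_mul_smul_comm, this]
    simp
  have key : ∀ z z' : Gr L, z' * (1 - (1 / 8 : ℂ) • (s.η * D s.η)) =
      z * (1 - (1 / 8 : ℂ) • (s.η * D s.η)) * w → z' = z * w := fun z z' h => by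
    have h2 := congrArg (· * (1 + (1 / 8 : ℂ) • (s.η * D s.η))) h
    simp only [mul_assoc, hinv, mul_one] at h2
    rw [h2, Gr.even_comm hw.1, ← mul_assoc (1 - _), hinv, one_mul]
  refine ⟨key _ _ ?_, key _ _ ?_, hη⟩
  · have h1 : s'.a * (1 - (1 / 8 : ℂ) • (s'.η * D s'.η)) =
      s.a * (1 - (1 / 8 : ℂ) • (s.η * D s.η)) * w := he 1 1
    rwa [ht] at h1
  · have h1 : s'.b * (1 - (1 / 8 : ℂ) • (s'.η * D s'.η)) =
      s.b * (1 - (1 / 8 : ℂ) • (s.η * D s.η)) * w := he 2 1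
    rwa [ht] at h1

end Action

/-- Two points with the same image differ by `w = a^◇ a' + b^◇ b'`. -/
theorem exists_action_of_hopf_eq {s s' : UOSP D} (h : hopf s = hopf s') :
    ∃ w ∈ superU1 D, s'.a = s.a * w ∧ s'.b = s.b * w ∧ s'.η = s.η * w := by
  have haa : s.a * D s.a = s'.a * D s'.a := by rw [a_map_a, a_map_a, h]
  have hbb : s.b * D s.b = s'.b * D s'.b := by rw [b_map_b, b_map_b, h]
  have hab : s.a * D s.b = s'.a * D s'.b := by rw [a_map_b, a_map_b, h]
  have hba : s.b * D s.a = s'.b * D s'.a := by rw [b_map_a, b_map_a, h]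
  have hn : D s'.a * s'.a + D s'.b * s'.b = 1 := by
    rw [← Gr.even_comm s'.a_mem, ← Gr.even_comm s'.b_mem, s'.norm]
  set w := D s.a * s'.a + D s.b * s'.b with hwdef
  have hwe : w ∈ Gr.part L 0 := add_mem (Gr.even_mul (D.map_mem 0 _ s.a_mem) s'.a_mem)
    (Gr.even_mul (D.map_mem 0 _ s.b_mem) s'.b_mem)
  have ha : s'.a = s.a * w := by
    rw [hwdef, mul_add, ← mul_assoc, ← mul_assoc, haa, hab, mul_assoc, mul_assoc, ← mul_add, hn,
      mul_one]
  have hb : s'.b = s.b * w := by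
    rw [hwdef, mul_add, ← mul_assoc, ← mul_assoc, hba, hbb, mul_assoc, mul_assoc, ← mul_add, hn,
      mul_one]
  have hww : w * D w = 1 := by
    have e1 : D s.a * s'.a * D w = s'.a * D s'.a := by
      conv_rhs => rw [ha, D.map_mul, ← ha]
      rw [← Gr.even_comm s'.a_mem, mul_assoc]
    have e2 : D s.b * s'.b * D w = s'.b * D s'.b := by
      conv_rhs => rw [hb, D.map_mul, ← hb]
      rw [← Gr.even_comm s'.b_mem, mul_assoc]
    conv_lhs => rw [hwdef]
    rw [← hwdef, add_mul, e1, e2, s'.norm]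
  refine ⟨w, ⟨hwe, hww⟩, ha, hb, ?_⟩
  rw [η_eq s', ← h, η_eq s, SuperSphere.oddParam, SuperSphere.oddParam, ha, hb, smul_mul_assoc,
    sub_mul, mul_assoc, mul_assoc, Gr.even_comm hwe, Gr.even_comm hwe, mul_assoc, mul_assoc]

theorem hopf_eq_iff (s s' : UOSP D) : hopf s = hopf s' ↔
    ∃ w ∈ superU1 D, s'.toMatrix = s.toMatrix * superU1.toMatrix D w := by
  constructor
  · intro h
    obtain ⟨w, hw, ha, hb, hη⟩ := exists_action_of_hopf_eq h
    exact ⟨w, hw, toMatrix_eq_of_action hw ha hb hη⟩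
  · rintro ⟨w, hw, h⟩
    obtain ⟨ha, hb, hη⟩ := action_of_toMatrix_eq hw h
    exact (hopf_eq_of_action hw ha hb hη).symm

end UOSP

/-! ### Local sections of the projection and descent of `GH^∞` functions -/

theorem ContDiffOn.complex_ofReal {m : ℕ} {g : (Fin m → ℝ) → ℝ} {V : Set (Fin m → ℝ)}
    (hg : ContDiffOn ℝ ∞ g V) : ContDiffOn ℝ ∞ (fun v => (g v : ℂ)) V :=
  Complex.ofRealCLM.contDiff.comp_contDiffOn hg

/-- The continuation to the rescaled coordinates `y = x + ξ_1 ξ_2 x`, expanded around `x`: the increment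
is given by the Euler derivative `∑ v_j ∂_j g`. -/
theorem SuperSphere.grassmannCont_y {L : ℕ} {D : GradedInvolution L} (p : SuperSphere D)
    {W : Set (Fin 3 → ℝ)} (hW : IsOpen W) (hp : realBody p.x ∈ W) {g : (Fin 3 → ℝ) → ℝ}
    (hg : ContDiffOn ℝ ∞ g W) :
    grassmannCont (fun v => (g v : ℂ)) p.y = grassmannCont (fun v => (g v : ℂ)) p.x +
      p.ξ 0 * p.ξ 1 * grassmannCont
        (fun v => ((∑ j, v j * fderiv ℝ g v (Pi.single j 1) : ℝ) : ℂ)) p.x := by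
  have hc : ∀ j, grassmannCont (fun v => (v j : ℂ)) p.x = p.x j := fun j =>
    grassmannCont_coordFun (D.body_im_of_real (p.x_real j))
  have h := grassmannCont_comp (x := p.x) p.x_mem hW hp (Y := fun i v => v i) (Z := fun i v => v i)
    (fun i => (contDiff_apply ℝ ℝ i).contDiffOn) (fun i => (contDiff_apply ℝ ℝ i).contDiffOn)
    p.u_even p.u_sq hW hp hg.complex_ofReal
  simp only [hc] at h
  refine h.trans ?_
  congr 2
  refine grassmannCont_congr hW (fun v hv => ?_) hp
  have hd : DifferentiableAt ℝ g v := (hg.contDiffAt (hW.mem_nhds hv)).differentiableAt (by simp)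
  rw [Complex.ofReal_sum]
  refine Finset.sum_congr rfl fun j _ => ?_
  rw [Complex.ofReal_mul]
  congr 1
  have h2 := (Complex.ofRealCLM.hasFDerivAt.comp v hd.hasFDerivAt).fderiv
  exact DFunLike.congr_fun h2 (Pi.single j 1)

namespace SuperSphere

variable {L L' : ℕ} {D : GradedInvolution L}

/-- The first parameter of the point over `p` in the chart given by the functions `Y_i`. -/
noncomputable def chartA (Y : Fin 4 → (Fin 3 → ℝ) → ℝ) (p : SuperSphere D) : Gr L :=
  grassmannCont (fun v => (Y 0 v : ℂ)) p.y + Complex.I • grassmannCont (fun v => (Y 1 v : ℂ)) p.y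

/-- The second parameter of the point over `p` in the chart given by the functions `Y_i`. -/
noncomputable def chartB (Y : Fin 4 → (Fin 3 → ℝ) → ℝ) (p : SuperSphere D) : Gr L :=
  grassmannCont (fun v => (Y 2 v : ℂ)) p.y + Complex.I • grassmannCont (fun v => (Y 3 v : ℂ)) p.y

/-- The equations under which the real functions `Y_0, …, Y_3` of the rescaled even coordinates are
the real and imaginary parts of parameters `a`, `b` of a point over `p`. -/
def IsChartAt (Y : Fin 4 → (Fin 3 → ℝ) → ℝ) (p : SuperSphere D) : Prop :=
  chartA Y p * D (chartA Y p) = (1 / 2 : ℂ) • (1 + p.y 0) ∧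
  chartB Y p * D (chartB Y p) = (1 / 2 : ℂ) • (1 - p.y 0) ∧
  chartA Y p * D (chartB Y p) = (1 / 2 : ℂ) • (p.y 1 + Complex.I • p.y 2)

variable {Y : Fin 4 → (Fin 3 → ℝ) → ℝ}

theorem chartA_even (p : SuperSphere D) : chartA Y p ∈ Gr.part L 0 :=
  add_mem (grassmannCont_even _ p.y_even _)
    (Submodule.smul_mem _ _ (grassmannCont_even _ p.y_even _))

theorem chartB_even (p : SuperSphere D) : chartB Y p ∈ Gr.part L 0 :=
  add_mem (grassmannCont_even _ p.y_even _)
    (Submodule.smul_mem _ _ (grassmannCont_even _ p.y_even _))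

theorem map_chartA (p : SuperSphere D) : D (chartA Y p) =
    grassmannCont (fun v => (Y 0 v : ℂ)) p.y -
      Complex.I • grassmannCont (fun v => (Y 1 v : ℂ)) p.y := by
  rw [chartA, D.map_add, D.map_smul, D.map_grassmannCont_ofReal p.y_real,
    D.map_grassmannCont_ofReal p.y_real, Complex.conj_I, neg_smul, ← sub_eq_add_neg]

theorem map_chartB (p : SuperSphere D) : D (chartB Y p) =
    grassmannCont (fun v => (Y 2 v : ℂ)) p.y -
      Complex.I • grassmannCont (fun v => (Y 3 v : ℂ)) p.y := by
  rw [chartB, D.map_add, D.map_smul, D.map_grassmannCont_ofReal p.y_real,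
    D.map_grassmannCont_ofReal p.y_real, Complex.conj_I, neg_smul, ← sub_eq_add_neg]

theorem IsChartAt.exists_hopf_eq {p : SuperSphere D} (h : IsChartAt Y p) :
    ∃ s : UOSP D, hopf s = p ∧ s.a = chartA Y p ∧ s.b = chartB Y p ∧
      s.η = p.oddParam (chartA Y p) (chartB Y p) :=
  p.exists_hopf_eq (chartA_even p) (chartB_even p) h.1 h.2.1 h.2.2

/-- A function on the supersphere is of class `GH^∞` over the domain `W` of a chart as soon as its
pullback is: it is the pullback of `f ∘ hopf` along the section. -/
theorem isGH_restrict_of_comp_hopf {W : Set (Fin 3 → ℝ)} (hW : IsOpen W)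
    (hY : ∀ i, ContDiffOn ℝ ∞ (Y i) W)
    (hc : ∀ p : SuperSphere D, realBody p.x ∈ W → IsChartAt Y p) {f : SuperSphere D → Gr L}
    (hf : IsGH (UOSP.coords D) L' (f ∘ hopf)) :
    IsGH ((SuperSphere.coords D).restrict W) L' (fun p => f p) := by
  have hch := fun p : {p : SuperSphere D // realBody ((SuperSphere.coords D).x p) ∈ W} =>
    (hc p p.2).exists_hopf_eq
  choose φ hφ ha hb hη using hch
  set c := (SuperSphere.coords D).restrict W with hcdef
  have hZ : ∀ i, ContDiffOn ℝ ∞ (fun v => ∑ j, v j * fderiv ℝ (Y i) v (Pi.single j 1)) W :=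
    fun i => ContDiffOn.sum fun j _ => (contDiff_apply ℝ ℝ j).contDiffOn.mul
      (((hY i).fderiv_of_isOpen hW (by simp)).clm_apply contDiffOn_const)
  have hx : ∀ p i, (UOSP.coords D).x (φ p) i =
      grassmannCont (fun v => (Y i v : ℂ)) (c.x p) + c.ξ p 0 * c.ξ p 1 * grassmannCont
        (fun v => ((∑ j, v j * fderiv ℝ (Y i) v (Pi.single j 1) : ℝ) : ℂ)) (c.x p) := by
    intro p i
    refine Eq.trans ?_ (p.1.grassmannCont_y hW p.2 (hY i))
    have r : ∀ z z' : Gr L, (1 / 2 : ℂ) • (z + Complex.I • z' + (z - Complex.I • z')) = z :=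
      fun z z' => by rw [add_add_sub_cancel, ← two_smul ℂ, smul_smul]; norm_num
    have r' : ∀ z z' : Gr L,
        (-Complex.I / 2) • (z + Complex.I • z' - (z - Complex.I • z')) = z' := fun z z' => by
      rw [add_sub_sub_cancel, ← two_smul ℂ, smul_smul, smul_smul,
        show -Complex.I / 2 * 2 * Complex.I = 1 by linear_combination -Complex.I_sq, one_smul]
    fin_cases i
    · change (1 / 2 : ℂ) • ((φ p).a + D (φ p).a) = _
      rw [ha, map_chartA, chartA, r]
      rfl
    · change (-Complex.I / 2) • ((φ p).a - D (φ p).a) = _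
      rw [ha, map_chartA, chartA, r']
      rfl
    · change (1 / 2 : ℂ) • ((φ p).b + D (φ p).b) = _
      rw [hb, map_chartB, chartB, r]
      rfl
    · change (-Complex.I / 2) • ((φ p).b - D (φ p).b) = _
      rw [hb, map_chartB, chartB, r']
      rfl
  have hP : ∀ i, IsGH c L' (fun p => grassmannCont (fun v => (Y i v : ℂ)) p.1.y) := fun i => by
    have e : (fun p : {p : SuperSphere D // realBody ((SuperSphere.coords D).x p) ∈ W} =>
        grassmannCont (fun v => (Y i v : ℂ)) p.1.y) = fun p =>
        grassmannCont (fun v => (Y i v : ℂ)) (c.x p) + c.ξ p 0 * c.ξ p 1 * grassmannCont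
        (fun v => ((∑ j, v j * fderiv ℝ (Y i) v (Pi.single j 1) : ℝ) : ℂ)) (c.x p) :=
      funext fun p => p.1.grassmannCont_y hW p.2 (hY i)
    rw [e]
    exact (isGH_grassmannCont hW (fun p => p.2) (hY i).complex_ofReal
      ).add (((isGH_ξ (c := c) 0).mul (isGH_ξ (c := c) 1)).mul (isGH_grassmannCont hW (fun p => p.2)
        (hZ i).complex_ofReal))
  have hξ : ∀ j, IsGH c L' (fun p => (UOSP.coords D).ξ (φ p) j) := by
    intro j
    have h0 := isGH_ξ (c := c) (L' := L') 0
    have h1 := isGH_ξ (c := c) (L' := L') 1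
    fin_cases j
    · have e : (fun p => (UOSP.coords D).ξ (φ p) 0) =
          fun p => p.1.oddParam (chartA Y p.1) (chartB Y p.1) := funext hη
      change IsGH c L' (fun p => (UOSP.coords D).ξ (φ p) 0)
      rw [e]
      exact ((((hP 0).add ((hP 1).smul _)).mul h1).sub
        (((hP 2).add ((hP 3).smul _)).mul h0)).smul 2
    · have e : (fun p => (UOSP.coords D).ξ (φ p) 1) =
          fun p => -((2 : ℂ) • (D (chartA Y p.1) * p.1.ξ 0 + D (chartB Y p.1) * p.1.ξ 1)) :=
        funext fun p => by
          rw [← map_oddParam, ← hη]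
          rfl
      change IsGH c L' (fun p => (UOSP.coords D).ξ (φ p) 1)
      rw [e]
      simp only [map_chartA, map_chartB]
      exact (((((hP 0).sub ((hP 1).smul _)).mul h0).add
        (((hP 2).sub ((hP 3).smul _)).mul h1)).smul 2).neg
  have main := IsGH.comp (c := c) (c' := UOSP.coords D) hW (fun p => p.2) hY hZ hx hξ hf
  simpa only [Function.comp_apply, hφ] using main

/-- The domain `1 + ε v_1 > 0` of a chart, for `ε = ± 1`. -/
def chartDomain (ε : ℝ) : Set (Fin 3 → ℝ) := {v | 0 < 1 + ε * v 0}

theorem isOpen_chartDomain (ε : ℝ) : IsOpen (chartDomain ε) :=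
  isOpen_lt continuous_const (by fun_prop)

/-- The function `√((1 + ε v_1) / 2)`. -/
noncomputable def chartRoot (ε : ℝ) (v : Fin 3 → ℝ) : ℝ := Real.sqrt ((1 + ε * v 0) / 2)

/-- The function `1 / (2 √((1 + ε v_1) / 2))`. -/
noncomputable def chartInv (ε : ℝ) (v : Fin 3 → ℝ) : ℝ := (2 * chartRoot ε v)⁻¹

theorem chartRoot_pos {ε : ℝ} {v : Fin 3 → ℝ} (hv : v ∈ chartDomain ε) : 0 < chartRoot ε v :=
  Real.sqrt_pos.mpr (half_pos hv)

theorem contDiffOn_chartRoot (ε : ℝ) : ContDiffOn ℝ ∞ (chartRoot ε) (chartDomain ε) := by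
  refine ContDiffOn.sqrt ?_ fun v hv => (half_pos (show 0 < 1 + ε * v 0 from hv)).ne'
  exact ContDiff.contDiffOn (by fun_prop)

theorem contDiffOn_chartInv (ε : ℝ) : ContDiffOn ℝ ∞ (chartInv ε) (chartDomain ε) :=
  (contDiffOn_const.mul (contDiffOn_chartRoot ε)).inv fun v hv => by
    have := chartRoot_pos hv
    positivity

/-- The chart with `a` real, over the points where the body of `x_1` is greater than `-1`. -/
noncomputable def chartPos : Fin 4 → (Fin 3 → ℝ) → ℝ :=
  ![chartRoot 1, fun _ => 0, fun v => v 1 * chartInv 1 v, fun v => -(v 2 * chartInv 1 v)]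

/-- The chart with `b` real, over the points where the body of `x_1` is less than `1`. -/
noncomputable def chartNeg : Fin 4 → (Fin 3 → ℝ) → ℝ :=
  ![fun v => v 1 * chartInv (-1) v, fun v => v 2 * chartInv (-1) v, chartRoot (-1), fun _ => 0]

theorem contDiffOn_chartPos (i : Fin 4) : ContDiffOn ℝ ∞ (chartPos i) (chartDomain 1) := by
  fin_cases i
  · exact contDiffOn_chartRoot 1
  · exact contDiffOn_const
  · exact (contDiff_apply ℝ ℝ 1).contDiffOn.mul (contDiffOn_chartInv 1)
  · exact ((contDiff_apply ℝ ℝ 2).contDiffOn.mul (contDiffOn_chartInv 1)).neg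

theorem contDiffOn_chartNeg (i : Fin 4) : ContDiffOn ℝ ∞ (chartNeg i) (chartDomain (-1)) := by
  fin_cases i
  · exact (contDiff_apply ℝ ℝ 1).contDiffOn.mul (contDiffOn_chartInv (-1))
  · exact (contDiff_apply ℝ ℝ 2).contDiffOn.mul (contDiffOn_chartInv (-1))
  · exact contDiffOn_chartRoot (-1)
  · exact contDiffOn_const

section Root

variable {ε : ℝ} {p : SuperSphere D}

theorem grassmannCont_coord_y (p : SuperSphere D) (j : Fin 3) :
    grassmannCont (fun v => (v j : ℂ)) p.y = p.y j :=
  grassmannCont_coordFun (D.body_im_of_real (p.y_real j))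

theorem grassmannCont_chartRoot_sq (hp : realBody p.x ∈ chartDomain ε) :
    grassmannCont (fun v => (chartRoot ε v : ℂ)) p.y *
      grassmannCont (fun v => (chartRoot ε v : ℂ)) p.y =
        (1 / 2 : ℂ) • (1 + (ε : ℂ) • p.y 0) := by
  have hp' : realBody p.y ∈ chartDomain ε := p.realBody_y ▸ hp
  have hs := (contDiffOn_chartRoot ε).complex_ofReal
  have hk : ∀ k : ℂ, ContDiffOn ℝ ∞ (fun _ : Fin 3 → ℝ => k) Set.univ := fun _ => contDiffOn_const
  have h0 := (contDiff_coordFun (0 : Fin 3)).contDiffOn (s := Set.univ)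
  have e1 : grassmannCont ((fun _ => ((ε / 2 : ℝ) : ℂ)) * coordFun 0 + fun _ => (1 / 2 : ℂ)) p.y =
      (1 / 2 : ℂ) • (1 + (ε : ℂ) • p.y 0) := by
    have hm : ContDiffOn ℝ ∞ ((fun _ => ((ε / 2 : ℝ) : ℂ)) * coordFun (0 : Fin 3)) Set.univ :=
      (hk _).mul h0
    rw [grassmannCont_add isOpen_univ hm (hk _) trivial,
      grassmannCont_mul p.y_even isOpen_univ (hk _) h0 trivial, grassmannCont_const,
      grassmannCont_const, show grassmannCont (coordFun 0) p.y = p.y 0 from grassmannCont_coord_y p 0,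
      ← Algebra.smul_def, Algebra.algebraMap_eq_smul_one, smul_add, smul_smul, add_comm]
    congr 2
    push_cast
    ring
  rw [← e1, ← grassmannCont_mul p.y_even (isOpen_chartDomain ε) hs hs hp']
  refine grassmannCont_congr (isOpen_chartDomain ε) (fun v hv => ?_) hp'
  have : chartRoot ε v * chartRoot ε v = ε / 2 * v 0 + 1 / 2 := by
    rw [chartRoot, Real.mul_self_sqrt (half_pos (show 0 < 1 + ε * v 0 from hv)).le]; ring
  simp only [Pi.mul_apply, Pi.add_apply, coordFun]
  rw [← Complex.ofReal_mul, this]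
  push_cast
  ring

theorem grassmannCont_chartRoot_mul_chartInv (hp : realBody p.x ∈ chartDomain ε) :
    grassmannCont (fun v => (chartRoot ε v : ℂ)) p.y *
      grassmannCont (fun v => (chartInv ε v : ℂ)) p.y = (1 / 2 : ℂ) • 1 := by
  have hp' : realBody p.y ∈ chartDomain ε := p.realBody_y ▸ hp
  rw [← Algebra.algebraMap_eq_smul_one, ← grassmannCont_const p.y, ← grassmannCont_mul p.y_even
    (isOpen_chartDomain ε) (contDiffOn_chartRoot ε).complex_ofReal
    (contDiffOn_chartInv ε).complex_ofReal hp']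
  refine grassmannCont_congr (isOpen_chartDomain ε) (fun v hv => ?_) hp'
  have h := (chartRoot_pos hv).ne'
  have : chartRoot ε v * chartInv ε v = 1 / 2 := by
    rw [chartInv]; field_simp
  simp only [Pi.mul_apply]
  rw [← Complex.ofReal_mul, this]
  push_cast
  rfl

theorem grassmannCont_coord_mul_chartInv (hp : realBody p.x ∈ chartDomain ε) (j : Fin 3) :
    grassmannCont (fun v => ((v j * chartInv ε v : ℝ) : ℂ)) p.y =
      p.y j * grassmannCont (fun v => (chartInv ε v : ℂ)) p.y := by
  have hp' : realBody p.y ∈ chartDomain ε := p.realBody_y ▸ hp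
  rw [← grassmannCont_coord_y p j, ← grassmannCont_mul p.y_even (isOpen_chartDomain ε)
    (contDiff_apply ℝ ℝ j).contDiffOn.complex_ofReal
    (contDiffOn_chartInv ε).complex_ofReal hp']
  congr 1
  funext v
  simp

theorem grassmannCont_neg {V : Set (Fin 3 → ℝ)} (hV : IsOpen V) {g : (Fin 3 → ℝ) → ℂ}
    (hg : ContDiffOn ℝ ∞ g V) (hp : realBody p.y ∈ V) :
    grassmannCont (fun v => -g v) p.y = -grassmannCont g p.y := by
  rw [eq_neg_iff_add_eq_zero, ← grassmannCont_add hV hg.neg hg hp, ← map_zero (algebraMap ℂ _),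
    ← grassmannCont_const p.y]
  congr 1
  funext v
  simp

end Root

/-- The algebra behind both charts: with `q = √((1 + x) / 2)`, `c = 1 / (2 q)` and
`x² + y² + z² = 1`, the element `b = (y - i z) c` satisfies `b b^◇ = (1 - x) / 2` and
`q b^◇ = (y + i z) / 2`. -/
theorem chart_identities {R : Type} [CommRing R] [Algebra ℂ R] {q c x y z : R}
    (hq : q * q = (1 / 2 : ℂ) • (1 + x)) (hqc : q * c = (1 / 2 : ℂ) • 1)
    (h : x * x + y * y + z * z = 1) :
    (y * c + Complex.I • (z * c)) * (y * c - Complex.I • (z * c)) = (1 / 2 : ℂ) • (1 - x) ∧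
    q * (y * c + Complex.I • (z * c)) = (1 / 2 : ℂ) • (y + Complex.I • z) := by
  have hI : (algebraMap ℂ R Complex.I) ^ 2 = -1 := by
    rw [← map_pow, Complex.I_sq, map_neg, map_one]
  have h2 : (2 : R) * algebraMap ℂ R (1 / 2) = 1 := by
    rw [← map_ofNat (algebraMap ℂ R) 2, ← map_mul]; norm_num
  simp only [Algebra.smul_def, mul_one] at *
  generalize algebraMap ℂ R Complex.I = i at *
  generalize algebraMap ℂ R (1 / 2) = k at *
  constructor
  · -- `4 q² c² = 1` and `y² + z² = (1 + x) (1 - x)`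
    have h3 : (1 + x) * (c * c) = k := by
      have : k * ((1 + x) * (c * c)) = k * k := by
        linear_combination (-(c * c)) * hq + (q * c + k) * hqc
      calc (1 + x) * (c * c) = 2 * (k * ((1 + x) * (c * c))) := by
            linear_combination (-((1 + x) * (c * c))) * h2
        _ = k := by rw [this]; linear_combination k * h2
    linear_combination (c * c) * h + (1 - x) * h3 - (z * c) ^ 2 * hI
  · linear_combination (y + i * z) * hqc

/-- `chart_identities` for even, hence central, elements of the Grassmann algebra. -/
theorem chart_identities' {q c x y z : Gr L} (hqe : q ∈ Gr.part L 0) (hce : c ∈ Gr.part L 0)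
    (hxe : x ∈ Gr.part L 0) (hye : y ∈ Gr.part L 0) (hze : z ∈ Gr.part L 0)
    (hq : q * q = (1 / 2 : ℂ) • (1 + x)) (hqc : q * c = (1 / 2 : ℂ) • 1)
    (h : x * x + y * y + z * z = 1) :
    (y * c + Complex.I • (z * c)) * (y * c - Complex.I • (z * c)) = (1 / 2 : ℂ) • (1 - x) ∧
    q * (y * c + Complex.I • (z * c)) = (1 / 2 : ℂ) • (y + Complex.I • z) := by
  have := chart_identities (R := Subalgebra.center ℂ (Gr L)) (q := ⟨q, Gr.even_mem_center hqe⟩)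
    (c := ⟨c, Gr.even_mem_center hce⟩) (x := ⟨x, Gr.even_mem_center hxe⟩)
    (y := ⟨y, Gr.even_mem_center hye⟩) (z := ⟨z, Gr.even_mem_center hze⟩) (Subtype.ext hq)
    (Subtype.ext hqc) (Subtype.ext h)
  exact ⟨congrArg Subtype.val this.1, congrArg Subtype.val this.2⟩

theorem isChartAt_chartPos {p : SuperSphere D} (hp : realBody p.x ∈ chartDomain 1) :
    IsChartAt chartPos p := by
  have hq := grassmannCont_chartRoot_sq hp
  have hqc := grassmannCont_chartRoot_mul_chartInv hp
  set q := grassmannCont (fun v => (chartRoot 1 v : ℂ)) p.y with hqd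
  set c := grassmannCont (fun v => (chartInv 1 v : ℂ)) p.y with hcd
  have hqe : q ∈ Gr.part L 0 := grassmannCont_even _ p.y_even _
  have hce : c ∈ Gr.part L 0 := grassmannCont_even _ p.y_even _
  have hA : chartA chartPos p = q := by
    change q + Complex.I • grassmannCont (fun v => ((0 : ℝ) : ℂ)) p.y = q
    rw [grassmannCont_const]
    simp
  have hDA : D q = q := D.map_grassmannCont_ofReal p.y_real _
  have h2 : grassmannCont (fun v => (chartPos 2 v : ℂ)) p.y = p.y 1 * c :=
    grassmannCont_coord_mul_chartInv hp 1
  have h3 : grassmannCont (fun v => (chartPos 3 v : ℂ)) p.y = -(p.y 2 * c) := by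
    rw [← grassmannCont_coord_mul_chartInv hp 2, ← grassmannCont_neg (isOpen_chartDomain 1)
      ((contDiff_apply ℝ ℝ 2).contDiffOn.mul (contDiffOn_chartInv 1)).complex_ofReal (p.realBody_y ▸ hp)]
    congr 1
    funext v
    exact Complex.ofReal_neg _
  have hB : chartB chartPos p = p.y 1 * c - Complex.I • (p.y 2 * c) := by
    rw [chartB, h2, h3, smul_neg, ← sub_eq_add_neg]
  have hDB : D (chartB chartPos p) = p.y 1 * c + Complex.I • (p.y 2 * c) := by
    rw [map_chartB, h2, h3, smul_neg, sub_neg_eq_add]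
  rw [Complex.ofReal_one, one_smul] at hq
  have key := chart_identities' hqe hce (p.y_even 0) (p.y_even 1) (p.y_even 2) hq hqc p.sum_y_sq
  refine ⟨by rw [hA, hDA, hq], ?_, by rw [hA, hDB, key.2]⟩
  rw [hDB, ← Gr.even_comm (hDB ▸ D.map_mem 0 _ (chartB_even p)), hB, key.1]

theorem isChartAt_chartNeg {p : SuperSphere D} (hp : realBody p.x ∈ chartDomain (-1)) :
    IsChartAt chartNeg p := by
  have hq := grassmannCont_chartRoot_sq hp
  have hqc := grassmannCont_chartRoot_mul_chartInv hp
  set q := grassmannCont (fun v => (chartRoot (-1) v : ℂ)) p.y with hqd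
  set c := grassmannCont (fun v => (chartInv (-1) v : ℂ)) p.y with hcd
  have hqe : q ∈ Gr.part L 0 := grassmannCont_even _ p.y_even _
  have hce : c ∈ Gr.part L 0 := grassmannCont_even _ p.y_even _
  have hB : chartB chartNeg p = q := by
    change q + Complex.I • grassmannCont (fun v => ((0 : ℝ) : ℂ)) p.y = q
    rw [grassmannCont_const]
    simp
  have hDB : D q = q := D.map_grassmannCont_ofReal p.y_real _
  have h2 : grassmannCont (fun v => (chartNeg 0 v : ℂ)) p.y = p.y 1 * c :=
    grassmannCont_coord_mul_chartInv hp 1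
  have h3 : grassmannCont (fun v => (chartNeg 1 v : ℂ)) p.y = p.y 2 * c :=
    grassmannCont_coord_mul_chartInv hp 2
  have hA : chartA chartNeg p = p.y 1 * c + Complex.I • (p.y 2 * c) := by rw [chartA, h2, h3]
  have hDA : D (chartA chartNeg p) = p.y 1 * c - Complex.I • (p.y 2 * c) := by
    rw [map_chartA, h2, h3]
  rw [Complex.ofReal_neg, Complex.ofReal_one, neg_one_smul] at hq
  have hn : -p.y 0 * -p.y 0 + p.y 1 * p.y 1 + p.y 2 * p.y 2 = 1 := by rw [neg_mul_neg, p.sum_y_sq]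
  have key := chart_identities' hqe hce (neg_mem (p.y_even 0)) (p.y_even 1) (p.y_even 2) hq hqc hn
  refine ⟨?_, by rw [hB, hDB, hq, sub_eq_add_neg], ?_⟩
  · rw [hDA, hA, key.1, sub_neg_eq_add]
  · rw [hB, hDB, hA, ← Gr.even_comm hqe, key.2]

theorem mem_chartDomain (p : SuperSphere D) :
    realBody p.x ∈ chartDomain 1 ∨ realBody p.x ∈ chartDomain (-1) := by
  simp only [chartDomain, Set.mem_ofPred_eq]
  by_contra! h
  linarith [h.1, h.2]

end SuperSphere

open SuperSphere in
theorem hopf_surjective {L : ℕ} {D : GradedInvolution L} : Function.Surjective (hopf (D := D)) := by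
  intro p
  rcases p.mem_chartDomain with h | h
  · obtain ⟨s, hs, -⟩ := (isChartAt_chartPos h).exists_hopf_eq
    exact ⟨s, hs⟩
  · obtain ⟨s, hs, -⟩ := (isChartAt_chartNeg h).exists_hopf_eq
    exact ⟨s, hs⟩

open SuperSphere in
theorem isGH_of_comp_hopf {L L' : ℕ} {D : GradedInvolution L} {f : SuperSphere D → Gr L}
    (hf : IsGH (UOSP.coords D) L' (f ∘ hopf)) : IsGH (SuperSphere.coords D) L' f := by
  refine isGH_of_restrict fun p => ?_
  rcases p.mem_chartDomain with h | h
  · exact ⟨_, isOpen_chartDomain 1, h, isGH_restrict_of_comp_hopf (isOpen_chartDomain 1)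
      contDiffOn_chartPos (fun p hp => isChartAt_chartPos hp) hf⟩
  · exact ⟨_, isOpen_chartDomain (-1), h, isGH_restrict_of_comp_hopf (isOpen_chartDomain (-1))
      contDiffOn_chartNeg (fun p hp => isChartAt_chartNeg hp) hf⟩

/-! ### Pullback of `GH^∞` functions to `UOSP(1,2)` -/

/-- The three even coordinates of the projection as polynomials in the real and imaginary parts of
`a` and `b`, apart from the nilpotent factor. -/
def hopfPoly {R : Type*} [CommRing R] (x : Fin 4 → R) : Fin 3 → R :=
  ![x 0 * x 0 + x 1 * x 1 - (x 2 * x 2 + x 3 * x 3),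
    (x 0 * x 2 + x 1 * x 3) + (x 0 * x 2 + x 1 * x 3),
    (x 1 * x 2 - x 0 * x 3) + (x 1 * x 2 - x 0 * x 3)]

theorem hopfPoly_eq {R : Type} [CommRing R] [Algebra ℂ R] (x : Fin 4 → R) :
    (x 0 + Complex.I • x 1) * (x 0 - Complex.I • x 1) -
      (x 2 + Complex.I • x 3) * (x 2 - Complex.I • x 3) = hopfPoly x 0 ∧
    (x 0 + Complex.I • x 1) * (x 2 - Complex.I • x 3) +
      (x 2 + Complex.I • x 3) * (x 0 - Complex.I • x 1) = hopfPoly x 1 ∧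
    (-Complex.I) • ((x 0 + Complex.I • x 1) * (x 2 - Complex.I • x 3) -
      (x 2 + Complex.I • x 3) * (x 0 - Complex.I • x 1)) = hopfPoly x 2 := by
  have hI : (algebraMap ℂ R Complex.I) * (algebraMap ℂ R Complex.I) = -1 := by
    rw [← map_mul, Complex.I_mul_I, map_neg, map_one]
  simp only [Algebra.smul_def, map_neg, hopfPoly, Matrix.cons_val]
  generalize algebraMap ℂ R Complex.I = i at *
  refine ⟨?_, ?_, ?_⟩
  · linear_combination (x 3 * x 3 - x 1 * x 1) * hI
  · linear_combination (-2 * x 1 * x 3) * hI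
  · linear_combination (2 * (x 0 * x 3 - x 1 * x 2)) * hI

namespace UOSP

variable {L L' : ℕ} {D : GradedInvolution L}

theorem contDiff_hopfPoly (i : Fin 3) :
    ContDiff ℝ ∞ (fun v : Fin 4 → ℝ => hopfPoly v i) := by
  fin_cases i <;> simp only [hopfPoly] <;> dsimp <;> fun_prop

theorem grassmannCont_hopfPoly (s : UOSP D) (i : Fin 3) :
    grassmannCont (fun v => ((hopfPoly v i : ℝ) : ℂ)) ((UOSP.coords D).x s) = (hopf s).y i := by
  set x := (UOSP.coords D).x s with hx
  have hxe : ∀ j, x j ∈ Gr.part L 0 := (UOSP.coords D).x_mem s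
  have hco : ∀ j, contHom x hxe ⟨coordFun j, mem_smoothFun.mpr (contDiff_coordFun j)⟩ = x j :=
    fun j => grassmannCont_coordFun (D.body_im_of_real (s.coords_real j))
  let X : Fin 4 → smoothFun 4 := fun j => ⟨coordFun j, mem_smoothFun.mpr (contDiff_coordFun j)⟩
  have e : grassmannCont (fun v => ((hopfPoly v i : ℝ) : ℂ)) x = contHom x hxe (hopfPoly X i) := by
    change _ = grassmannCont (hopfPoly X i).1 x
    congr 1
    funext v
    fin_cases i
    · exact (by push_cast; rfl : (((v 0 * v 0 + v 1 * v 1 - (v 2 * v 2 + v 3 * v 3) : ℝ)) : ℂ) =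
        v 0 * v 0 + v 1 * v 1 - (v 2 * v 2 + v 3 * v 3))
    · exact (by push_cast; rfl : ((((v 0 * v 2 + v 1 * v 3) + (v 0 * v 2 + v 1 * v 3) : ℝ)) : ℂ) =
        (v 0 * v 2 + v 1 * v 3) + (v 0 * v 2 + v 1 * v 3))
    · exact (by push_cast; rfl : ((((v 1 * v 2 - v 0 * v 3) + (v 1 * v 2 - v 0 * v 3) : ℝ)) : ℂ) =
        (v 1 * v 2 - v 0 * v 3) + (v 1 * v 2 - v 0 * v 3))
  let x' : Fin 4 → Subalgebra.center ℂ (Gr L) := fun j => ⟨x j, Gr.even_mem_center (hxe j)⟩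
  have e2 : contHom x hxe (hopfPoly X i) = (hopfPoly x' i).1 := by
    fin_cases i
    · change contHom x hxe (X 0 * X 0 + X 1 * X 1 - (X 2 * X 2 + X 3 * X 3)) = _
      simp only [map_add, map_sub, map_mul, X, hco]
      rfl
    · change contHom x hxe ((X 0 * X 2 + X 1 * X 3) + (X 0 * X 2 + X 1 * X 3)) = _
      simp only [map_add, map_mul, X, hco]
      rfl
    · change contHom x hxe ((X 1 * X 2 - X 0 * X 3) + (X 1 * X 2 - X 0 * X 3)) = _
      simp only [map_add, map_sub, map_mul, X, hco]
      rfl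
  have key := hopfPoly_eq x'
  rw [e, e2]
  fin_cases i
  · change (hopfPoly x' 0).1 = (hopf s).y 0
    rw [hopf_y0, map_a_eq, map_b_eq, s.a_eq, s.b_eq, ← key.1]
    rfl
  · change (hopfPoly x' 1).1 = (hopf s).y 1
    rw [hopf_y1, map_a_eq, map_b_eq, s.a_eq, s.b_eq, ← key.2.1]
    rfl
  · change (hopfPoly x' 2).1 = (hopf s).y 2
    rw [hopf_y2, map_a_eq, map_b_eq, s.a_eq, s.b_eq, ← key.2.2]
    rfl

theorem isGH_comp_hopf {f : SuperSphere D → Gr L} (hf : IsGH (SuperSphere.coords D) L' f) :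
    IsGH (UOSP.coords D) L' (f ∘ hopf) := by
  have hZ : ∀ i, ContDiff ℝ ∞ (fun v : Fin 4 → ℝ => -(1 / 4) * hopfPoly v i) := fun i =>
    contDiff_const.mul (contDiff_hopfPoly i)
  refine IsGH.comp (c := UOSP.coords D) (c' := SuperSphere.coords D) isOpen_univ
    (fun _ => trivial) (Y := fun i v => hopfPoly v i) (Z := fun i v => -(1 / 4) * hopfPoly v i)
    (fun i => (contDiff_hopfPoly i).contDiffOn) (fun i => (hZ i).contDiffOn) (fun s i => ?_)
    (fun j => ?_) hf
  · have e : grassmannCont (fun v => ((-(1 / 4) * hopfPoly v i : ℝ) : ℂ)) ((UOSP.coords D).x s) =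
        -(1 / 4 : ℂ) • (hopf s).y i := by
      rw [← s.grassmannCont_hopfPoly i, Algebra.smul_def, ← grassmannCont_const,
        ← grassmannCont_mul ((UOSP.coords D).x_mem s) isOpen_univ contDiffOn_const
          (contDiff_hopfPoly i).contDiffOn.complex_ofReal trivial]
      congr 1
      funext v
      simp
    rw [e, s.grassmannCont_hopfPoly i]
    change (hopf s).x i = (hopf s).y i + s.η * D s.η * (-(1 / 4 : ℂ) • (hopf s).y i)
    rw [← (hopf s).x_eq i, mul_smul_comm, mul_sub, mul_one, ← Gr.even_comm (hopf s).u_even, hopf_u,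
      smul_mul_assoc, neg_smul, ← sub_eq_add_neg]
  · have hη := isGH_η (D := D) (L' := L')
    have hη' := isGH_map_η (D := D) (L' := L')
    fin_cases j
    · exact ((isGH_a.mul hη').add (hη.mul isGH_map_b)).smul (-(1 / 2))
    · exact ((hη.mul isGH_map_a).sub (isGH_b.mul hη')).smul (1 / 2)

end UOSP

/-! ### Supermodules and even idempotents -/

theorem isInternal_zmod_two_iff {M : Type*} [AddCommGroup M] (ℳ : ZMod 2 → AddSubgroup M) :
    DirectSum.IsInternal ℳ ↔ (∀ x, x ∈ ℳ 0 → x ∈ ℳ 1 → x = 0) ∧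
      ∀ x, ∃ y ∈ ℳ 0, ∃ z ∈ ℳ 1, y + z = x := by
  have h01 : ∀ i : ZMod 2, i = 0 ∨ i = 1 := by decide
  have hsum : ∀ f : DirectSum (ZMod 2) fun i => ℳ i,
      DirectSum.coeAddMonoidHom ℳ f = (f 0 : M) + f 1 := fun f => by
    have : f = DirectSum.of (fun i => ℳ i) 0 (f 0) + DirectSum.of (fun i => ℳ i) 1 (f 1) := by
      ext i
      rw [DirectSum.add_apply]
      obtain rfl | rfl := h01 i
      · rw [DirectSum.of_eq_same, DirectSum.of_eq_of_ne _ _ _ (by decide), add_zero]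
      · rw [DirectSum.of_eq_same, DirectSum.of_eq_of_ne _ _ _ (by decide), zero_add]
    conv_lhs => rw [this]
    rw [map_add, DirectSum.coeAddMonoidHom_of, DirectSum.coeAddMonoidHom_of]
  constructor
  · intro h
    refine ⟨fun x h0 h1 => ?_, fun x => ?_⟩
    · have e : DirectSum.of (fun i => ℳ i) 0 ⟨x, h0⟩ = DirectSum.of (fun i => ℳ i) 1 ⟨x, h1⟩ :=
        h.1 (by rw [DirectSum.coeAddMonoidHom_of, DirectSum.coeAddMonoidHom_of])
      have e2 := congrArg (fun f : DirectSum (ZMod 2) fun i => ℳ i => (f 0 : M)) e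
      simp only [DirectSum.of_eq_same] at e2
      rw [DirectSum.of_eq_of_ne _ _ _ (by decide)] at e2
      simpa using e2
    · obtain ⟨f, rfl⟩ := h.2 x
      exact ⟨f 0, (f 0).2, f 1, (f 1).2, (hsum f).symm⟩
  · rintro ⟨h0, h1⟩
    refine ⟨(injective_iff_map_eq_zero _).mpr fun f hf => ?_, fun x => ?_⟩
    · rw [hsum] at hf
      have e : (f 0 : M) = -f 1 := eq_neg_of_add_eq_zero_left hf
      have z0 : (f 0 : M) = 0 := h0 _ (f 0).2 (e ▸ neg_mem (f 1).2)
      have z1 : (f 1 : M) = 0 := by rw [z0, zero_add] at hf; exact hf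
      ext i
      fin_cases i
      exacts [z0, z1]
    · obtain ⟨y, hy, z, hz, rfl⟩ := h1 x
      refine ⟨DirectSum.of (fun i => ℳ i) 0 ⟨y, hy⟩ + DirectSum.of (fun i => ℳ i) 1 ⟨z, hz⟩, ?_⟩
      rw [map_add, DirectSum.coeAddMonoidHom_of, DirectSum.coeAddMonoidHom_of]

section Columns

variable {R : Type*} [Ring R] {𝒜 : ZMod 2 → AddSubgroup R} {I J : Type*}

/-- The degree of a basis vector of the free supermodule of columns. -/
def basisDegree : I ⊕ J → ZMod 2 := Sum.elim (fun _ => 0) fun _ => 1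

theorem mem_columnGrading {i : ZMod 2} {v : I ⊕ J → R} :
    v ∈ columnGrading 𝒜 I J i ↔ ∀ k, v k ∈ 𝒜 (i + basisDegree k) := by
  constructor
  · rintro ⟨h0, h1⟩ (k | k)
    · simpa [basisDegree] using h0 k
    · exact h1 k
  · exact fun h => ⟨fun k => by simpa [basisDegree] using h (Sum.inl k), fun k => h (Sum.inr k)⟩

theorem isSuperModule_columnGrading (h : IsSuperCommRing 𝒜) :
    IsSuperModule 𝒜 (columnGrading 𝒜 I J) := by
  have := h.graded
  obtain ⟨h0, h1⟩ := (isInternal_zmod_two_iff 𝒜).mp h.internal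
  refine ⟨(isInternal_zmod_two_iff _).mpr ⟨fun v hv hw => funext fun k => ?_, fun v => ?_⟩,
    fun i j a v hv ha => ?_⟩
  · have hv := mem_columnGrading.mp hv k
    have hw := mem_columnGrading.mp hw k
    rcases k with k | k
    · exact h0 _ hv hw
    · exact h0 _ hw hv
  · choose y hy z hz e using fun k => h1 (v k)
    refine ⟨Sum.elim (fun k => y (Sum.inl k)) fun k => z (Sum.inr k), ?_,
      Sum.elim (fun k => z (Sum.inl k)) fun k => y (Sum.inr k), ?_, funext fun k => ?_⟩
    · exact ⟨fun k => hy _, fun k => hz _⟩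
    · exact ⟨fun k => hz _, fun k => hy _⟩
    · rcases k with k | k
      · exact e _
      · exact (add_comm _ _).trans (e _)
  · rw [mem_columnGrading] at hv ⊢
    intro k
    have := SetLike.GradedMul.mul_mem (hv k) ha
    rwa [add_right_comm] at this

/-- Left multiplication of columns by a matrix, as a map of right modules. -/
def matrixColumns {ι : Type*} [Fintype ι] (P : Matrix ι ι R) : (ι → R) →ₗ[Rᵐᵒᵖ] (ι → R) where
  toFun v := P.mulVec v
  map_add' := Matrix.mulVec_add P
  map_smul' a v := by
    funext i
    simp [Matrix.mulVec, dotProduct, Finset.sum_mul, mul_assoc]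

theorem matrixColumns_idempotent {ι : Type*} [Fintype ι] {P : Matrix ι ι R} (hP : P * P = P) :
    matrixColumns P ∘ₗ matrixColumns P = matrixColumns P := by
  ext v : 1
  exact (Matrix.mulVec_mulVec v P P).trans (by rw [hP]; rfl)

theorem matrixColumns_even [SetLike.GradedMonoid 𝒜] [Fintype I] [Fintype J]
    {P : Matrix (I ⊕ J) (I ⊕ J) R} (hP : ∀ k l, P k l ∈ 𝒜 (basisDegree k + basisDegree l))
    {i : ZMod 2} {v : I ⊕ J → R} (hv : v ∈ columnGrading 𝒜 I J i) :
    matrixColumns P v ∈ columnGrading 𝒜 I J i := by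
  rw [mem_columnGrading] at hv ⊢
  intro k
  refine sum_mem fun l _ => ?_
  have h := SetLike.GradedMul.mul_mem (hP k l) (hv l)
  have e : basisDegree k + basisDegree l + (i + basisDegree l) = i + basisDegree k := by
    have : ∀ x y z : ZMod 2, x + y + (z + y) = z + x := by decide
    exact this _ _ _
  rwa [e] at h

end Columns

theorem isSuperModule_submoduleGrading {R M : Type*} [Ring R] [AddCommGroup M] [Module Rᵐᵒᵖ M]
    {𝒜 : ZMod 2 → AddSubgroup R} {ℳ : ZMod 2 → AddSubgroup M} (h : IsSuperModule 𝒜 ℳ)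
    (N : Submodule Rᵐᵒᵖ M) (hN : ∀ x ∈ N, ∃ y ∈ ℳ 0, ∃ z ∈ ℳ 1, y ∈ N ∧ z ∈ N ∧ y + z = x) :
    IsSuperModule 𝒜 (submoduleGrading ℳ N) := by
  obtain ⟨h0, -⟩ := (isInternal_zmod_two_iff ℳ).mp h.internal
  refine ⟨(isInternal_zmod_two_iff _).mpr ⟨fun x hx hx' => Subtype.ext (h0 _ hx hx'), ?_⟩,
    fun i j a x hx ha => h.smul_mem i j a x hx ha⟩
  rintro ⟨x, hx⟩
  obtain ⟨y, hy, z, hz, hyN, hzN, e⟩ := hN x hx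
  exact ⟨⟨y, hyN⟩, hy, ⟨z, hzN⟩, hz, Subtype.ext e⟩

/-- The image of an even idempotent of a free supermodule of finite rank is super projective: its
complement is the kernel. -/
theorem isSuperProjective_range {R I J : Type} [Ring R] [Finite I] [Finite J]
    {𝒜 : ZMod 2 → AddSubgroup R} (h𝒜 : IsSuperCommRing 𝒜)
    (E : (I ⊕ J → R) →ₗ[Rᵐᵒᵖ] (I ⊕ J → R)) (hE : E ∘ₗ E = E)
    (heven : ∀ i F, F ∈ columnGrading 𝒜 I J i → E F ∈ columnGrading 𝒜 I J i) :
    IsSuperProjective 𝒜 (submoduleGrading (columnGrading 𝒜 I J) (LinearMap.range E)) := by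
  have hM : IsSuperModule 𝒜 (columnGrading 𝒜 I J) := isSuperModule_columnGrading h𝒜
  obtain ⟨-, h1⟩ := (isInternal_zmod_two_iff _).mp hM.internal
  have hEE : ∀ v, E (E v) = E v := fun v => LinearMap.congr_fun hE v
  have hr : ∀ x ∈ LinearMap.range E, E x = x := by
    rintro _ ⟨v, rfl⟩; exact hEE v
  refine ⟨isSuperModule_submoduleGrading hM _ fun x hx => ?_, I, J, LinearMap.ker E, inferInstance,
    inferInstance, submoduleGrading (columnGrading 𝒜 I J) (LinearMap.ker E),
    isSuperModule_submoduleGrading hM _ fun x hx => ?_, ?_⟩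
  · obtain ⟨y, hy, z, hz, e⟩ := h1 x
    refine ⟨E y, heven _ _ hy, E z, heven _ _ hz, ⟨y, rfl⟩, ⟨z, rfl⟩, ?_⟩
    rw [← map_add, e, hr x hx]
  · obtain ⟨y, hy, z, hz, e⟩ := h1 x
    refine ⟨y - E y, sub_mem hy (heven _ _ hy), z - E z, sub_mem hz (heven _ _ hz), ?_, ?_, ?_⟩
    · rw [LinearMap.mem_ker, map_sub, hEE, sub_self]
    · rw [LinearMap.mem_ker, map_sub, hEE, sub_self]
    · rw [sub_add_sub_comm, ← map_add, e, LinearMap.mem_ker.mp hx, sub_zero]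
  · have hc : IsCompl (LinearMap.range E) (LinearMap.ker E) :=
      LinearMap.IsIdempotentElem.isCompl (f := E) hE
    let e := (Submodule.prodEquivOfIsCompl _ _ hc).trans
      (Finsupp.linearEquivFunOnFinite Rᵐᵒᵖ R (I ⊕ J)).symm
    refine ⟨e, fun i z => ?_⟩
    have he : ∀ z, e z ∈ freeGrading 𝒜 I J i ↔
        (z.1 : I ⊕ J → R) + z.2 ∈ columnGrading 𝒜 I J i := fun z => Iff.rfl
    rw [he]
    have e1 : E ((z.1 : I ⊕ J → R) + z.2) = z.1 := by
      rw [map_add, hr _ z.1.2, LinearMap.mem_ker.mp z.2.2, add_zero]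
    constructor
    · rintro ⟨ha, hb⟩
      exact add_mem ha hb
    · intro h
      have h2 := heven _ _ h
      rw [e1] at h2
      refine ⟨h2, ?_⟩
      have h3 := sub_mem h h2
      rwa [add_sub_cancel_left] at h3

/-! ### The superring of `GH^∞` functions -/

section GHRing

variable {L m L' : ℕ} {X : Type} {c : SuperCoords L m X}

theorem Gr.mul_mem_part {i j : ZMod 2} {z w : Gr L} (hz : z ∈ part L i) (hw : w ∈ part L j) :
    z * w ∈ part L (i + j) :=
  CliffordAlgebra.evenOdd_mul_le _ i j (Submodule.mul_mem_mul hz hw)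

theorem Gr.parity_mem_part (z : Gr L) :
    (1 / 2 : ℂ) • (z + parity L z) ∈ part L 0 ∧ (1 / 2 : ℂ) • (z - parity L z) ∈ part L 1 := by
  have h : z ∈ part L 0 ⊔ part L 1 := by
    have := (CliffordAlgebra.evenOdd_isCompl (0 : QuadraticForm ℂ (Fin L → ℂ))).sup_eq_top
    exact this.symm ▸ Submodule.mem_top (x := z)
  obtain ⟨a, ha, b, hb, rfl⟩ := Submodule.mem_sup.mp h
  rw [map_add, parity_even ha, parity_odd hb]
  have e1 : (1 / 2 : ℂ) • (a + b + (a + -b)) = a := by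
    rw [show a + b + (a + -b) = (2 : ℂ) • a by rw [two_smul]; abel, smul_smul]; norm_num
  have e2 : (1 / 2 : ℂ) • (a + b - (a + -b)) = b := by
    rw [show a + b - (a + -b) = (2 : ℂ) • b by rw [two_smul]; abel, smul_smul]; norm_num
  rw [e1, e2]
  exact ⟨ha, hb⟩

theorem Gr.eq_zero_of_mem_parts {z : Gr L} (h0 : z ∈ part L 0) (h1 : z ∈ part L 1) : z = 0 :=
  (Submodule.disjoint_def.mp
    (CliffordAlgebra.evenOdd_isCompl (0 : QuadraticForm ℂ (Fin L → ℂ))).disjoint) z h0 h1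

theorem IsGH.parity {f : X → Gr L} (hf : IsGH c L' f) : IsGH c L' (fun p => Gr.parity L (f p)) := by
  intro p₀
  obtain ⟨V, hV, hp, F, hF, hf⟩ := hf p₀
  have m1 : ∀ k : ℕ, ((-1) ^ k : Gr L) ∈ Gr.sub L L' := fun k => pow_mem (neg_mem (one_mem _)) k
  refine ⟨V, hV, hp, fun i j => (fun p => Gr.parity L (F i j p)) * fun _ => (-1) ^ (i.val + j.val),
    fun i j => (hF i j).parity.mul hV (.const (m1 _)), fun p hp => ?_⟩
  have e := hf p hp
  have h0 := Gr.parity_odd (c.ξ_mem p 0)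
  have h1 := Gr.parity_odd (c.ξ_mem p 1)
  simp [e, Fin.sum_univ_two, h0, h1]

theorem isSuperCommRing_grading : IsSuperCommRing (GHFun.grading c L') := by
  refine ⟨{ one_mem := fun p => Gr.one_even
            mul_mem := fun i j f g hf hg p => Gr.mul_mem_part (hf p) (hg p) },
    (isInternal_zmod_two_iff _).mpr ⟨fun f h0 h1 => ?_, fun f => ?_⟩, ?_⟩
  · exact Subtype.ext (funext fun p => Gr.eq_zero_of_mem_parts (h0 p) (h1 p))
  · refine ⟨⟨_, (f.2.add (IsGH.parity f.2)).smul (1 / 2)⟩, fun p => (Gr.parity_mem_part _).1,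
      ⟨_, (f.2.sub (IsGH.parity f.2)).smul (1 / 2)⟩, fun p => (Gr.parity_mem_part _).2,
      Subtype.ext (funext fun p => ?_)⟩
    change (1 / 2 : ℂ) • (f.1 p + Gr.parity L (f.1 p)) + (1 / 2 : ℂ) • (f.1 p - Gr.parity L (f.1 p)) =
      f.1 p
    rw [← smul_add, add_add_sub_cancel, ← two_smul ℂ, smul_smul]
    norm_num
  · intro i j f g hf hg
    refine Subtype.ext (funext fun p => ?_)
    change f.1 p * g.1 p = ((-1) ^ (i.val * j.val) : Gr L) * (g.1 p * f.1 p)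
    have hf := hf p
    have hg := hg p
    have h01 : ∀ i : ZMod 2, i = 0 ∨ i = 1 := by decide
    obtain rfl | rfl := h01 i
    · rw [ZMod.val_zero, zero_mul, pow_zero, one_mul]
      exact Gr.even_comm hf _
    obtain rfl | rfl := h01 j
    · rw [ZMod.val_zero, mul_zero, pow_zero, one_mul]
      exact (Gr.even_comm hg _).symm
    · rw [ZMod.val_one, mul_one, pow_one, neg_one_mul]
      exact Gr.odd_swap hf hg

end GHRing

/-! ### The projectors -/

namespace UOSP

variable {L L' : ℕ} {D : GradedInvolution L}

theorem odd_norm_even (s : UOSP D) : s.η * D s.η ∈ Gr.part L 0 :=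
  Gr.odd_mul_odd s.η_mem (D.map_mem 1 _ s.η_mem)

theorem map_sqrt_smul (D : GradedInvolution L) (k : ℕ) (z : Gr L) :
    D ((Real.sqrt k : ℂ) • z) = (Real.sqrt k : ℂ) • D z := by
  rw [D.map_smul, Complex.conj_ofReal]

theorem map_odd_norm (s : UOSP D) : D (s.η * D s.η) = s.η * D s.η := by
  rw [D.map_mul, D.odd_invol s.η_mem, mul_neg, ← Gr.odd_swap s.η_mem (D.map_mem 1 _ s.η_mem)]

theorem map_one_sub_odd_norm (s : UOSP D) :
    D (1 - (1 / 8 : ℂ) • (s.η * D s.η)) = 1 - (1 / 8 : ℂ) • (s.η * D s.η) := by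
  rw [D.map_sub, D.map_one, D.map_smul, map_odd_norm,
    show (starRingEnd ℂ) (1 / 8) = 1 / 8 by simp [Complex.ext_iff]]

theorem ket_inl (n : ℕ) (s : UOSP D) (k : Fin (n + 1)) : s.ket n (Sum.inl k) =
    (1 - (1 / 8 : ℂ) • (s.η * D s.η)) *
      ((Real.sqrt (n.choose k) : ℂ) • (s.a ^ (n - k) * s.b ^ (k : ℕ))) := by
  rw [ket, bra, D.map_mul, map_one_sub_odd_norm, map_sqrt_smul, D.map_mul, D.map_pow, D.map_pow,
    D.even_invol s.a_mem, D.even_invol s.b_mem]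

theorem ket_inr (n : ℕ) (s : UOSP D) (k : Fin n) : s.ket n (Sum.inr k) =
    (-(1 / 2 : ℂ) • s.η) *
      ((Real.sqrt ((n - 1).choose k) : ℂ) • (s.a ^ (n - 1 - k) * s.b ^ (k : ℕ))) := by
  rw [ket, bra, D.map_mul, D.map_smul, D.odd_invol s.η_mem, map_sqrt_smul, D.map_mul, D.map_pow,
    D.map_pow, D.even_invol s.a_mem, D.even_invol s.b_mem,
    show (starRingEnd ℂ) (1 / 2) = 1 / 2 by simp [Complex.ext_iff], smul_neg, neg_smul]

/-- The binomial theorem for `(a a^◇ + b b^◇)^n = 1`, with outer factors `v` and `w`. -/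
theorem sum_binomial (s : UOSP D) (n : ℕ) (v w : Gr L) :
    ∑ k ∈ Finset.range (n + 1),
      v * ((Real.sqrt (n.choose k) : ℂ) • (D s.a ^ (n - k) * D s.b ^ k)) *
        (w * ((Real.sqrt (n.choose k) : ℂ) • (s.a ^ (n - k) * s.b ^ k))) = v * w := by
  have ha' := D.map_mem 0 _ s.a_mem
  have hb' := D.map_mem 0 _ s.b_mem
  have term : ∀ k, v * ((Real.sqrt (n.choose k) : ℂ) • (D s.a ^ (n - k) * D s.b ^ k)) *
        (w * ((Real.sqrt (n.choose k) : ℂ) • (s.a ^ (n - k) * s.b ^ k))) =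
      v * w * ((s.b * D s.b) ^ k * (s.a * D s.a) ^ (n - k) * (n.choose k : Gr L)) := fun k => by
    have hX : D s.a ^ (n - k) * D s.b ^ k ∈ Gr.part L 0 :=
      Gr.even_mul (Gr.even_pow ha' _) (Gr.even_pow hb' _)
    have hc : (Real.sqrt (n.choose k) : ℂ) * (Real.sqrt (n.choose k) : ℂ) = (n.choose k : ℂ) := by
      rw [← Complex.ofReal_mul, Real.mul_self_sqrt (Nat.cast_nonneg _), Complex.ofReal_natCast]
    have e1 : (s.a * D s.a) ^ (n - k) = s.a ^ (n - k) * D s.a ^ (n - k) :=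
      Commute.mul_pow (Gr.even_comm s.a_mem _) _
    have e2 : (s.b * D s.b) ^ k = s.b ^ k * D s.b ^ k :=
      Commute.mul_pow (Gr.even_comm s.b_mem _) _
    have e3 : D s.a ^ (n - k) * D s.b ^ k * (s.a ^ (n - k) * s.b ^ k) =
        (s.b * D s.b) ^ k * (s.a * D s.a) ^ (n - k) := by
      rw [e1, e2, Gr.even_comm (Gr.even_pow ha' _),
        ← Gr.even_comm (Gr.even_mul (Gr.even_pow s.a_mem _) (Gr.even_pow s.b_mem _)),
        Gr.even_comm (Gr.even_pow s.a_mem _)]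
      simp only [mul_assoc]
      congr 1
      rw [← mul_assoc, Gr.even_comm (Gr.even_pow s.a_mem _), mul_assoc]
    have e4 : v * (D s.a ^ (n - k) * D s.b ^ k) * (w * (s.a ^ (n - k) * s.b ^ k)) =
        v * w * ((s.b * D s.b) ^ k * (s.a * D s.a) ^ (n - k)) := by
      rw [← e3, mul_assoc v, ← mul_assoc _ w, Gr.even_comm hX, mul_assoc w, ← mul_assoc v]
    rw [mul_smul_comm, mul_smul_comm, mul_smul_comm, smul_mul_assoc, smul_smul, hc, e4,
      Nat.cast_smul_eq_nsmul, nsmul_eq_mul', mul_assoc]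
  rw [Finset.sum_congr rfl fun k _ => term k, ← Finset.mul_sum, ← Commute.add_pow, add_comm, s.norm,
    one_pow, mul_one]
  exact Gr.even_comm (Gr.even_mul s.b_mem hb') _

/-- The normalization `⟨ψ_n|ψ_n⟩ = 1`. -/
theorem bra_ket {n : ℕ} (hn : 1 ≤ n) (s : UOSP D) : ∑ i, s.bra n i * s.ket n i = 1 := by
  have htt := Gr.odd_mul_sq s.η_mem (D.map_mem 1 _ s.η_mem)
  rw [Fintype.sum_sum_type]
  have e1 : ∑ k : Fin (n + 1), s.bra n (Sum.inl k) * s.ket n (Sum.inl k) =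
      1 - (1 / 4 : ℂ) • (s.η * D s.η) := by
    simp only [ket_inl, bra]
    rw [Fin.sum_univ_eq_sum_range (fun k => (1 - (1 / 8 : ℂ) • (s.η * D s.η)) *
      ((Real.sqrt (n.choose k) : ℂ) • (D s.a ^ (n - k) * D s.b ^ k)) *
        ((1 - (1 / 8 : ℂ) • (s.η * D s.η)) *
          ((Real.sqrt (n.choose k) : ℂ) • (s.a ^ (n - k) * s.b ^ k)))), sum_binomial, sub_mul,
      one_mul, mul_sub, mul_one, smul_mul_smul_comm, htt, smul_zero, sub_zero, sub_sub, ← add_smul]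
    norm_num
  have e2 : ∑ k : Fin n, s.bra n (Sum.inr k) * s.ket n (Sum.inr k) =
      (1 / 4 : ℂ) • (s.η * D s.η) := by
    obtain ⟨m, rfl⟩ := Nat.exists_eq_add_of_le' hn
    simp only [ket_inr, bra, Nat.add_sub_cancel]
    rw [Fin.sum_univ_eq_sum_range (fun k => ((1 / 2 : ℂ) • D s.η) *
      ((Real.sqrt (m.choose k) : ℂ) • (D s.a ^ (m - k) * D s.b ^ k)) *
        ((-(1 / 2 : ℂ) • s.η) * ((Real.sqrt (m.choose k) : ℂ) • (s.a ^ (m - k) * s.b ^ k)))),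
      sum_binomial, smul_mul_smul_comm, Gr.odd_swap (D.map_mem 1 _ s.η_mem) s.η_mem, smul_neg,
      ← neg_smul]
    norm_num
  rw [e1, e2, sub_add_cancel]

theorem sum_proj_mul_proj {n : ℕ} (hn : 1 ≤ n) (s : UOSP D) (i k : Fin (n + 1) ⊕ Fin n) :
    ∑ j, s.proj n i j * s.proj n j k = s.proj n i k := by
  simp only [proj, Matrix.vecMulVec_apply]
  calc ∑ j, s.ket n i * s.bra n j * (s.ket n j * s.bra n k)
      = s.ket n i * (∑ j, s.bra n j * s.ket n j) * s.bra n k := by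
        rw [Finset.mul_sum, Finset.sum_mul]
        exact Finset.sum_congr rfl fun j _ => by simp only [mul_assoc]
    _ = _ := by rw [bra_ket hn, mul_one]

theorem bra_mem (n : ℕ) (s : UOSP D) (i : Fin (n + 1) ⊕ Fin n) :
    s.bra n i ∈ Gr.part L (basisDegree i) := by
  have hX : ∀ j k, D s.a ^ j * D s.b ^ k ∈ Gr.part L 0 := fun j k =>
    Gr.even_mul (Gr.even_pow (D.map_mem 0 _ s.a_mem) _) (Gr.even_pow (D.map_mem 0 _ s.b_mem) _)
  rcases i with k | k
  · exact Gr.even_mul (sub_mem Gr.one_even (Submodule.smul_mem _ _ s.odd_norm_even))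
      (Submodule.smul_mem _ _ (hX _ _))
  · have := Gr.mul_mem_part (Submodule.smul_mem _ (1 / 2 : ℂ) (D.map_mem 1 _ s.η_mem))
      (Submodule.smul_mem _ (Real.sqrt ((n - 1).choose k) : ℂ) (hX (n - 1 - k) k))
    rwa [add_zero] at this

theorem proj_mem (n : ℕ) (s : UOSP D) (i j : Fin (n + 1) ⊕ Fin n) :
    s.proj n i j ∈ Gr.part L (basisDegree i + basisDegree j) :=
  Gr.mul_mem_part (D.map_mem _ _ (s.bra_mem n i)) (s.bra_mem n j)

theorem pow_mem_superU1 {w : Gr L} (hw : w ∈ superU1 D) (n : ℕ) : w ^ n ∈ superU1 D := by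
  refine ⟨?_, ?_⟩
  · exact Gr.even_pow hw.1 n
  · rw [D.map_pow, ← Commute.mul_pow (Gr.even_comm hw.1 _), hw.2, one_pow]

/-- Under the action of `w`, the row `⟨ψ_n|` is multiplied by `(w^◇)^n`. -/
theorem bra_action {s s' : UOSP D} {w : Gr L} (hw : w ∈ superU1 D) (ha : s'.a = s.a * w)
    (hb : s'.b = s.b * w) (hη : s'.η = s.η * w) (n : ℕ) (i : Fin (n + 1) ⊕ Fin n) :
    s'.bra n i = s.bra n i * D w ^ n := by
  have hw' := D.map_mem 0 _ hw.1
  have hX : ∀ j k, D (s.a * w) ^ j * D (s.b * w) ^ k = D s.a ^ j * D s.b ^ k * D w ^ (j + k) :=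
    fun j k => by
      have c : ∀ z, Commute z (D w) := fun z => (Gr.even_comm hw' z).symm
      rw [D.map_mul, D.map_mul, (c _).mul_pow, (c _).mul_pow, pow_add, mul_assoc, mul_assoc]
      congr 1
      rw [← mul_assoc, ((c (D s.b ^ k)).pow_right j).symm.eq, mul_assoc]
  rcases i with k | k
  · simp only [bra]
    rw [hη, ha, hb, D.map_mul s.η, mul_cancel_superU1 hw, hX, Nat.sub_add_cancel k.is_le,
      mul_assoc (1 - _), smul_mul_assoc]
  · have hk := k.isLt
    simp only [bra]
    rw [hη, ha, hb, D.map_mul s.η, hX, show n - 1 - (k : ℕ) + k = n - 1 by omega]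
    have e : D w ^ n = D w * D w ^ (n - 1) := by
      rw [← pow_succ', Nat.sub_add_cancel (by omega)]
    rw [e]
    simp only [smul_mul_assoc, mul_smul_comm]
    rw [mul_assoc, ← mul_assoc (D w), Gr.even_comm hw']
    simp only [mul_assoc]

theorem proj_action {s s' : UOSP D} {w : Gr L} (hw : w ∈ superU1 D) (ha : s'.a = s.a * w)
    (hb : s'.b = s.b * w) (hη : s'.η = s.η * w) (n : ℕ) (i j : Fin (n + 1) ⊕ Fin n) :
    s'.proj n i j = s.proj n i j := by
  simp only [proj, Matrix.vecMulVec_apply, ket]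
  rw [bra_action hw ha hb hη, bra_action hw ha hb hη, D.map_mul, D.map_pow, D.even_invol hw.1,
    ← D.map_pow]
  exact mul_cancel_superU1 (pow_mem_superU1 hw n) _ _

theorem proj_eq_of_hopf_eq {s s' : UOSP D} (h : hopf s = hopf s') (n : ℕ)
    (i j : Fin (n + 1) ⊕ Fin n) : s'.proj n i j = s.proj n i j := by
  obtain ⟨w, hw, ha, hb, hη⟩ := exists_action_of_hopf_eq h
  exact proj_action hw ha hb hη n i j

theorem isGH_proj (n : ℕ) (i j : Fin (n + 1) ⊕ Fin n) :
    IsGH (UOSP.coords D) L' (fun s => s.proj n i j) := by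
  have h1 : IsGH (UOSP.coords D) L' (fun _ => (1 : Gr L)) := isGH_const (one_mem _)
  have ht : IsGH (UOSP.coords D) L' (fun s => 1 - (1 / 8 : ℂ) • (s.η * D s.η)) :=
    h1.sub ((isGH_η.mul isGH_map_η).smul _)
  have hket : ∀ i, IsGH (UOSP.coords D) L' (fun s => s.ket n i) := by
    rintro (k | k)
    · simp only [ket_inl]
      exact ht.mul (((isGH_a.pow _).mul (isGH_b.pow _)).smul _)
    · simp only [ket_inr]
      exact (isGH_η.smul _).mul (((isGH_a.pow _).mul (isGH_b.pow _)).smul _)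
  have hbra : ∀ i, IsGH (UOSP.coords D) L' (fun s => s.bra n i) := by
    rintro (k | k)
    · exact ht.mul (((isGH_map_a.pow _).mul (isGH_map_b.pow _)).smul _)
    · exact (isGH_map_η.smul _).mul (((isGH_map_a.pow _).mul (isGH_map_b.pow _)).smul _)
  exact (hket i).mul (hbra j)

/-- The entries of `p_n` as functions on the supersphere. -/
noncomputable def sphereProj (D : GradedInvolution L) (n : ℕ) (p : SuperSphere D) :
    Matrix (Fin (n + 1) ⊕ Fin n) (Fin (n + 1) ⊕ Fin n) (Gr L) :=
  (Function.surjInv hopf_surjective p).proj n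

theorem sphereProj_hopf (n : ℕ) (s : UOSP D) : sphereProj D n (hopf s) = s.proj n :=
  Matrix.ext fun i j =>
    proj_eq_of_hopf_eq (Function.surjInv_eq hopf_surjective (hopf s)).symm n i j

theorem isGH_sphereProj (n : ℕ) (i j : Fin (n + 1) ⊕ Fin n) :
    IsGH (SuperSphere.coords D) L' (fun p => sphereProj D n p i j) := by
  refine isGH_of_comp_hopf ?_
  have e : (fun p => sphereProj D n p i j) ∘ hopf = fun s => s.proj n i j :=
    funext fun s => by rw [Function.comp_apply, sphereProj_hopf]
  rw [e]
  exact isGH_proj n i j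

end UOSP

open UOSP

theorem GHFun.sum_apply {L m L' : ℕ} {X : Type} {c : SuperCoords L m X} {ι : Type*} (s : Finset ι)
    (f : ι → GHFun c L') (p : X) : (∑ i ∈ s, f i).1 p = ∑ i ∈ s, (f i).1 p := by
  rw [AddSubmonoidClass.coe_finsetSum, Finset.sum_apply]

theorem mainTheorem9 (r L' : ℕ) (D : GradedInvolution (2 * r)) (n : ℕ) (hn : 1 ≤ n) :
    -- `S^{2,2} ≅ UOSP(1,2) / 𝒰(1)`, the orbit space with its induced `GH^∞` structure
    (Function.Surjective (hopf (D := D)) ∧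
      (∀ s s' : UOSP D, hopf s = hopf s' ↔
        ∃ w ∈ superU1 D, s'.toMatrix = s.toMatrix * superU1.toMatrix D w) ∧
      (∀ f : SuperSphere D → Gr (2 * r),
        IsGH (SuperSphere.coords D) L' f ↔ IsGH (UOSP.coords D) L' (f ∘ hopf))) ∧
    -- `𝒜` is a super commutative ring, and the columns form a supermodule over it
    IsSuperCommRing (GHFun.grading (SuperSphere.coords D) L') ∧
    IsSuperModule (GHFun.grading (SuperSphere.coords D) L')
      (columnGrading (GHFun.grading (SuperSphere.coords D) L') (Fin (n + 1)) (Fin n)) ∧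
    -- `p_n` defines an idempotent `π_n` of the module of columns over `ℬ`
    (∃ π : Columns (UOSPFun D L') n →ₗ[(UOSPFun D L')ᵐᵒᵖ] Columns (UOSPFun D L') n,
      (∀ F i s, (π F i).1 s = ∑ j, s.proj n i j * (F j).1 s) ∧ π ∘ₗ π = π) ∧
    -- and it induces an idempotent of the module of columns over `𝒜`, with super projective image
    (∃! π' : Columns (SphereFun D L') n →ₗ[(SphereFun D L')ᵐᵒᵖ] Columns (SphereFun D L') n,
      ∀ F i s, (π' F i).1 (hopf s) = ∑ j, s.proj n i j * (F j).1 (hopf s)) ∧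
    (∀ π' : Columns (SphereFun D L') n →ₗ[(SphereFun D L')ᵐᵒᵖ] Columns (SphereFun D L') n,
      (∀ F i s, (π' F i).1 (hopf s) = ∑ j, s.proj n i j * (F j).1 (hopf s)) →
        π' ∘ₗ π' = π' ∧
        (∀ i F, F ∈ columnGrading (GHFun.grading (SuperSphere.coords D) L')
            (Fin (n + 1)) (Fin n) i →
          π' F ∈ columnGrading (GHFun.grading (SuperSphere.coords D) L')
            (Fin (n + 1)) (Fin n) i) ∧
        IsSuperProjective (GHFun.grading (SuperSphere.coords D) L')
          (submoduleGrading (columnGrading (GHFun.grading (SuperSphere.coords D) L')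
            (Fin (n + 1)) (Fin n)) (LinearMap.range π'))) := by
  let P : Matrix (Fin (n + 1) ⊕ Fin n) (Fin (n + 1) ⊕ Fin n) (UOSPFun D L') :=
    fun i j => ⟨fun s => s.proj n i j, isGH_proj n i j⟩
  let P' : Matrix (Fin (n + 1) ⊕ Fin n) (Fin (n + 1) ⊕ Fin n) (SphereFun D L') :=
    fun i j => ⟨fun p => sphereProj D n p i j, isGH_sphereProj n i j⟩
  have hring : IsSuperCommRing (GHFun.grading (SuperSphere.coords D) L') := isSuperCommRing_grading
  have hgraded := hring.graded
  have hPP : P * P = P := by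
    refine Matrix.ext fun i k => Subtype.ext (funext fun s => ?_)
    rw [Matrix.mul_apply, GHFun.sum_apply]
    exact sum_proj_mul_proj hn s i k
  have hPP' : P' * P' = P' := by
    refine Matrix.ext fun i k => Subtype.ext (funext fun p => ?_)
    rw [Matrix.mul_apply, GHFun.sum_apply]
    exact sum_proj_mul_proj hn _ i k
  have hP : ∀ F i s, (matrixColumns P F i).1 s = ∑ j, s.proj n i j * (F j).1 s :=
    fun F i s => GHFun.sum_apply _ _ s
  have hP' : ∀ F i s, (matrixColumns P' F i).1 (hopf s) = ∑ j, s.proj n i j * (F j).1 (hopf s) :=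
    fun F i s => by
      rw [← sphereProj_hopf]
      exact GHFun.sum_apply _ _ (hopf s)
  have huniq : ∀ π' : Columns (SphereFun D L') n →ₗ[(SphereFun D L')ᵐᵒᵖ] Columns (SphereFun D L') n,
      (∀ F i s, (π' F i).1 (hopf s) = ∑ j, s.proj n i j * (F j).1 (hopf s)) →
        π' = matrixColumns P' := fun π' h => by
    refine LinearMap.ext fun F => funext fun i => Subtype.ext (funext fun p => ?_)
    obtain ⟨s, rfl⟩ := hopf_surjective p
    rw [h, hP']
  have hdeg : ∀ k l, P' k l ∈ GHFun.grading (SuperSphere.coords D) L'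
      (basisDegree k + basisDegree l) := fun k l p => proj_mem n _ k l
  have heven : ∀ i F, F ∈ columnGrading (GHFun.grading (SuperSphere.coords D) L')
      (Fin (n + 1)) (Fin n) i → matrixColumns P' F ∈ columnGrading
        (GHFun.grading (SuperSphere.coords D) L') (Fin (n + 1)) (Fin n) i := fun i F hF =>
    matrixColumns_even hdeg hF
  refine ⟨⟨hopf_surjective, hopf_eq_iff, fun f => ⟨isGH_comp_hopf, isGH_of_comp_hopf⟩⟩, hring,
    isSuperModule_columnGrading hring, ⟨matrixColumns P, hP, matrixColumns_idempotent hPP⟩,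
    ⟨matrixColumns P', hP', huniq⟩, fun π' h => ?_⟩
  obtain rfl := huniq π' h
  exact ⟨matrixColumns_idempotent hPP', heven,
    isSuperProjective_range hring _ (matrixColumns_idempotent hPP') heven⟩
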